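/- Let $\mathcal E,\omega,h,\mu>0$ with $\mathcal E>\omega^2/2$, and put $I_c=\sqrt{\mathcal E-\omega^2/2}$, $V_E(z)=\mathcal E-\frac{\omega^2}{2}|z|^2$, $V_I(z)=\mathcal E+h+\frac{\mu}{|z|}$ for $z\in\mathbb R^2$ (with $z\ne 0$ for $V_I$). For $I\in(-I_c,I_c)$ let $$\theta_E(I)=\operatorname{arccot}\Big(\tfrac{\mathcal E-2I^2}{I\sqrt{4\mathcal E-2(2I^2+\omega^2)}}\Big)-\pi\,\mathbf 1_{\{I<0\}}\ (I\neq0),\qquad \theta_E(0)=0,$$ $$\theta_I(I)=\operatorname{sign}(I)\Big[2\arccos\Big(\tfrac{2I^2-\mu}{\sqrt{4(\mathcal E+h)I^2+\mu^2}}\Big)-2\pi\Big]\ (I\ne0),\qquad \theta_I(0)=0,$$ where $\operatorname{arccot}$ takes values in $(0,\pi)$ (these are the angular shifts of the outer and inner arcs when the domain is the unit disc), and let $$\mathcal J=\{I\in(-I_c,I_c):\ \theta_E'(I)+\theta_I'(I)=0\}.$$ Let $k\ge2$ be an integer, $C>0$, and let $f(\xi;\epsilon)$ be of class $C^k$ on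 $\mathbb R\times[-C,C]$ and $2\pi$-periodic in $\xi$ (for instance, $f\in C^k(\mathbb R/2\pi\mathbb Z)$ independent of $\epsilon$). For small $|\epsilon|$ let $D_\epsilon$ be the domain, containing the origin, bounded by the curve $\gamma(\xi)=(1+\epsilon f(\xi;\epsilon))(\cos\xi,\sin\xi)$. The first return map on $D_\epsilon$ is defined as follows. The outer arc starting at $\gamma(\xi_0)$ with velocity $v_0$ pointing strictly outwards, with $\frac12|v_0|^2=V_E(\gamma(\xi_0))$, and with angle $\alpha_0\in(-\pi/2,\pi/2)$ from the outward normal (positive towards $\dot\gamma$), has action $I_0=\sqrt{V_E(\gamma(\xi_0))}\,\sin\alpha_0\,|\dot\gamma(\xi_0)|$. Follow the solution of $z''=-\omega^2z$, outside $\overline{D_\epsilon}$, up to its first return to $\partial D_\epsilon$, where it arrives strictly inwards. Refract it by Snell's law $\sqrt{V_I}\sin\alpha_I=\sqrt{V_E}\sin\alpha_E$ (angles with the normal) into a velocity $v$ pointing strictly inwards with $\frac12|v|^2=V_I$. Follow the solution of $z''=-\mu z/|z|^3$ inside $D_\epsilon$ (collisions with the origin being regularised by the elastic bounce, in which the particle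 goes back along its path) up to its first return to $\partial D_\epsilon$, at $\gamma(\xi_1)$, where it arrives strictly outwards. Refract it by Snell's law into a velocity $v_1$ pointing strictly outwards with $\frac12|v_1|^2=V_E(\gamma(\xi_1))$, and let $I_1$ be the action of $v_1$ at $\gamma(\xi_1)$. Then $\mathcal F(\xi_0,I_0;\epsilon)=(\xi_1,I_1)$. **Proposition.** The set $\mathcal J$ is finite. Moreover, for every $a<b$ with $[a,b]\subset(-I_c,I_c)\setminus\mathcal J$ there is $\epsilon_0>0$ such that, for every $\epsilon$ with $|\epsilon|<\epsilon_0$: 1. the first return map $\mathcal F(\xi_0,I_0;\epsilon)=(\xi_1(\xi_0,I_0;\epsilon),I_1(\xi_0,I_0;\epsilon))$ on $D_\epsilon$ is well defined on $\mathbb R/2\pi\mathbb Z\times[a,b]$ (the construction can be carried out from every such point, with a unique result in $\mathbb R/2\pi\mathbb Z\times\mathbb R$), and it has a lift to $\mathbb R\times[a,b]$ of class $C^{k-2}$; 2. it is area preserving: the lift is differentiable at every point of $\mathbb R\times[a,b]$ with Jacobian determinant $1$, and $\mathcal F(A;\epsilon)$ has the same area as $A$ for every measurable $A\subset\mathbb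 R/2\pi\mathbb Z\times[a,b]$, for the area $d\xi\,dI$; 3. $\dfrac{\partial\xi_1}{\partial I_0}(\xi_0,I_0;\epsilon)$ exists and is nonzero for every $(\xi_0,I_0)\in\mathbb R/2\pi\mathbb Z\times[a,b]$ (one-sided derivatives are meant at $I_0=a$ and $I_0=b$). -/

import Mathlib

open Set MeasureTheory

noncomputable section

namespace GalacticBilliard

/-! The plane is identified with `ℂ`; `inner ℝ` is the Euclidean scalar product.
`E, ω, h, μ` are the physical parameters. -/

/-- The inner potential `V_I(z) = E + h + μ / |z|`. -/
def innerPotential (E h μ : ℝ) (z : ℂ) : ℝ := E + h + μ / ‖z‖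

/-- The outer potential `V_E(z) = E - (ω² / 2) |z|²`. -/
def outerPotential (E ω : ℝ) (z : ℂ) : ℝ := E - ω ^ 2 / 2 * ‖z‖ ^ 2

/-! ### The quasi-circular domain -/

/-- The curve `γ(ξ) = (1 + ε f(ξ; ε)) (cos ξ, sin ξ)`. -/
def bdry (f : ℝ → ℝ → ℝ) (ε ξ : ℝ) : ℂ :=
  ((1 + ε * f ξ ε : ℝ) : ℂ) * Complex.exp (ξ * Complex.I)

/-- The domain `D_ε` enclosed by the curve `bdry f ε`. -/
def domain (f : ℝ → ℝ → ℝ) (ε : ℝ) : Set ℂ :=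
  {z | ∃ r ξ : ℝ, 0 ≤ r ∧ r < 1 + ε * f ξ ε ∧ z = (r : ℂ) * Complex.exp (ξ * Complex.I)}

/-- The velocity `v` at the point of parameter `ξ` of the counterclockwise curve `γ` points strictly
outwards; `-i γ'(ξ)` is an outward normal vector. -/
def PointsOutward (γ : ℝ → ℂ) (ξ : ℝ) (v : ℂ) : Prop :=
  0 < inner ℝ (-Complex.I * deriv γ ξ) v

/-- The velocity `v` at the point of parameter `ξ` of the counterclockwise curve `γ` points strictly
inwards. -/
def PointsInward (γ : ℝ → ℂ) (ξ : ℝ) (v : ℂ) : Prop :=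
  inner ℝ (-Complex.I * deriv γ ξ) v < 0

/-- The sine of the angle of `v` with the normal direction to `γ` at the parameter `ξ`, signed by
the tangent direction `γ'(ξ)`: the scalar product of the two unit vectors `γ' / |γ'|`, `v / |v|`. -/
def sinAngle (γ : ℝ → ℂ) (ξ : ℝ) (v : ℂ) : ℝ :=
  inner ℝ (deriv γ ξ) v / (‖deriv γ ξ‖ * ‖v‖)

/-- The velocity `v` at the position `p` has zero total energy for the potential `V`. -/
def ZeroEnergy (V : ℂ → ℝ) (p v : ℂ) : Prop := ‖v‖ ^ 2 / 2 - V p = 0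

/-- Snell's law `√V_I(z) sin α_I = √V_E(z) sin α_E` at `z = γ(ξ)`, between an outer velocity `vE`
and an inner velocity `vI`. -/
def Snell (E ω h μ : ℝ) (γ : ℝ → ℂ) (ξ : ℝ) (vE vI : ℂ) : Prop :=
  √(innerPotential E h μ (γ ξ)) * sinAngle γ ξ vI =
    √(outerPotential E ω (γ ξ)) * sinAngle γ ξ vE

/-- The canonical action `I = √V_E(γ(ξ)) sin α |γ'(ξ)|` conjugated with the parameter `ξ`, for an
outer arc starting at `γ(ξ)` with velocity `v` at angle `α` from the outward normal. By the first
variation formula this is minus the derivative of the Jacobi length of the arc with respect to the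
parameter of its starting point. -/
def action (E ω : ℝ) (γ : ℝ → ℂ) (ξ : ℝ) (v : ℂ) : ℝ :=
  √(outerPotential E ω (γ ξ)) * sinAngle γ ξ v * ‖deriv γ ξ‖

/-! ### Outer and inner arcs -/

/-- The outer arc from `(p, v)` first returns to the boundary of `D` at the point `q` and with the
velocity `w`: it solves `z'' = -ω² z` and stays outside the closure of `D` in between. -/
def IsOuterArc (ω : ℝ) (D : Set ℂ) (p v q w : ℂ) : Prop :=
  ∃ T : ℝ, 0 < T ∧ ∃ z z' : ℝ → ℂ,
    (∀ t ∈ Icc 0 T, HasDerivWithinAt z (z' t) (Icc 0 T) t ∧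
      HasDerivWithinAt z' (-((ω : ℂ) ^ 2) * z t) (Icc 0 T) t) ∧
    z 0 = p ∧ z' 0 = v ∧
    (∀ t ∈ Ioo 0 T, z t ∉ closure D) ∧
    q ∈ frontier D ∧ z T = q ∧ z' T = w

/-- The inner arc from `(p, v)` first returns to the boundary of `D` at the point `q` and with the
velocity `w`: it solves `z'' = -μ z / |z|³` away from the origin and stays in `D` in between.
Collisions with the origin are regularised as usual (Levi-Civita): `z` is continuous through the
collision and bounces back along the path by which it came. -/
def IsInnerArc (μ : ℝ) (D : Set ℂ) (p v q w : ℂ) : Prop :=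
  ∃ T : ℝ, 0 < T ∧ ∃ z z' : ℝ → ℂ,
    ContinuousOn z (Icc 0 T) ∧
    (∀ t ∈ Icc 0 T, z t ≠ 0 → HasDerivWithinAt z (z' t) (Icc 0 T) t ∧
      HasDerivWithinAt z' (-((μ / ‖z t‖ ^ 3 : ℝ) : ℂ) * z t) (Icc 0 T) t) ∧
    (∀ τ ∈ Icc 0 T, z τ = 0 →
      ∀ s : ℝ, τ - s ∈ Icc 0 T → τ + s ∈ Icc 0 T → z (τ + s) = z (τ - s)) ∧
    z 0 = p ∧ z' 0 = v ∧
    (∀ t ∈ Ioo 0 T, z t ∈ D) ∧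
    q ∈ frontier D ∧ z T = q ∧ z' T = w

/-! ### The first return map -/

/-- The first return map on `D_ε` is defined at `(ξ₀, I₀)` and has there the value `(ξ₁, I₁)`:
from `γ(ξ₀)` an outer arc starts with the outward velocity `v₀` of action `I₀`; it is followed up
to its first return `(γ(ξm), vE)`, refracted into the inner velocity `vI`, followed along the inner
arc up to its first return `(γ(ξ₁), wI)`, and refracted into the outward velocity `v₁`, the action
of which is `I₁`. -/
def IsFirstReturn (E ω h μ : ℝ) (f : ℝ → ℝ → ℝ) (ε ξ₀ I₀ ξ₁ I₁ : ℝ) : Prop :=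
  ∃ (ξm : ℝ) (v₀ vE vI wI v₁ : ℂ),
    (PointsOutward (bdry f ε) ξ₀ v₀ ∧ ZeroEnergy (outerPotential E ω) (bdry f ε ξ₀) v₀ ∧
      action E ω (bdry f ε) ξ₀ v₀ = I₀) ∧
    IsOuterArc ω (domain f ε) (bdry f ε ξ₀) v₀ (bdry f ε ξm) vE ∧
    (PointsInward (bdry f ε) ξm vE ∧ PointsInward (bdry f ε) ξm vI ∧
      ZeroEnergy (innerPotential E h μ) (bdry f ε ξm) vI ∧
      Snell E ω h μ (bdry f ε) ξm vE vI) ∧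
    IsInnerArc μ (domain f ε) (bdry f ε ξm) vI (bdry f ε ξ₁) wI ∧
    (PointsOutward (bdry f ε) ξ₁ wI ∧ PointsOutward (bdry f ε) ξ₁ v₁ ∧
      ZeroEnergy (outerPotential E ω) (bdry f ε ξ₁) v₁ ∧
      Snell E ω h μ (bdry f ε) ξ₁ v₁ wI) ∧
    action E ω (bdry f ε) ξ₁ v₁ = I₁

/-! ### The circular case -/

/-- The inverse cotangent with values in `(0, π)`. -/
def arccot (x : ℝ) : ℝ := Real.pi / 2 - Real.arctan x

/-- The critical action `I_c = √(E - ω² / 2)`. -/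
def criticalAction (E ω : ℝ) : ℝ := √(E - ω ^ 2 / 2)

/-- The angular shift of the outer arc for the unit circle. -/
def outerShift (E ω I : ℝ) : ℝ :=
  if 0 < I then
    arccot ((E - 2 * I ^ 2) / (I * √(4 * E - 2 * (2 * I ^ 2 + ω ^ 2))))
  else if I = 0 then 0
  else arccot ((E - 2 * I ^ 2) / (I * √(4 * E - 2 * (2 * I ^ 2 + ω ^ 2)))) - Real.pi

/-- The angular shift of the inner arc for the unit circle. -/
def innerShift (E h μ I : ℝ) : ℝ :=
  if 0 < I then
    2 * Real.arccos ((2 * I ^ 2 - μ) / √(4 * (E + h) * I ^ 2 + μ ^ 2)) - 2 * Real.pi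
  else if I = 0 then 0
  else -2 * Real.arccos ((2 * I ^ 2 - μ) / √(4 * (E + h) * I ^ 2 + μ ^ 2)) + 2 * Real.pi

/-- The set `J` of the actions `I ∈ (-I_c, I_c)` at which `θ_E'(I) + θ_I'(I) = 0`. -/
def criticalSet (E ω h μ : ℝ) : Set ℝ :=
  {I | I ∈ Ioo (-criticalAction E ω) (criticalAction E ω) ∧
    deriv (outerShift E ω) I + deriv (innerShift E h μ) I = 0}

/-! ### Area on the cylinder -/

instance twoPi_pos_fact : Fact (0 < 2 * Real.pi) := ⟨Real.two_pi_pos⟩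

/-- The phase space `ℝ/2πℤ × ℝ`, with the area `dξ dI` as its `volume`. -/
abbrev Cylinder : Type := AddCircle (2 * Real.pi) × ℝ

/-- The annulus `ℝ/2πℤ × [a, b]`. -/
def annulus (a b : ℝ) : Set Cylinder := univ ×ˢ Icc a b

/-- `F` preserves the area of all measurable subsets of `S`. -/
def PreservesAreaOn (F : Cylinder → Cylinder) (S : Set Cylinder) : Prop :=
  ∀ A ⊆ S, MeasurableSet A → volume (F '' A) = volume A

end GalacticBilliard

end

noncomputable section

namespace GalacticBilliard

open Filter Topology

/-! On the unit disc, rotation invariance makes the return map an integrable twist, `(ξ, I) ↦ (ξ +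
θ_E(I) + θ_I(I), I)` modulo `2π`. The twist is nonzero off the critical set. Existence,
transversality, smoothness and nonzero twist are open conditions at `ε = 0`, so compactness of `[0,
4π] × [a, b]` gives them for all small `ε`.

Both arcs are reduced to one problem. The outer equation is linear. In the inner one the Levi-Civita
substitution `z = w²`, `dt = |w|² ds` turns Kepler's equation at fixed energy into `w'' = l w`;
collisions become ordinary passages through `0`, and the bounce is the oddness of `w` about a zero.
`ArcSystem` treats a linear flow on one side of a star-shaped curve. `exists_return_zero` and
`arcMap_zero` solve it on the circle, and `eventually_good` perturbs it by the implicit function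
theorem (`exists_first_return`).

At zero energy Snell's law says that the tangential component of the velocity is kept (`snell_iff`),
and the action is this component over `√2`. Hence refraction is the identity in the coordinates
(parameter, tangential momentum), and the return map is a composition of two arc maps and constant
scalings. Each arc map has determinant `1`, because a linear flow preserves the symplectic form and
the variation of the return time disappears on an energy level (`symplectic_identity`,
`hasFDerivAt_arcMap`).

The construction is deterministic forwards (`IsFirstReturn.unique`) and, by reversibility and
conservation of energy, backwards (`IsFirstReturn.injective`). Injectivity and determinant `1` give
preservation of area on the cylinder (`preservesAreaOn_of_lift`). The critical set is finite because
its equation, cleared of denominators and square roots, is polynomial and nontrivial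
(`criticalSet_finite`). -/

/-! ### Linear flows -/

/-- `C` and `S` are the fundamental solutions of the scalar equation `x'' = l x`. -/
structure LinearFlow (l : ℝ) (C S : ℝ → ℝ) : Prop where
  hasDerivAt_C : ∀ t, HasDerivAt C (l * S t) t
  hasDerivAt_S : ∀ t, HasDerivAt S (C t) t
  C_zero : C 0 = 1
  S_zero : S 0 = 0
  C_neg : ∀ t, C (-t) = C t
  S_neg : ∀ t, S (-t) = -S t
  C_add : ∀ s t, C (s + t) = C s * C t + l * S s * S t
  S_add : ∀ s t, S (s + t) = S s * C t + C s * S t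
  contDiff_C : ∀ n : ℕ, ContDiff ℝ n C
  contDiff_S : ∀ n : ℕ, ContDiff ℝ n S

namespace LinearFlow

variable {l : ℝ} {C S : ℝ → ℝ}

theorem C_sq (h : LinearFlow l C S) (t : ℝ) : C t ^ 2 - l * S t ^ 2 = 1 := by
  have := h.C_add t (-t)
  rw [add_neg_cancel, h.C_zero, h.C_neg, h.S_neg] at this
  linarith

theorem S_sub (h : LinearFlow l C S) (s t : ℝ) : S (s - t) = S s * C t - C s * S t := by
  rw [sub_eq_add_neg, h.S_add, h.C_neg, h.S_neg]; ring

/-- The solution of `w'' = l w` with `w 0 = p`, `w' 0 = v`. -/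
def sol (C S : ℝ → ℝ) (p v : ℂ) (t : ℝ) : ℂ := (C t : ℂ) * p + (S t : ℂ) * v

/-- The velocity of `sol C S p v`. -/
def solVel (l : ℝ) (C S : ℝ → ℝ) (p v : ℂ) (t : ℝ) : ℂ := (l : ℂ) * (S t : ℂ) * p + (C t : ℂ) * v

theorem hasDerivAt_sol (h : LinearFlow l C S) (p v : ℂ) (t : ℝ) :
    HasDerivAt (sol C S p v) (solVel l C S p v t) t := by
  have h1 := ((h.hasDerivAt_C t).ofReal_comp.mul_const p).add
    ((h.hasDerivAt_S t).ofReal_comp.mul_const v)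
  convert! h1 using 1
  simp only [solVel]; push_cast; ring

theorem hasDerivAt_solVel (h : LinearFlow l C S) (p v : ℂ) (t : ℝ) :
    HasDerivAt (solVel l C S p v) ((l : ℂ) * sol C S p v t) t := by
  have h1 := (((h.hasDerivAt_S t).ofReal_comp.const_mul (l : ℂ)).mul_const p).add
    ((h.hasDerivAt_C t).ofReal_comp.mul_const v)
  convert! h1 using 1
  simp only [sol]; push_cast; ring

/-- Along any solution `C z - S z'` and `C z' - l S z` are constant, hence equal to the initial
data. The relation `C² - l S² = 1` inverts this linear system. -/
theorem eq_sol (h : LinearFlow l C S) {T : ℝ} {z z' : ℝ → ℂ}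
    (hz : ∀ t ∈ Icc 0 T, HasDerivWithinAt z (z' t) (Icc 0 T) t ∧
      HasDerivWithinAt z' ((l : ℂ) * z t) (Icc 0 T) t) {t : ℝ} (ht : t ∈ Icc 0 T) :
    z t = sol C S (z 0) (z' 0) t ∧ z' t = solVel l C S (z 0) (z' 0) t := by
  have hT : 0 ≤ T := ht.1.trans ht.2
  have key : ∀ F : ℝ → ℂ, (∀ t ∈ Icc 0 T, HasDerivWithinAt F 0 (Icc 0 T) t) → F t = F 0 := by
    intro F hF
    refine constant_of_derivWithin_zero (fun x hx => (hF x hx).differentiableWithinAt) ?_ t ht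
    intro x hx
    exact (hF x (Ico_subset_Icc_self hx)).derivWithin
      (uniqueDiffOn_Icc (hx.1.trans_lt hx.2) x (Ico_subset_Icc_self hx))
  have hA := key (fun t => (C t : ℂ) * z t - (S t : ℂ) * z' t) (fun t ht => by
    have h1 := ((h.hasDerivAt_C t).ofReal_comp.hasDerivWithinAt.mul (hz t ht).1).sub
      ((h.hasDerivAt_S t).ofReal_comp.hasDerivWithinAt.mul (hz t ht).2)
    convert! h1 using 1
    push_cast; ring)
  have hB := key (fun t => (C t : ℂ) * z' t - (l : ℂ) * (S t : ℂ) * z t) (fun t ht => by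
    have h1 := ((h.hasDerivAt_C t).ofReal_comp.hasDerivWithinAt.mul (hz t ht).2).sub
      (((h.hasDerivAt_S t).ofReal_comp.const_mul (l : ℂ)).hasDerivWithinAt.mul (hz t ht).1)
    convert! h1 using 1
    push_cast; ring)
  simp only [h.C_zero, h.S_zero, Complex.ofReal_one, Complex.ofReal_zero, one_mul, zero_mul,
    mul_zero, sub_zero] at hA hB
  have hsq : (C t : ℂ) ^ 2 - (l : ℂ) * (S t : ℂ) ^ 2 = 1 := by exact_mod_cast h.C_sq t
  constructor
  · rw [sol, ← hA, ← hB]; linear_combination (-z t) * hsq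
  · rw [solVel, ← hA, ← hB]; linear_combination (-z' t) * hsq

/-- The sum of the values at `s₀ + s` and `s₀ - s` is `2 C(s)` times the value at `s₀`. For the
square of the solution this oddness is the elastic bounce. -/
theorem sol_refl (h : LinearFlow l C S) (p v : ℂ) {s₀ : ℝ} (h0 : sol C S p v s₀ = 0) (s : ℝ) :
    sol C S p v (s₀ + s) = -sol C S p v (s₀ - s) := by
  have : sol C S p v (s₀ + s) + sol C S p v (s₀ - s) = 2 * (C s : ℂ) * sol C S p v s₀ := by
    simp only [sol, sub_eq_add_neg, h.C_add, h.S_add, h.C_neg, h.S_neg]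
    push_cast; ring
  rw [h0, mul_zero] at this
  exact eq_neg_of_add_eq_zero_left this

theorem energy (h : LinearFlow l C S) (p v : ℂ) (t : ℝ) :
    ‖solVel l C S p v t‖ ^ 2 - l * ‖sol C S p v t‖ ^ 2 = ‖v‖ ^ 2 - l * ‖p‖ ^ 2 := by
  simp only [← Complex.normSq_eq_norm_sq, Complex.normSq_apply, sol, solVel]
  simp
  linear_combination (v.re ^ 2 + v.im ^ 2 - l * (p.re ^ 2 + p.im ^ 2)) * h.C_sq t

end LinearFlow

open LinearFlow

/-! ### Outer arcs -/

/-- Both arcs follow the same explicit solution. The durations agree because the earlier arrival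
point lies in the closure of `D`, which the longer arc avoids at interior times. -/
theorem IsOuterArc.unique {ω : ℝ} {D : Set ℂ} {C S : ℝ → ℝ} (hCS : LinearFlow (-ω ^ 2) C S)
    {p v q w q' w' : ℂ} (h : IsOuterArc ω D p v q w) (h' : IsOuterArc ω D p v q' w') :
    q = q' ∧ w = w' := by
  obtain ⟨T, hT, z, y, hz, hz0, hy0, hout, hq, hzT, hyT⟩ := h
  obtain ⟨T', hT', z', y', hz', hz0', hy0', hout', hq', hzT', hyT'⟩ := h'
  have e : ∀ t ∈ Icc 0 T, z t = sol C S p v t ∧ y t = solVel (-ω ^ 2) C S p v t := fun t ht => by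
    rw [← hz0, ← hy0]
    exact hCS.eq_sol (fun t ht => by simpa using hz t ht) ht
  have e' : ∀ t ∈ Icc 0 T', z' t = sol C S p v t ∧ y' t = solVel (-ω ^ 2) C S p v t :=
    fun t ht => by
    rw [← hz0', ← hy0']
    exact hCS.eq_sol (fun t ht => by simpa using hz' t ht) ht
  have hTT : T = T' := by
    rcases lt_trichotomy T T' with hlt | heq | hlt
    · refine absurd (frontier_subset_closure hq) ?_
      rw [← hzT, (e T ⟨hT.le, le_rfl⟩).1, ← (e' T ⟨hT.le, hlt.le⟩).1]
      exact hout' T ⟨hT, hlt⟩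
    · exact heq
    · refine absurd (frontier_subset_closure hq') ?_
      rw [← hzT', (e' T' ⟨hT'.le, le_rfl⟩).1, ← (e T' ⟨hT'.le, hlt.le⟩).1]
      exact hout T' ⟨hT', hlt⟩
  subst hTT
  have h1 := e T ⟨hT.le, le_rfl⟩
  have h2 := e' T ⟨hT.le, le_rfl⟩
  exact ⟨by rw [← hzT, ← hzT', h1.1, h2.1], by rw [← hyT, ← hyT', h1.2, h2.2]⟩

theorem hasDerivWithinAt_reverse {T : ℝ} {z : ℝ → ℂ} {d : ℂ} {t : ℝ}
    (h : HasDerivWithinAt z d (Icc 0 T) (T - t)) :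
    HasDerivWithinAt (fun s => z (T - s)) (-d) (Icc 0 T) t := by
  have h1 : HasDerivWithinAt (fun s : ℝ => T - s) (-1) (Icc 0 T) t :=
    ((hasDerivAt_id t).const_sub T).hasDerivWithinAt
  have h2 := h.scomp t h1 (fun s hs => ⟨by linarith [hs.2], by linarith [hs.1]⟩)
  simpa [Function.comp_def] using h2

/-- Reversibility of the flow, used to run the return map backwards and prove it injective. -/
theorem IsOuterArc.reverse {ω : ℝ} {D : Set ℂ} {p v q w : ℂ} (h : IsOuterArc ω D p v q w)
    (hp : p ∈ frontier D) : IsOuterArc ω D q (-w) p (-v) := by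
  obtain ⟨T, hT, z, y, hz, hz0, hy0, hout, hq, hzT, hyT⟩ := h
  refine ⟨T, hT, fun t => z (T - t), fun t => -y (T - t), ?_, by simpa, by simpa, ?_, hp,
    by simpa, by simpa⟩
  · intro t ht
    have ht' : T - t ∈ Icc 0 T := ⟨by linarith [ht.2], by linarith [ht.1]⟩
    refine ⟨hasDerivWithinAt_reverse (hz _ ht').1, ?_⟩
    convert! (hasDerivWithinAt_reverse (hz _ ht').2).neg using 1
    ring
  · intro t ht
    exact hout _ ⟨by linarith [ht.2], by linarith [ht.1]⟩

theorem IsOuterArc.energy {ω : ℝ} {D : Set ℂ} {C S : ℝ → ℝ} (hCS : LinearFlow (-ω ^ 2) C S)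
    {p v q w : ℂ} (h : IsOuterArc ω D p v q w) :
    ‖w‖ ^ 2 + ω ^ 2 * ‖q‖ ^ 2 = ‖v‖ ^ 2 + ω ^ 2 * ‖p‖ ^ 2 := by
  obtain ⟨T, hT, z, y, hz, rfl, rfl, -, -, rfl, rfl⟩ := h
  obtain ⟨h1, h2⟩ := hCS.eq_sol (fun t ht => by simpa using hz t ht) (right_mem_Icc.2 hT.le)
  have := hCS.energy (z 0) (y 0) T
  rw [← h1, ← h2] at this
  linarith

theorem isOuterArc_sol {ω : ℝ} {D : Set ℂ} {C S : ℝ → ℝ} (hCS : LinearFlow (-ω ^ 2) C S)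
    {p v : ℂ} {T : ℝ} (hT : 0 < T) (hout : ∀ t ∈ Ioo 0 T, sol C S p v t ∉ closure D)
    (hq : sol C S p v T ∈ frontier D) :
    IsOuterArc ω D p v (sol C S p v T) (solVel (-ω ^ 2) C S p v T) := by
  refine ⟨T, hT, sol C S p v, solVel (-ω ^ 2) C S p v, fun t _ =>
    ⟨(hCS.hasDerivAt_sol p v t).hasDerivWithinAt, ?_⟩, ?_, ?_, hout, hq, rfl, rfl⟩
  · simpa using (hCS.hasDerivAt_solVel p v t).hasDerivWithinAt
  · simp [sol, hCS.C_zero, hCS.S_zero]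
  · simp [solVel, hCS.C_zero, hCS.S_zero]

/-! ### Inner arcs: uniqueness and reversal -/

theorem IsInnerArc.reverse {μ : ℝ} {D : Set ℂ} {p v q w : ℂ} (h : IsInnerArc μ D p v q w)
    (hp : p ∈ frontier D) : IsInnerArc μ D q (-w) p (-v) := by
  obtain ⟨T, hT, z, y, hc, hz, hr, hz0, hy0, hin, hq, hzT, hyT⟩ := h
  have hm : ∀ t ∈ Icc 0 T, T - t ∈ Icc 0 T := fun t ht => ⟨by linarith [ht.2], by linarith [ht.1]⟩
  refine ⟨T, hT, fun t => z (T - t), fun t => -y (T - t), ?_, ?_, ?_, by simpa, by simpa, ?_, hp,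
    by simpa, by simpa⟩
  · exact hc.comp (by fun_prop) hm
  · intro t ht hne
    refine ⟨hasDerivWithinAt_reverse (hz _ (hm t ht) hne).1, ?_⟩
    convert! (hasDerivWithinAt_reverse (hz _ (hm t ht) hne).2).neg using 1
    ring
  · intro τ hτ h0 s h1 h2
    have := hr (T - τ) (hm τ hτ) h0 (-s) (by convert! hm _ h1 using 1; ring)
      (by convert! hm _ h2 using 1; ring)
    simp only [show T - (τ + s) = T - τ + -s by ring, show T - (τ - s) = T - τ - -s by ring, this]
  · intro t ht
    exact hin _ ⟨by linarith [ht.2], by linarith [ht.1]⟩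

/-- Uniqueness of collision-free Kepler arcs. -/
theorem kepler_unique {μ T : ℝ} {z y z' y' : ℝ → ℂ}
    (hc : ContinuousOn z (Icc 0 T)) (hc' : ContinuousOn z' (Icc 0 T))
    (hz : ∀ t ∈ Icc 0 T, z t ≠ 0 → HasDerivWithinAt z (y t) (Icc 0 T) t ∧
      HasDerivWithinAt y (-((μ / ‖z t‖ ^ 3 : ℝ) : ℂ) * z t) (Icc 0 T) t)
    (hz' : ∀ t ∈ Icc 0 T, z' t ≠ 0 → HasDerivWithinAt z' (y' t) (Icc 0 T) t ∧
      HasDerivWithinAt y' (-((μ / ‖z' t‖ ^ 3 : ℝ) : ℂ) * z' t) (Icc 0 T) t)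
    (h0 : z 0 = z' 0) (h0' : y 0 = y' 0) (hne : ∀ t ∈ Icc 0 T, z t ≠ 0) :
    ∀ t ∈ Icc 0 T, z t = z' t ∧ y t = y' t := by
  have hyc : ∀ t ∈ Icc 0 T, z t = z' t → ContinuousWithinAt y' (Icc 0 T) t := fun t ht e =>
    (hz' t ht (e ▸ hne t ht)).2.continuousWithinAt
  have hycz : ∀ t ∈ Icc 0 T, ContinuousWithinAt y (Icc 0 T) t := fun t ht =>
    (hz t ht (hne t ht)).2.continuousWithinAt
  -- Continuous induction: the coincidence set is closed and, by Picard–Lindelöf, extends to the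
  -- right of each of its points. Only `z` is assumed to avoid the origin; `z'` inherits this where
  -- the two agree and, by continuity, slightly beyond.
  refine IsClosed.Icc_subset_of_forall_exists_gt (s := {t | z t = z' t ∧ y t = y' t}) ?_ ⟨h0, h0'⟩ ?_
  · refine isClosed_of_closure_subset fun t ht => ?_
    have hcl : IsClosed (Icc 0 T ∩ (fun t => z t - z' t) ⁻¹' {0}) :=
      (hc.sub hc').preimage_isClosed_of_isClosed isClosed_Icc isClosed_singleton
    have h1 : t ∈ Icc 0 T ∩ (fun t => z t - z' t) ⁻¹' {0} := by
      refine hcl.closure_subset_iff.2 ?_ ht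
      rintro s ⟨hs, hs'⟩
      exact ⟨hs', by simp [hs.1]⟩
    have hzt : z t = z' t := by simpa [sub_eq_zero] using h1.2
    have h2 : ContinuousWithinAt (fun t => y t - y' t) ({t | z t = z' t ∧ y t = y' t} ∩ Icc 0 T) t :=
      ((hycz t h1.1).sub (hyc t h1.1 hzt)).mono inter_subset_right
    have h3 := h2.mem_closure (t := {0}) ht (fun s hs => by simp [hs.1.2])
    rw [closure_singleton] at h3
    exact ⟨⟨hzt, by simpa [sub_eq_zero] using h3⟩, h1.1⟩
  · rintro x ⟨⟨hx1, hx2⟩, hx⟩ b hb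
    have hxI : x ∈ Icc 0 T := Ico_subset_Icc_self hx
    set F : ℂ × ℂ → ℂ × ℂ := fun u => (u.2, -((μ / ‖u.1‖ ^ 3 : ℝ) : ℂ) * u.1) with hF
    have hFd : ContDiffAt ℝ 1 F (z x, y x) := by
      have hn : ContDiffAt ℝ 1 (fun u : ℂ × ℂ => ‖u.1‖) (z x, y x) :=
        contDiffAt_fst.norm ℝ (hne x hxI)
      have h3 : ContDiffAt ℝ 1 (fun u : ℂ × ℂ => μ / ‖u.1‖ ^ 3) (z x, y x) :=
        contDiffAt_const.div (hn.pow 3) (pow_ne_zero _ (norm_ne_zero_iff.2 (hne x hxI)))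
      exact contDiffAt_snd.prodMk
        ((Complex.ofRealCLM.contDiff.contDiffAt.comp _ h3).neg.mul contDiffAt_fst)
    obtain ⟨K, U, hU, hL⟩ := hFd.exists_lipschitzOnWith
    have hev : ∀ᶠ t in 𝓝[Icc 0 T] x, (z t, y t) ∈ U ∧ (z' t, y' t) ∈ U ∧ z' t ≠ 0 := by
      have c1 : ContinuousWithinAt (fun t => (z t, y t)) (Icc 0 T) x :=
        (hc x hxI).prodMk (hycz x hxI)
      have c2 : ContinuousWithinAt (fun t => (z' t, y' t)) (Icc 0 T) x :=
        (hc' x hxI).prodMk (hyc x hxI hx1)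
      have e1 := c1 hU
      have e2 := c2 (show U ∈ 𝓝 (z' x, y' x) by rwa [← hx1, ← hx2])
      have e3 := (hc' x hxI).eventually_ne (hx1 ▸ hne x hxI)
      filter_upwards [e1, e2, e3] with t h1 h2 h3 using ⟨h1, h2, h3⟩
    rw [eventually_nhdsWithin_iff, Metric.eventually_nhds_iff] at hev
    obtain ⟨δ, hδ, hev⟩ := hev
    set c := min (x + δ / 2) (min b T) with hcdef
    have hxc : x < c := lt_min (by linarith) (lt_min hb hx.2)
    have hcT : c ≤ T := (min_le_right _ _).trans (min_le_right _ _)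
    have hcb : c ≤ b := (min_le_right _ _).trans (min_le_left _ _)
    have hsub : Icc x c ⊆ Icc 0 T := Icc_subset_Icc hx.1 hcT
    have hev' : ∀ t ∈ Icc x c, (z t, y t) ∈ U ∧ (z' t, y' t) ∈ U ∧ z' t ≠ 0 := fun t ht => by
      refine hev ?_ (hsub ht)
      rw [Real.dist_eq, abs_lt]
      have := ht.2.trans (min_le_left _ _)
      constructor <;> linarith [ht.1]
    have hnh : ∀ t ∈ Ico x c, Icc 0 T ∈ 𝓝[Ici t] t := fun t ht =>
      mem_of_superset (Icc_mem_nhdsGE (ht.2.trans_le hcT))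
        (Icc_subset_Icc_left (hx.1.trans ht.1))
    have huni := ODE_solution_unique_of_mem_Icc_right (v := fun _ => F) (s := fun _ => U)
      (f := fun t => (z t, y t)) (g := fun t => (z' t, y' t)) (a := x) (b := c) (K := K)
      (fun _ _ => hL)
      (fun t ht => ((hc t (hsub ht)).prodMk (hycz t (hsub ht))).mono hsub)
      (fun t ht => by
        have := hz t (hsub (Ico_subset_Icc_self ht)) (hne t (hsub (Ico_subset_Icc_self ht)))
        exact (this.1.prodMk this.2).mono_of_mem_nhdsWithin (hnh t ht))
      (fun t ht => (hev' t (Ico_subset_Icc_self ht)).1)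
      (fun t ht => by
        have := hz' t (hsub ht) (hev' t ht).2.2
        exact (this.1.continuousWithinAt.prodMk this.2.continuousWithinAt).mono hsub)
      (fun t ht => by
        have := hz' t (hsub (Ico_subset_Icc_self ht)) (hev' t (Ico_subset_Icc_self ht)).2.2
        exact (this.1.prodMk this.2).mono_of_mem_nhdsWithin (hnh t ht))
      (fun t ht => (hev' t (Ico_subset_Icc_self ht)).2.1)
      (by simp [hx1, hx2])
    have hcc := huni (right_mem_Icc.2 hxc.le)
    exact ⟨c, ⟨by simpa using congrArg Prod.fst hcc, by simpa using congrArg Prod.snd hcc⟩, hxc, hcb⟩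

/-- An inner arc that reaches the origin for the first time at `τ` goes back along its path. -/
theorem bounce {D : Set ℂ} (hD : IsOpen D) (h0D : (0 : ℂ) ∈ D) {T τ : ℝ} {z : ℝ → ℂ}
    (hτ : τ ∈ Icc 0 T) (hzτ : z τ = 0)
    (hr : ∀ s : ℝ, τ - s ∈ Icc 0 T → τ + s ∈ Icc 0 T → z (τ + s) = z (τ - s))
    (hz0 : z 0 ∈ frontier D) (hin : ∀ t ∈ Ioo 0 T, z t ∈ D) (hzT : z T ∈ frontier D) :
    T = 2 * τ := by
  have hdis : ∀ x ∈ frontier D, x ∉ D := fun x hx hxD => by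
    rw [hD.frontier_eq] at hx; exact hx.2 hxD
  have hτ0 : 0 < τ := lt_of_le_of_ne hτ.1 (fun h => hdis _ hz0 (by rw [h, hzτ]; exact h0D))
  have hτT : τ < T := lt_of_le_of_ne hτ.2 (fun h => hdis _ hzT (by rw [← h, hzτ]; exact h0D))
  -- If `T ≠ 2 * τ`, reflection about `τ` carries one end of the arc, which is on the frontier, to
  -- an interior time, where the arc is in the open set `D`.
  rcases lt_trichotomy T (2 * τ) with hlt | heq | hlt
  · have := hr (T - τ) ⟨by linarith, by linarith⟩ ⟨by linarith, by linarith⟩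
    rw [add_sub_cancel] at this
    exact absurd (this ▸ hin _ ⟨by linarith, by linarith⟩) (hdis _ hzT)
  · exact heq
  · have := hr τ ⟨by linarith, by linarith⟩ ⟨by linarith, by linarith⟩
    rw [sub_self] at this
    exact absurd (this ▸ hin _ ⟨by linarith, by linarith⟩) (hdis _ hz0)

/-- An inner arc through the origin returns to its starting point with the opposite velocity. -/
theorem bounce_back {μ : ℝ} {D : Set ℂ} (hD : IsOpen D) (h0D : (0 : ℂ) ∈ D) {T : ℝ}
    {z y : ℝ → ℂ} (hT : 0 < T) (hcol : ∃ τ ∈ Icc 0 T, z τ = 0)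
    (hz : ∀ t ∈ Icc 0 T, z t ≠ 0 → HasDerivWithinAt z (y t) (Icc 0 T) t ∧
      HasDerivWithinAt y (-((μ / ‖z t‖ ^ 3 : ℝ) : ℂ) * z t) (Icc 0 T) t)
    (hr : ∀ τ ∈ Icc 0 T, z τ = 0 →
      ∀ s : ℝ, τ - s ∈ Icc 0 T → τ + s ∈ Icc 0 T → z (τ + s) = z (τ - s))
    (hz0 : z 0 ∈ frontier D) (hin : ∀ t ∈ Ioo 0 T, z t ∈ D) (hzT : z T ∈ frontier D) :
    z T = z 0 ∧ y T = -y 0 := by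
  obtain ⟨τ, hτ, hzτ⟩ := hcol
  have hdis : ∀ x ∈ frontier D, x ∉ D := fun x hx hxD => by
    rw [hD.frontier_eq] at hx; exact hx.2 hxD
  have hne0 : ∀ x ∈ frontier D, x ≠ 0 := fun x hx h => hdis x hx (h ▸ h0D)
  have hT2 := bounce hD h0D hτ hzτ (hr τ hτ hzτ) hz0 hin hzT
  have hsym : ∀ t ∈ Icc 0 T, z (T - t) = z t := fun t ht => by
    have := hr τ hτ hzτ (τ - t) (by simpa using ht)
      ⟨by linarith [ht.1, ht.2], by linarith [ht.1, ht.2]⟩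
    convert! this using 2 <;> [(rw [hT2]; ring); ring]
  have hTI : T ∈ Icc 0 T := right_mem_Icc.2 hT.le
  have h0I : (0 : ℝ) ∈ Icc 0 T := left_mem_Icc.2 hT.le
  have hz0T : z T = z 0 := by simpa using hsym 0 h0I
  refine ⟨hz0T, ?_⟩
  have d1 := (hz T hTI (hne0 _ hzT)).1
  -- The velocity is unconstrained at a collision, so it cannot be followed through it. Instead the
  -- symmetry `z (T - t) = z t` is differentiated at `t = 0`.
  have d2 : HasDerivWithinAt z (-y T) (Icc 0 T) 0 := by
    refine (hasDerivWithinAt_reverse (T := T) (t := 0) (by simpa using d1)).congr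
      (fun t ht => (hsym t ht).symm) (by simpa using hz0T.symm)
  have := (uniqueDiffOn_Icc hT 0 h0I).eq_deriv _ d2 (hz 0 h0I (hne0 _ hz0)).1
  rw [← this, neg_neg]

/-- The energy cannot be differentiated across a collision, but then `bounce_back` brings the arc
back to its start with the opposite velocity. Without collision the energy has zero derivative. -/
theorem IsInnerArc.energy {μ : ℝ} {D : Set ℂ} (hD : IsOpen D) (h0D : (0 : ℂ) ∈ D)
    {p v q w : ℂ} (hp : p ∈ frontier D) (h : IsInnerArc μ D p v q w) :
    ‖w‖ ^ 2 / 2 - μ / ‖q‖ = ‖v‖ ^ 2 / 2 - μ / ‖p‖ := by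
  obtain ⟨T, hT, z, y, hc, hz, hr, rfl, rfl, hin, hq, rfl, rfl⟩ := h
  by_cases hcol : ∃ τ ∈ Icc 0 T, z τ = 0
  · have := bounce_back hD h0D hT hcol hz hr hp hin hq
    rw [this.1, this.2, norm_neg]
  · push Not at hcol
    have hd : ∀ t ∈ Icc 0 T,
        HasDerivWithinAt (fun t => ‖y t‖ ^ 2 / 2 - μ / ‖z t‖) 0 (Icc 0 T) t := fun t ht => by
      obtain ⟨h1, h2⟩ := hz t ht (hcol t ht)
      have hn : ‖z t‖ ≠ 0 := norm_ne_zero_iff.2 (hcol t ht)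
      have e1 := h2.norm_sq
      have e2 := (h1.norm_sq.sqrt (pow_ne_zero 2 hn))
      simp only [Real.sqrt_sq (norm_nonneg _)] at e2
      convert! (e1.div_const 2).sub ((hasDerivWithinAt_const t (Icc 0 T) μ).div e2 hn) using 1
      simp only [Complex.inner, Complex.mul_re, Complex.mul_im, Complex.conj_re, Complex.conj_im,
        Complex.neg_re, Complex.neg_im, Complex.ofReal_re, Complex.ofReal_im]
      field_simp
      ring
    exact constant_of_derivWithin_zero (fun x hx => (hd x hx).differentiableWithinAt)
      (fun x hx => (hd x (Ico_subset_Icc_self hx)).derivWithin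
        (uniqueDiffOn_Icc hT x (Ico_subset_Icc_self hx))) T ⟨hT.le, le_rfl⟩

/-- Up to the first collision the two arcs coincide by `kepler_unique`, so by continuity they
collide together. From then on `bounce_back` prescribes the end of each. Without collision the
durations are compared as for outer arcs. -/
theorem IsInnerArc.unique {μ : ℝ} {D : Set ℂ} (hD : IsOpen D) (h0D : (0 : ℂ) ∈ D)
    {p v q w q' w' : ℂ} (hp : p ∈ frontier D)
    (h : IsInnerArc μ D p v q w) (h' : IsInnerArc μ D p v q' w') :
    q = q' ∧ w = w' := by
  have hdis : ∀ x ∈ frontier D, x ∉ D := fun x hx hxD => by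
    rw [hD.frontier_eq] at hx; exact hx.2 hxD
  have hne0 : ∀ x ∈ frontier D, x ≠ 0 := fun x hx h => hdis x hx (h ▸ h0D)
  obtain ⟨T, hT, z, y, hc, hz, hr, hz0, hy0, hin, hq, hzT, hyT⟩ := h
  obtain ⟨T', hT', z', y', hc', hz', hr', hz0', hy0', hin', hq', hzT', hyT'⟩ := h'
  -- it suffices to treat the case `T ≤ T'`
  have main : ∀ {T T' : ℝ} {z y z' y' : ℝ → ℂ} {q w q' w' : ℂ}, 0 < T → T ≤ T' →
      ContinuousOn z (Icc 0 T) → ContinuousOn z' (Icc 0 T') →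
      (∀ t ∈ Icc 0 T, z t ≠ 0 → HasDerivWithinAt z (y t) (Icc 0 T) t ∧
        HasDerivWithinAt y (-((μ / ‖z t‖ ^ 3 : ℝ) : ℂ) * z t) (Icc 0 T) t) →
      (∀ t ∈ Icc 0 T', z' t ≠ 0 → HasDerivWithinAt z' (y' t) (Icc 0 T') t ∧
        HasDerivWithinAt y' (-((μ / ‖z' t‖ ^ 3 : ℝ) : ℂ) * z' t) (Icc 0 T') t) →
      (∀ τ ∈ Icc 0 T, z τ = 0 →
        ∀ s : ℝ, τ - s ∈ Icc 0 T → τ + s ∈ Icc 0 T → z (τ + s) = z (τ - s)) →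
      (∀ τ ∈ Icc 0 T', z' τ = 0 →
        ∀ s : ℝ, τ - s ∈ Icc 0 T' → τ + s ∈ Icc 0 T' → z' (τ + s) = z' (τ - s)) →
      z 0 = p → z' 0 = p → y 0 = v → y' 0 = v →
      (∀ t ∈ Ioo 0 T, z t ∈ D) → (∀ t ∈ Ioo 0 T', z' t ∈ D) →
      q ∈ frontier D → q' ∈ frontier D → z T = q → z' T' = q' → y T = w → y' T' = w' →
      q = q' ∧ w = w' := by
    intro T T' z y z' y' q w q' w' hT hTT hc hc' hz hz' hr hr' hz0 hz0' hy0 hy0' hin hin' hq hq'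
      hzT hzT' hyT hyT'
    have hT' : 0 < T' := hT.trans_le hTT
    have huniq : ∀ T₁ ≤ T, (∀ t ∈ Icc 0 T₁, z t ≠ 0) →
        ∀ t ∈ Icc 0 T₁, z t = z' t ∧ y t = y' t := fun T₁ h1 hne => by
      have s1 : Icc 0 T₁ ⊆ Icc 0 T := Icc_subset_Icc_right h1
      have s2 : Icc 0 T₁ ⊆ Icc 0 T' := Icc_subset_Icc_right (h1.trans hTT)
      exact kepler_unique (hc.mono s1) (hc'.mono s2)
        (fun t ht h => ⟨(hz t (s1 ht) h).1.mono s1, (hz t (s1 ht) h).2.mono s1⟩)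
        (fun t ht h => ⟨(hz' t (s2 ht) h).1.mono s2, (hz' t (s2 ht) h).2.mono s2⟩)
        (by rw [hz0, hz0']) (by rw [hy0, hy0']) hne
    by_cases hcol : ∃ τ ∈ Icc 0 T, z τ = 0
    · -- the first collision time
      have hcl : IsCompact (Icc 0 T ∩ z ⁻¹' {0}) :=
        isCompact_Icc.of_isClosed_subset
          (hc.preimage_isClosed_of_isClosed isClosed_Icc isClosed_singleton) inter_subset_left
      obtain ⟨τ, ⟨hτ, hzτ⟩, hmin⟩ := hcl.exists_isLeast
        (by obtain ⟨τ, h1, h2⟩ := hcol; exact ⟨τ, h1, h2⟩)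
      have hzτ : z τ = 0 := hzτ
      have hτ0 : 0 < τ := lt_of_le_of_ne hτ.1
        (fun h => hne0 _ hp (by rw [← hz0, h, hzτ]))
      have heq : ∀ t ∈ Ico 0 τ, z t = z' t := fun t ht =>
        (huniq t (ht.2.le.trans hτ.2) (fun s hs h0 =>
          absurd (hmin ⟨⟨hs.1, hs.2.trans (ht.2.le.trans hτ.2)⟩, h0⟩)
            (not_le.2 (hs.2.trans_lt ht.2))) t ⟨ht.1, le_rfl⟩).1
      have hz'τ : z' τ = 0 := by
        have c1 : ContinuousWithinAt (fun t => z t - z' t) (Icc 0 T) τ :=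
          (hc τ hτ).sub ((hc' τ ⟨hτ.1, hτ.2.trans hTT⟩).mono (Icc_subset_Icc_right hTT))
        have c2 : ContinuousWithinAt (fun t => z t - z' t) (Ico 0 τ) τ :=
          c1.mono (fun t ht => ⟨ht.1, ht.2.le.trans hτ.2⟩)
        have h3 := c2.mem_closure (t := {0})
          (by rw [closure_Ico hτ0.ne]; exact right_mem_Icc.2 hτ0.le)
          (fun s hs => by simp [heq s hs])
        rw [closure_singleton] at h3
        have : z τ - z' τ = 0 := h3
        rw [hzτ, zero_sub, neg_eq_zero] at this
        exact this
      have b1 := bounce_back hD h0D hT ⟨τ, hτ, hzτ⟩ hz hr (hz0 ▸ hp) hin (hzT ▸ hq)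
      have b2 := bounce_back hD h0D hT' ⟨τ, ⟨hτ.1, hτ.2.trans hTT⟩, hz'τ⟩ hz' hr' (hz0' ▸ hp) hin' (hzT' ▸ hq')
      exact ⟨by rw [← hzT, ← hzT', b1.1, b2.1, hz0, hz0'],
        by rw [← hyT, ← hyT', b1.2, b2.2, hy0, hy0']⟩
    · push Not at hcol
      have h1 := huniq T le_rfl hcol T ⟨hT.le, le_rfl⟩
      have hTT' : T = T' := by
        refine le_antisymm hTT (not_lt.1 fun hlt => hdis q hq ?_)
        rw [← hzT, h1.1]
        exact hin' T ⟨hT, hlt⟩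
      subst hTT'
      exact ⟨by rw [← hzT, ← hzT', h1.1], by rw [← hyT, ← hyT', h1.2]⟩
  rcases le_total T T' with hTT | hTT
  · exact main hT hTT hc hc' hz hz' hr hr' hz0 hz0' hy0 hy0' hin hin' hq hq' hzT hzT' hyT hyT'
  · have := main hT' hTT hc' hc hz' hz hr' hr hz0' hz0 hy0' hy0 hin' hin hq' hq hzT' hzT hyT' hyT
    exact ⟨this.1.symm, this.2.symm⟩

/-! ### Inner arcs: existence by the Levi-Civita regularisation -/

/-- The image of `f` may be a bounded interval. Extending `f` from `[0, b]` with slope one gives an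
increasing bijection of the line, whose inverse is continuous on all of it. It serves to invert the
change of time. -/
theorem exists_continuous_inverse {f : ℝ → ℝ} (hf : Continuous f) (hm : StrictMono f) {b : ℝ}
    (hb : 0 ≤ b) (h0 : f 0 = 0) :
    ∃ g : ℝ → ℝ, Continuous g ∧ (∀ t ∈ Icc 0 (f b), f (g t) = t ∧ g t ∈ Icc 0 b) := by
  set F : ℝ → ℝ := fun x => f (max 0 (min x b)) + (x - max 0 (min x b)) with hF
  have hFc : Continuous F := by
    have : Continuous fun x : ℝ => max 0 (min x b) := by fun_prop
    exact (hf.comp this).add (continuous_id.sub this)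
  have hF1 : ∀ x ≤ 0, F x = x := fun x hx => by
    simp [hF, min_eq_left (hx.trans hb), max_eq_left hx, h0]
  have hF2 : ∀ x ∈ Icc 0 b, F x = f x := fun x hx => by
    simp [hF, min_eq_left hx.2, max_eq_right hx.1]
  have hF3 : ∀ x, b ≤ x → F x = f b + (x - b) := fun x hx => by
    simp [hF, min_eq_right hx, max_eq_right hb]
  have hFm : StrictMono F := by
    intro x y hxy
    simp only [hF]
    have hp : max 0 (min x b) ≤ max 0 (min y b) := max_le_max le_rfl (min_le_min hxy.le le_rfl)
    rcases hp.eq_or_lt with h | h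
    · rw [h]; linarith
    · have h1 := hm h
      have h2 : max 0 (min y b) - max 0 (min x b) ≤ y - x := by
        rcases le_total 0 (min x b) with hx0 | hx0 <;> rcases le_total 0 (min y b) with hy0 | hy0 <;>
          rcases le_total x b with hxb | hxb <;> rcases le_total y b with hyb | hyb <;>
          simp_all <;> linarith
      linarith
  have hFs : Function.Surjective F := by
    refine hFc.surjective ?_ ?_
    · refine tendsto_atTop_mono' _ ?_ (tendsto_atTop_add_const_right _ (f b - b) tendsto_id)
      filter_upwards [eventually_ge_atTop b] with x hx
      rw [hF3 x hx]; simp only [id]; linarith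
    · refine tendsto_atBot_mono' _ ?_ tendsto_id
      filter_upwards [eventually_le_atBot 0] with x hx
      rw [hF1 x hx]; rfl
  set e := hFm.orderIsoOfSurjective F hFs
  refine ⟨e.symm, e.symm.continuous, fun t ht => ?_⟩
  have hFe : F (e.symm t) = t := e.apply_symm_apply t
  have hmem : e.symm t ∈ Icc 0 b := by
    constructor
    · by_contra hlt
      push Not at hlt
      rw [hF1 _ hlt.le] at hFe
      linarith [ht.1]
    · by_contra hlt
      push Not at hlt
      rw [hF3 _ hlt.le] at hFe
      linarith [ht.2]
  exact ⟨by rw [← hF2 _ hmem, hFe], hmem⟩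

/-- With `dt = |w|² ds` the velocity of `z = w²` is `2 w' / conj w`; the left side is its derivative
in `t`. The energy relation is what turns the linear force into Kepler's. -/
theorem levi_civita_acceleration {l μ : ℝ} {w w' : ℂ} (hw : w ≠ 0)
    (he : ‖w'‖ ^ 2 - l * ‖w‖ ^ 2 = μ / 2) :
    ((1 / ‖w‖ ^ 2 : ℝ) : ℂ) * ((2 * (l * w) * (starRingEnd ℂ) w
      - 2 * w' * (starRingEnd ℂ) w') / (starRingEnd ℂ) w ^ 2) =
      -((μ / ‖w ^ 2‖ ^ 3 : ℝ) : ℂ) * w ^ 2 := by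
  have hw' : (starRingEnd ℂ) w ≠ 0 := by simpa using hw
  have h1 : ((‖w‖ ^ 2 : ℝ) : ℂ) = w * (starRingEnd ℂ) w := by
    rw [Complex.mul_conj, Complex.normSq_eq_norm_sq]
  have h2 : ((‖w'‖ ^ 2 : ℝ) : ℂ) = w' * (starRingEnd ℂ) w' := by
    rw [Complex.mul_conj, Complex.normSq_eq_norm_sq]
  have h3 : w' * (starRingEnd ℂ) w' - l * (w * (starRingEnd ℂ) w) = μ / 2 := by
    rw [← h1, ← h2]; exact_mod_cast congrArg (fun x : ℝ => (x : ℂ)) he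
  have h4 : ‖w ^ 2‖ ^ 3 = (‖w‖ ^ 2) ^ 3 := by rw [norm_pow]
  rw [h4, Complex.ofReal_div, Complex.ofReal_div, Complex.ofReal_pow (‖w‖ ^ 2), h1,
    Complex.ofReal_one]
  field_simp
  linear_combination (-2 : ℂ) * h3

/-- Levi-Civita regularisation: `r` is the physical time as a function of the fictitious time `s`,
`g` its inverse, and the arc is `w (g t) ^ 2`. -/
theorem isInnerArc_sol {l μ : ℝ} {D : Set ℂ} {C S : ℝ → ℝ} (hCS : LinearFlow l C S) (hμ : 0 < μ)
    {p v : ℂ} (he : ‖v‖ ^ 2 - l * ‖p‖ ^ 2 = μ / 2) {b : ℝ} (hb : 0 < b)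
    (hin : ∀ s ∈ Ioo 0 b, sol C S p v s ^ 2 ∈ D) (hq : sol C S p v b ^ 2 ∈ frontier D) :
    IsInnerArc μ D (p ^ 2) (2 * v / (starRingEnd ℂ) p) (sol C S p v b ^ 2)
      (2 * solVel l C S p v b / (starRingEnd ℂ) (sol C S p v b)) := by
  set w := sol C S p v with hw
  set w' := solVel l C S p v with hw'
  have hwd : ∀ s, HasDerivAt w (w' s) s := hCS.hasDerivAt_sol p v
  have hwd' : ∀ s, HasDerivAt w' (l * w s) s := hCS.hasDerivAt_solVel p v
  have hwc : Continuous w := continuous_iff_continuousAt.2 fun s => (hwd s).continuousAt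
  have hw0 : w 0 = p := by simp [hw, sol, hCS.C_zero, hCS.S_zero]
  have hw0' : w' 0 = v := by simp [hw', solVel, hCS.C_zero, hCS.S_zero]
  have hen : ∀ s, ‖w' s‖ ^ 2 - l * ‖w s‖ ^ 2 = μ / 2 := fun s => by
    rw [hw, hw', hCS.energy, he]
  set r : ℝ → ℝ := fun s => ∫ x in (0 : ℝ)..s, ‖w x‖ ^ 2 with hr
  have hnc : Continuous fun x => ‖w x‖ ^ 2 := by fun_prop
  have hrd : ∀ s, HasDerivAt r (‖w s‖ ^ 2) s := fun s =>
    intervalIntegral.integral_hasDerivAt_right (hnc.intervalIntegrable _ _)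
      (hnc.stronglyMeasurableAtFilter _ _) hnc.continuousAt
  have hrc : Continuous r := continuous_iff_continuousAt.2 fun s => (hrd s).continuousAt
  have hr0 : r 0 = 0 := by simp [hr]
  -- The time could only stop if `w` vanished on an interval. Then `w'` would vanish there too,
  -- against the energy `μ / 2 > 0`.
  have hrm : StrictMono r := by
    intro x y hxy
    have hpos : 0 < ∫ u in x..y, ‖w u‖ ^ 2 := by
      refine intervalIntegral.integral_pos hxy hnc.continuousOn (fun u _ => by positivity) ?_
      by_contra hcon
      push Not at hcon
      have hz : ∀ u ∈ Icc x y, w u = 0 := fun u hu => by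
        have := hcon u hu
        have h2 : ‖w u‖ ^ 2 = 0 := le_antisymm this (by positivity)
        simpa using h2
      have hd0 : w' x = 0 := by
        have h1 : HasDerivWithinAt w 0 (Icc x y) x :=
          (hasDerivWithinAt_const x (Icc x y) (0 : ℂ)).congr hz (hz x ⟨le_rfl, hxy.le⟩)
        exact (uniqueDiffOn_Icc hxy x ⟨le_rfl, hxy.le⟩).eq_deriv _ (hwd x).hasDerivWithinAt h1
      have := hen x
      rw [hd0, hz x ⟨le_rfl, hxy.le⟩] at this
      simp at this
      linarith
    have h1 : r x + ∫ u in x..y, ‖w u‖ ^ 2 = r y :=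
      intervalIntegral.integral_add_adjacent_intervals (hnc.intervalIntegrable _ _)
        (hnc.intervalIntegrable _ _)
    linarith
  obtain ⟨g, hgc, hg⟩ := exists_continuous_inverse hrc hrm hb.le hr0
  have hrb : 0 < r b := hr0 ▸ hrm hb
  have hg0 : g 0 = 0 := hrm.injective ((hg 0 ⟨le_rfl, hrb.le⟩).1.trans hr0.symm)
  have hgb : g (r b) = b := hrm.injective (hg (r b) ⟨hrb.le, le_rfl⟩).1
  have hgd : ∀ t ∈ Icc 0 (r b), w (g t) ≠ 0 →
      HasDerivWithinAt g (1 / ‖w (g t)‖ ^ 2) (Icc 0 (r b)) t := by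
    intro t ht hne
    have hne' : ‖w (g t)‖ ^ 2 ≠ 0 := pow_ne_zero _ (norm_ne_zero_iff.2 hne)
    have h1 := ((hrd (g t)).hasFDerivAt_equiv hne').hasFDerivWithinAt (s := univ)
    have h2 := h1.of_local_left_inverse (g := g) (s := Icc 0 (r b)) (a := t)
      (by rw [nhdsWithin_univ]; exact hgc.continuousAt.continuousWithinAt) ht
      (eventually_nhdsWithin_of_forall fun x hx => (hg x hx).1)
    have h3 := h2.hasDerivWithinAt
    simpa using h3
  refine ⟨r b, hrb, fun t => w (g t) ^ 2, fun t => 2 * w' (g t) / (starRingEnd ℂ) (w (g t)),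
    (by fun_prop), ?_, ?_, by simp [hg0, hw0], by simp [hg0, hw0, hw0'], ?_, hq, by simp [hgb],
    by simp [hgb]⟩
  · intro t ht hne
    have hne' : w (g t) ≠ 0 := fun h => hne (by simp [h])
    have hgt := hgd t ht hne'
    have hcne : (starRingEnd ℂ) (w (g t)) ≠ 0 := by simpa using hne'
    have h1 : ((‖w (g t)‖ ^ 2 : ℝ) : ℂ) = w (g t) * (starRingEnd ℂ) (w (g t)) := by
      rw [Complex.mul_conj, Complex.normSq_eq_norm_sq]
    constructor
    · have h2 := ((hwd (g t)).pow 2).scomp_hasDerivWithinAt t hgt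
      convert! h2 using 1
      rw [Complex.real_smul, Complex.ofReal_div, h1]
      push_cast
      field_simp
    · have hcd : HasDerivAt (fun s => (starRingEnd ℂ) (w s)) ((starRingEnd ℂ) (w' (g t))) (g t) :=
        (hwd (g t)).star
      have h2 := (((hwd' (g t)).const_mul 2).div hcd hcne).scomp_hasDerivWithinAt t hgt
      convert! h2 using 1
      rw [Complex.real_smul, ← levi_civita_acceleration hne' (hen (g t))]
  · intro τ hτ h0 s h1 h2
    have h0' : w (g τ) = 0 := by simpa using h0
    -- Since `w` is odd about its zero `g τ`, the clock `r` is antisymmetric about `τ`. Hence times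
    -- symmetric about `τ` correspond to opposite values of `w`, and to equal values of `w ^ 2`.
    have hsymm : ∀ x, r (g τ + x) + r (g τ - x) = 2 * τ := by
      have hd : ∀ x, HasDerivAt (fun x => r (g τ + x) + r (g τ - x)) 0 x := fun x => by
        have e1 : HasDerivAt (fun x => r (g τ + x)) (‖w (g τ + x)‖ ^ 2) x :=
          (hrd (g τ + x)).comp_const_add (g τ) x
        have e2 : HasDerivAt (fun x => r (g τ - x)) (-‖w (g τ - x)‖ ^ 2) x :=
          (hrd (g τ - x)).comp_const_sub (g τ) x
        convert! e1.add e2 using 1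
        rw [hw, hCS.sol_refl p v h0', norm_neg]; ring
      intro x
      have := is_const_of_deriv_eq_zero (fun x => (hd x).differentiableAt) (fun x => (hd x).deriv)
        x 0
      simp only [add_zero, sub_zero] at this
      rw [this, (hg τ hτ).1]; ring
    have h3 : g (τ - s) = g τ - (g (τ + s) - g τ) := by
      refine hrm.injective ?_
      have := hsymm (g (τ + s) - g τ)
      rw [add_sub_cancel, (hg _ h2).1] at this
      rw [(hg _ h1).1]; linarith
    have h4 := hCS.sol_refl p v h0' (g (τ + s) - g τ)
    rw [add_sub_cancel] at h4
    simp only [h3, hw, h4, neg_sq]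
  · intro t ht
    have ht' := Ioo_subset_Icc_self ht
    refine hin _ ⟨?_, ?_⟩
    · refine hrm.lt_iff_lt.1 ?_
      rw [hr0, (hg t ht').1]; exact ht.1
    · refine hrm.lt_iff_lt.1 ?_
      rw [(hg t ht').1]; exact ht.2

/-! ### Families of star-shaped curves -/

/-- A family, parametrised by `|ε| < δ`, of closed curves `|w| = R (arg w) ε` of class `C^(n+1)`,
which starts at `ε = 0` with the unit circle. -/
structure RadialFamily (n : ℕ) (δ : ℝ) (R : ℝ → ℝ → ℝ) : Prop where
  pos : 0 < δ
  periodic : ∀ ε, |ε| < δ → Function.Periodic (fun θ => R θ ε) (2 * Real.pi)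
  lower : ∀ ε, |ε| < δ → ∀ θ, 1 / 2 < R θ ε
  smooth : ∀ ε, |ε| < δ → ∀ θ,
    ContDiffAt ℝ ((n + 1 : ℕ) : WithTop ℕ∞) (fun x : ℝ × ℝ => R x.1 x.2) (θ, ε)
  circle : ∀ θ, R θ 0 = 1

/-- The curve of polar equation `r = R θ ε`. -/
def curve (R : ℝ → ℝ → ℝ) (ε θ : ℝ) : ℂ := ((R θ ε : ℝ) : ℂ) * Complex.exp (θ * Complex.I)

/-- The derivative of `curve R ε`. -/
def dcurve (R : ℝ → ℝ → ℝ) (ε θ : ℝ) : ℂ :=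
  ((deriv (fun x => R x ε) θ : ℝ) + (R θ ε : ℝ) * Complex.I) * Complex.exp (θ * Complex.I)

/-- The radius of the curve in the direction of `w`. -/
def rad (R : ℝ → ℝ → ℝ) (ε : ℝ) (w : ℂ) : ℝ := R (Complex.arg w) ε

theorem rad_polar {R : ℝ → ℝ → ℝ} {ε : ℝ} (h : Function.Periodic (fun θ => R θ ε) (2 * Real.pi))
    {r : ℝ} (hr : 0 < r) (θ : ℝ) : rad R ε ((r : ℂ) * Complex.exp (θ * Complex.I)) = R θ ε := by
  rw [rad, Complex.arg_real_mul _ hr, Complex.arg_exp_mul_I]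
  exact h.sub_zsmul_eq _

theorem contDiffAt_arg {w : ℂ} (hw : w ∈ Complex.slitPlane) {m : WithTop ℕ∞} :
    ContDiffAt ℝ m Complex.arg w := by
  have h1 : ContDiffAt ℝ m Complex.log w := (Complex.contDiffAt_log hw).restrict_scalars ℝ
  have h2 := Complex.imCLM.contDiff.contDiffAt.comp w h1
  exact h2.congr_of_eventuallyEq (Eventually.of_forall fun x => (Complex.log_im x).symm)

theorem inner_eq_re_im (w z : ℂ) : inner ℝ w z = w.re * z.re + w.im * z.im := by
  simp [Complex.inner]; ring

theorem dcurve_sq (R : ℝ → ℝ → ℝ) (ε θ : ℝ) :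
    ‖dcurve R ε θ‖ ^ 2 = deriv (fun x => R x ε) θ ^ 2 + R θ ε ^ 2 := by
  rw [dcurve, norm_mul, Complex.norm_exp_ofReal_mul_I, mul_one, ← Complex.normSq_eq_norm_sq,
    Complex.normSq_add_mul_I]

namespace RadialFamily

variable {n : ℕ} {δ : ℝ} {R : ℝ → ℝ → ℝ}

theorem pos_R (hR : RadialFamily n δ R) {ε : ℝ} (hε : |ε| < δ) (θ : ℝ) : 0 < R θ ε :=
  lt_trans (by norm_num) (hR.lower ε hε θ)

theorem rad_lower (hR : RadialFamily n δ R) {ε : ℝ} (hε : |ε| < δ) (w : ℂ) : 1 / 2 < rad R ε w :=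
  hR.lower ε hε _

theorem norm_curve (hR : RadialFamily n δ R) {ε : ℝ} (hε : |ε| < δ) (θ : ℝ) :
    ‖curve R ε θ‖ = R θ ε := by
  rw [curve, norm_mul, Complex.norm_exp_ofReal_mul_I, mul_one, Complex.norm_real,
    Real.norm_of_nonneg (hR.pos_R hε θ).le]

theorem curve_ne_zero (hR : RadialFamily n δ R) {ε : ℝ} (hε : |ε| < δ) (θ : ℝ) :
    curve R ε θ ≠ 0 := by
  rw [← norm_pos_iff, hR.norm_curve hε]; exact hR.pos_R hε θ

theorem rad_curve (hR : RadialFamily n δ R) {ε : ℝ} (hε : |ε| < δ) (θ : ℝ) :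
    rad R ε (curve R ε θ) = R θ ε := rad_polar (hR.periodic ε hε) (hR.pos_R hε θ) θ

theorem rad_real_mul {ε r : ℝ} (hr : 0 < r) (w : ℂ) : rad R ε (r * w) = rad R ε w := by
  rw [rad, rad, Complex.arg_real_mul _ hr]

/-- The argument jumps on the negative axis. Near `w` it is replaced by `arg w + arg (x / w)`,
smooth because `x / w` is close to `1`; periodicity of `R` makes the choice of the branch
irrelevant. -/
theorem contDiffAt_rad (hR : RadialFamily n δ R) {ε : ℝ} (hε : |ε| < δ) {w : ℂ} (hw : w ≠ 0) :
    ContDiffAt ℝ ((n + 1 : ℕ) : WithTop ℕ∞) (fun x : ℂ × ℝ => rad R x.2 x.1) (w, ε) := by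
  have h1 : ContDiffAt ℝ ((n + 1 : ℕ) : WithTop ℕ∞)
      (fun x : ℂ × ℝ => R (Complex.arg w + Complex.arg (x.1 / w)) x.2) (w, ε) := by
    have h2 : ContDiffAt ℝ ((n + 1 : ℕ) : WithTop ℕ∞)
        (fun x : ℂ × ℝ => (Complex.arg w + Complex.arg (x.1 / w), x.2)) (w, ε) := by
      refine (contDiffAt_const.add ?_).prodMk contDiffAt_snd
      have h3 : ContDiffAt ℝ ((n + 1 : ℕ) : WithTop ℕ∞) (fun x : ℂ × ℝ => x.1 / w) (w, ε) :=
        contDiffAt_fst.div_const w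
      refine (contDiffAt_arg ?_).comp (w, ε) h3
      simp [div_self hw]
    refine ContDiffAt.comp (w, ε) (g := fun x : ℝ × ℝ => R x.1 x.2) ?_ h2
    exact hR.smooth ε hε _
  refine h1.congr_of_eventuallyEq ?_
  have e1 : ∀ᶠ x : ℂ × ℝ in 𝓝 (w, ε), x.1 ≠ 0 := continuousAt_fst.eventually_ne hw
  have e2 : ∀ᶠ x : ℂ × ℝ in 𝓝 (w, ε), |x.2| < δ :=
    (continuous_abs.continuousAt.comp continuousAt_snd).eventually_lt continuousAt_const hε
  filter_upwards [e1, e2] with x hx hxε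
  have h3 : x.1 = ((‖w‖ * ‖x.1 / w‖ : ℝ) : ℂ) *
      Complex.exp ((Complex.arg w + Complex.arg (x.1 / w) : ℝ) * Complex.I) := by
    calc x.1 = w * (x.1 / w) := (mul_div_cancel₀ x.1 hw).symm
      _ = (‖w‖ * Complex.exp (Complex.arg w * Complex.I)) *
          (‖x.1 / w‖ * Complex.exp (Complex.arg (x.1 / w) * Complex.I)) := by
        rw [Complex.norm_mul_exp_arg_mul_I, Complex.norm_mul_exp_arg_mul_I]
      _ = _ := by
        rw [Complex.ofReal_add, add_mul, Complex.exp_add, Complex.ofReal_mul]; ring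
  have h4 := rad_polar (hR.periodic x.2 hxε) (r := ‖w‖ * ‖x.1 / w‖)
    (mul_pos (norm_pos_iff.2 hw) (norm_pos_iff.2 (div_ne_zero hx hw)))
    (Complex.arg w + Complex.arg (x.1 / w))
  rw [← h3] at h4
  exact h4

theorem continuousAt_rad (hR : RadialFamily n δ R) {ε : ℝ} (hε : |ε| < δ) {w : ℂ} (hw : w ≠ 0) :
    ContinuousAt (rad R ε) w :=
  (hR.contDiffAt_rad hε hw).continuousAt.comp (f := fun x : ℂ => (x, ε))
    (continuousAt_id.prodMk continuousAt_const)

theorem differentiableAt (hR : RadialFamily n δ R) {ε : ℝ} (hε : |ε| < δ) (θ : ℝ) :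
    DifferentiableAt ℝ (fun x => R x ε) θ := by
  have h1 := (hR.smooth ε hε θ).differentiableAt (by simp)
  exact h1.comp (f := fun x : ℝ => (x, ε)) θ (differentiableAt_id.prodMk (differentiableAt_const ε))

theorem hasDerivAt_curve (hR : RadialFamily n δ R) {ε : ℝ} (hε : |ε| < δ) (θ : ℝ) :
    HasDerivAt (curve R ε) (dcurve R ε θ) θ := by
  have h1 := (hR.differentiableAt hε θ).hasDerivAt.ofReal_comp
  have h2 : HasDerivAt (fun x : ℝ => Complex.exp (x * Complex.I))
      (Complex.exp (θ * Complex.I) * (1 * Complex.I)) θ :=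
    (Complex.ofRealCLM.hasDerivAt.mul_const Complex.I).cexp
  convert! h1.mul h2 using 1
  simp only [dcurve]; ring

theorem curve_periodic (hR : RadialFamily n δ R) {ε : ℝ} (hε : |ε| < δ) :
    Function.Periodic (curve R ε) (2 * Real.pi) := fun θ => by
  have h1 : R (θ + 2 * Real.pi) ε = R θ ε := hR.periodic ε hε θ
  rw [curve, curve, h1]
  push_cast
  rw [add_mul, Complex.exp_add, Complex.exp_two_pi_mul_I, mul_one]

theorem dcurve_periodic (hR : RadialFamily n δ R) {ε : ℝ} (hε : |ε| < δ) :
    Function.Periodic (dcurve R ε) (2 * Real.pi) := fun θ => by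
  have h1 : R (θ + 2 * Real.pi) ε = R θ ε := hR.periodic ε hε θ
  have h2 : deriv (fun x => R x ε) (θ + 2 * Real.pi) = deriv (fun x => R x ε) θ := by
    rw [← deriv_comp_add_const]
    congr 1
    funext x
    exact hR.periodic ε hε x
  rw [dcurve, dcurve, h1, h2, Complex.ofReal_add, Complex.ofReal_mul, Complex.ofReal_ofNat,
    add_mul (θ : ℂ), Complex.exp_add, Complex.exp_two_pi_mul_I, mul_one]

theorem curve_inj (hR : RadialFamily n δ R) {ε : ℝ} (hε : |ε| < δ) {θ θ' : ℝ}
    (h : curve R ε θ = curve R ε θ') : (θ : AddCircle (2 * Real.pi)) = θ' := by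
  have h1 : R θ ε = R θ' ε := by rw [← hR.norm_curve hε, h, hR.norm_curve hε]
  have h2 : ((R θ' ε : ℝ) : ℂ) ≠ 0 := by exact_mod_cast (hR.pos_R hε θ').ne'
  rw [curve, curve, h1] at h
  obtain ⟨m, hm⟩ := Complex.exp_eq_exp_iff_exists_int.1 (mul_left_cancel₀ h2 h)
  have h3 : (θ : ℂ) = θ' + m * (2 * Real.pi) := by
    refine mul_right_cancel₀ Complex.I_ne_zero ?_
    rw [hm]; ring
  have h4 : θ = θ' + m * (2 * Real.pi) := by exact_mod_cast h3
  rw [h4, AddCircle.coe_add, add_eq_left, AddCircle.coe_eq_zero_iff]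
  exact ⟨m, by simp⟩

theorem curve_congr (hR : RadialFamily n δ R) {ε : ℝ} (hε : |ε| < δ) {θ θ' : ℝ}
    (h : (θ : AddCircle (2 * Real.pi)) = θ') :
    curve R ε θ = curve R ε θ' ∧ dcurve R ε θ = dcurve R ε θ' := by
  rw [← sub_eq_zero, ← AddCircle.coe_sub, AddCircle.coe_eq_zero_iff] at h
  obtain ⟨m, hm⟩ := h
  have h4 : θ = θ' + m • (2 * Real.pi) := by rw [hm]; ring
  rw [h4]
  exact ⟨(hR.curve_periodic hε).zsmul m θ', (hR.dcurve_periodic hε).zsmul m θ'⟩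

/-! ### The enclosed domain -/

/-- The function `rad` need not be continuous at the origin; there the uniform lower bound `1 / 2`
takes over. -/
theorem isOpen_domain (hR : RadialFamily n δ R) {ε : ℝ} (hε : |ε| < δ) :
    IsOpen {z : ℂ | ‖z‖ < rad R ε z} := by
  rw [isOpen_iff_mem_nhds]
  intro z hz
  by_cases h0 : z = 0
  · subst h0
    filter_upwards [Metric.ball_mem_nhds (0 : ℂ) (by norm_num : (0 : ℝ) < 1 / 2)] with y hy
    rw [mem_ball_zero_iff] at hy
    exact hy.trans (hR.rad_lower hε y)
  · exact continuous_norm.continuousAt.eventually_lt (hR.continuousAt_rad hε h0) hz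

theorem notMem_closure_domain (hR : RadialFamily n δ R) {ε : ℝ} (hε : |ε| < δ) {z : ℂ}
    (hz : rad R ε z < ‖z‖) : z ∉ closure {z : ℂ | ‖z‖ < rad R ε z} := by
  have h0 : z ≠ 0 := by
    rintro rfl
    rw [norm_zero] at hz
    linarith [hR.rad_lower hε 0]
  rw [mem_closure_iff_frequently, not_frequently]
  filter_upwards [(hR.continuousAt_rad hε h0).eventually_lt continuous_norm.continuousAt hz] with y
    hy using not_lt.2 hy.le

theorem curve_mem_frontier (hR : RadialFamily n δ R) {ε : ℝ} (hε : |ε| < δ) (θ : ℝ) :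
    curve R ε θ ∈ frontier {z : ℂ | ‖z‖ < rad R ε z} := by
  rw [(hR.isOpen_domain hε).frontier_eq]
  refine ⟨?_, ?_⟩
  · have hc : ContinuousWithinAt (fun r : ℝ => (r : ℂ) * curve R ε θ) (Ioo 0 1) 1 := by
      fun_prop
    have := hc.mem_closure (t := {z : ℂ | ‖z‖ < rad R ε z})
      (by rw [closure_Ioo (by norm_num)]; exact ⟨by norm_num, le_rfl⟩) (fun r hr => by
        rw [mem_ofPred_eq, rad_real_mul hr.1, hR.rad_curve hε, norm_mul, hR.norm_curve hε,
          Complex.norm_real, Real.norm_of_nonneg hr.1.le]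
        nlinarith [hr.2, hR.pos_R hε θ])
    simpa using this
  · rw [mem_ofPred_eq, hR.rad_curve hε, hR.norm_curve hε]
    exact lt_irrefl _

end RadialFamily

/-- The radius of the curve `bdry f ε`. -/
def bdryRadius (f : ℝ → ℝ → ℝ) (ξ ε : ℝ) : ℝ := 1 + ε * f ξ ε

theorem domain_eq {n : ℕ} {δ : ℝ} {f : ℝ → ℝ → ℝ} (hR : RadialFamily n δ (bdryRadius f)) {ε : ℝ}
    (hε : |ε| < δ) : domain f ε = {z : ℂ | ‖z‖ < rad (bdryRadius f) ε z} := by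
  ext z
  constructor
  · rintro ⟨r, ξ, hr, hlt, rfl⟩
    rcases hr.eq_or_lt with rfl | hr
    · simp only [mem_ofPred_eq, Complex.ofReal_zero, zero_mul, norm_zero]
      exact lt_trans (by norm_num) (hR.rad_lower hε 0)
    · rw [mem_ofPred_eq, rad_polar (hR.periodic ε hε) hr, norm_mul, Complex.norm_exp_ofReal_mul_I,
        Complex.norm_real, Real.norm_of_nonneg hr.le, mul_one]
      exact hlt
  · intro hz
    exact ⟨‖z‖, Complex.arg z, norm_nonneg z, hz, (Complex.norm_mul_exp_arg_mul_I z).symm⟩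

theorem bdry_eq (f : ℝ → ℝ → ℝ) (ε : ℝ) : bdry f ε = curve (bdryRadius f) ε := rfl

theorem deriv_bdry {n : ℕ} {δ : ℝ} {f : ℝ → ℝ → ℝ} (hR : RadialFamily n δ (bdryRadius f)) {ε : ℝ}
    (hε : |ε| < δ) (ξ : ℝ) : deriv (bdry f ε) ξ = dcurve (bdryRadius f) ε ξ := by
  rw [bdry_eq]; exact (hR.hasDerivAt_curve hε ξ).deriv

/-! ### The first return relation -/

/-- The squares of the scalar products with `d` and `-i d` add up to `|d|² |v|²`. So the tangential
part and the norm determine the normal part up to its sign, which is prescribed. -/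
theorem eq_of_inner_eq {d v v' : ℂ} (h : inner ℝ d v = inner ℝ d v') (hn : ‖v‖ ^ 2 = ‖v'‖ ^ 2)
    (hv : 0 < inner ℝ (-Complex.I * d) v) (hv' : 0 < inner ℝ (-Complex.I * d) v') : v = v' := by
  simp only [inner_eq_re_im, ← Complex.normSq_eq_norm_sq, Complex.normSq_apply, neg_mul,
    Complex.neg_re, Complex.neg_im, Complex.mul_re, Complex.mul_im, Complex.I_re, Complex.I_im,
    zero_mul, one_mul, zero_sub, zero_add, neg_neg] at h hn hv hv'
  have hs : (d.im * v.re + -(d.re * v.im)) ^ 2 = (d.im * v'.re + -(d.re * v'.im)) ^ 2 := by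
    linear_combination (d.re ^ 2 + d.im ^ 2) * hn
      - (d.re * v.re + d.im * v.im + d.re * v'.re + d.im * v'.im) * h
  have hs' := (sq_eq_sq₀ hv.le hv'.le).1 hs
  have hd : d.re ^ 2 + d.im ^ 2 ≠ 0 := fun h0 => by
    have h1 : d.re = 0 := by nlinarith
    have h2 : d.im = 0 := by nlinarith
    simp [h1, h2] at hv
  apply Complex.ext
  · refine mul_left_cancel₀ hd ?_
    linear_combination d.re * h + d.im * hs'
  · refine mul_left_cancel₀ hd ?_
    linear_combination d.im * h - d.re * hs'

theorem eq_of_inner_eq' {d v v' : ℂ} (h : inner ℝ d v = inner ℝ d v') (hn : ‖v‖ ^ 2 = ‖v'‖ ^ 2)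
    (hv : inner ℝ (-Complex.I * d) v < 0) (hv' : inner ℝ (-Complex.I * d) v' < 0) : v = v' :=
  neg_injective (eq_of_inner_eq (d := d) (by rw [inner_neg_right, inner_neg_right, h])
    (by rw [norm_neg, norm_neg, hn])
    (by rw [inner_neg_right]; linarith) (by rw [inner_neg_right]; linarith))

/-- At zero energy `|v| = √(2 V)`, so `√V` cancels against the normalisation of the sine. The right
side no longer contains the potential, which makes Snell's law a statement on tangential components.
-/
theorem sqrt_mul_sinAngle {V : ℂ → ℝ} {γ : ℝ → ℂ} {ξ : ℝ} {v : ℂ} (hv : v ≠ 0)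
    (h : ZeroEnergy V (γ ξ) v) :
    √(V (γ ξ)) * sinAngle γ ξ v = inner ℝ (deriv γ ξ) v / (√2 * ‖deriv γ ξ‖) := by
  have hV : V (γ ξ) = ‖v‖ ^ 2 / 2 := by unfold ZeroEnergy at h; linarith
  have hv' : ‖v‖ ≠ 0 := norm_ne_zero_iff.2 hv
  rw [hV, Real.sqrt_div (by positivity), Real.sqrt_sq (norm_nonneg v), sinAngle]
  by_cases hd : ‖deriv γ ξ‖ = 0
  · simp [hd]
  · field_simp

theorem PointsOutward.ne_zero {γ : ℝ → ℂ} {ξ : ℝ} {v : ℂ} (h : PointsOutward γ ξ v) :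
    v ≠ 0 ∧ deriv γ ξ ≠ 0 := by
  constructor <;> intro h0 <;> simp [PointsOutward, h0] at h

theorem PointsInward.ne_zero {γ : ℝ → ℂ} {ξ : ℝ} {v : ℂ} (h : PointsInward γ ξ v) :
    v ≠ 0 ∧ deriv γ ξ ≠ 0 := by
  constructor <;> intro h0 <;> simp [PointsInward, h0] at h

theorem ZeroEnergy.norm_sq_eq {V : ℂ → ℝ} {p v v' : ℂ} (h : ZeroEnergy V p v)
    (h' : ZeroEnergy V p v') : ‖v‖ ^ 2 = ‖v'‖ ^ 2 := by
  unfold ZeroEnergy at h h'; linarith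

/-- Snell's law says that the tangential component of the velocity does not change. -/
theorem snell_iff {E ω h μ : ℝ} {γ : ℝ → ℂ} {ξ : ℝ} {vE vI : ℂ} (hd : deriv γ ξ ≠ 0)
    (hvE : vE ≠ 0) (hvI : vI ≠ 0) (hE : ZeroEnergy (outerPotential E ω) (γ ξ) vE)
    (hI : ZeroEnergy (innerPotential E h μ) (γ ξ) vI) :
    Snell E ω h μ γ ξ vE vI ↔ inner ℝ (deriv γ ξ) vI = inner ℝ (deriv γ ξ) vE := by
  rw [Snell, sqrt_mul_sinAngle hvE hE, sqrt_mul_sinAngle hvI hI]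
  have h1 : √2 * ‖deriv γ ξ‖ ≠ 0 := mul_ne_zero (by positivity) (norm_ne_zero_iff.2 hd)
  exact div_left_inj' h1

theorem action_eq {E ω : ℝ} {γ : ℝ → ℂ} {ξ : ℝ} {v : ℂ} (hd : deriv γ ξ ≠ 0) (hv : v ≠ 0)
    (hE : ZeroEnergy (outerPotential E ω) (γ ξ) v) :
    action E ω γ ξ v = inner ℝ (deriv γ ξ) v / √2 := by
  have h1 : ‖deriv γ ξ‖ ≠ 0 := norm_ne_zero_iff.2 hd
  rw [action, sqrt_mul_sinAngle hv hE]
  field_simp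

/-! ### The trigonometric and the hyperbolic linear flows. -/

theorem linearFlow_cos {ω : ℝ} (hω : 0 < ω) :
    LinearFlow (-ω ^ 2) (fun t => Real.cos (ω * t)) (fun t => Real.sin (ω * t) / ω) where
  hasDerivAt_C t := by
    convert! ((hasDerivAt_id t).const_mul ω).cos using 1
    field_simp
    simp
  hasDerivAt_S t := by
    convert! (((hasDerivAt_id t).const_mul ω).sin).div_const ω using 1
    field_simp
    simp
  C_zero := by simp
  S_zero := by simp
  C_neg t := by simp
  S_neg t := by simp [neg_div]
  C_add s t := by rw [mul_add, Real.cos_add]; field_simp; ring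
  S_add s t := by rw [mul_add, Real.sin_add]; field_simp
  contDiff_C n := by fun_prop
  contDiff_S n := by fun_prop

theorem linearFlow_cosh {κ : ℝ} (hκ : 0 < κ) :
    LinearFlow (κ ^ 2) (fun t => Real.cosh (κ * t)) (fun t => Real.sinh (κ * t) / κ) where
  hasDerivAt_C t := by
    convert! ((hasDerivAt_id t).const_mul κ).cosh using 1
    field_simp
    simp
  hasDerivAt_S t := by
    convert! (((hasDerivAt_id t).const_mul κ).sinh).div_const κ using 1
    field_simp
    simp
  C_zero := by simp
  S_zero := by simp
  C_neg t := by simp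
  S_neg t := by simp [neg_div]
  C_add s t := by rw [mul_add, Real.cosh_add]; field_simp
  S_add s t := by rw [mul_add, Real.sinh_add]; field_simp
  contDiff_C n := by fun_prop
  contDiff_S n := by fun_prop

/-! ### Determinism and injectivity of the first return relation. -/

section FirstReturn

variable {E ω h μ : ℝ} {n : ℕ} {δ : ℝ} {f : ℝ → ℝ → ℝ} {ε : ℝ}

theorem bdry_congr (hR : RadialFamily n δ (bdryRadius f)) (hε : |ε| < δ) {ξ ξ' : ℝ}
    (h : (ξ : AddCircle (2 * Real.pi)) = ξ') :
    bdry f ε ξ = bdry f ε ξ' ∧ deriv (bdry f ε) ξ = deriv (bdry f ε) ξ' := by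
  rw [deriv_bdry hR hε, deriv_bdry hR hε]
  exact hR.curve_congr hε h

theorem bdry_mem_frontier (hR : RadialFamily n δ (bdryRadius f)) (hε : |ε| < δ) (ξ : ℝ) :
    bdry f ε ξ ∈ frontier (domain f ε) := by
  rw [domain_eq hR hε]; exact hR.curve_mem_frontier hε ξ

theorem isOpen_domain (hR : RadialFamily n δ (bdryRadius f)) (hε : |ε| < δ) :
    IsOpen (domain f ε) := by
  rw [domain_eq hR hε]; exact hR.isOpen_domain hε

theorem zero_mem_domain (hR : RadialFamily n δ (bdryRadius f)) (hε : |ε| < δ) :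
    (0 : ℂ) ∈ domain f ε := by
  rw [domain_eq hR hε, mem_ofPred_eq, norm_zero]
  exact lt_trans (by norm_num) (hR.rad_lower hε 0)

theorem IsFirstReturn.congr (hR : RadialFamily n δ (bdryRadius f)) (hε : |ε| < δ)
    {ξ₀ I₀ ξ₁ I₁ ξ₀' ξ₁' : ℝ} (hret : IsFirstReturn E ω h μ f ε ξ₀ I₀ ξ₁ I₁)
    (h0 : (ξ₀ : AddCircle (2 * Real.pi)) = ξ₀') (h1 : (ξ₁ : AddCircle (2 * Real.pi)) = ξ₁') :
    IsFirstReturn E ω h μ f ε ξ₀' I₀ ξ₁' I₁ := by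
  obtain ⟨e0, d0⟩ := bdry_congr hR hε h0
  obtain ⟨e1, d1⟩ := bdry_congr hR hε h1
  simpa only [IsFirstReturn, PointsOutward, PointsInward, ZeroEnergy, action, Snell, sinAngle,
    e0, d0, e1, d1] using hret

/-- Each stage is determined by the previous one: velocities by `eq_of_inner_eq`, arcs by their
uniqueness. Parameters on the curve are determined only modulo `2π`, so the data are carried over
with `bdry_congr` after each arc. -/
theorem IsFirstReturn.unique (hω : 0 < ω) (hR : RadialFamily n δ (bdryRadius f)) (hε : |ε| < δ)
    {ξ₀ I₀ ξ₁ I₁ ξ₁' I₁' : ℝ} (hret : IsFirstReturn E ω h μ f ε ξ₀ I₀ ξ₁ I₁)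
    (hret' : IsFirstReturn E ω h μ f ε ξ₀ I₀ ξ₁' I₁') :
    (ξ₁ : AddCircle (2 * Real.pi)) = ξ₁' ∧ I₁ = I₁' := by
  have hD := isOpen_domain hR hε
  have h0D := zero_mem_domain hR hε
  obtain ⟨ξm, v₀, vE, vI, wI, v₁, ⟨ho, hz, ha⟩, hout, ⟨hEin, hIin, hIz, hsn⟩, hinn,
    ⟨hwo, hv1, hv1z, hsn'⟩, hact⟩ := hret
  obtain ⟨ξm', v₀', vE', vI', wI', v₁', ⟨ho', hz', ha'⟩, hout', ⟨hEin', hIin', hIz', hsn2⟩, hinn',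
    ⟨hwo', hv1', hv1z', hsn2'⟩, hact'⟩ := hret'
  have s2 : √2 ≠ 0 := by positivity
  have e0 : v₀ = v₀' := by
    rw [action_eq ho.ne_zero.2 ho.ne_zero.1 hz] at ha
    rw [action_eq ho'.ne_zero.2 ho'.ne_zero.1 hz', ← ha, div_left_inj' s2] at ha'
    exact eq_of_inner_eq ha'.symm (hz.norm_sq_eq hz') ho ho'
  subst e0
  obtain ⟨eq, rfl⟩ := IsOuterArc.unique (linearFlow_cos hω) hout hout'
  obtain ⟨em, dm⟩ := bdry_congr hR hε (hR.curve_inj hε eq)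
  simp only [PointsInward, ZeroEnergy, Snell, sinAngle, ← em, ← dm] at hIin' hIz' hsn2 hinn'
  have eI : vI = vI' := by
    have h1 : Snell E ω h μ (bdry f ε) ξm vE vI := hsn
    have h2 : Snell E ω h μ (bdry f ε) ξm vE vI' := hsn2
    have hI' : PointsInward (bdry f ε) ξm vI' := hIin'
    have hZ' : ZeroEnergy (innerPotential E h μ) (bdry f ε ξm) vI' := hIz'
    rw [Snell, sqrt_mul_sinAngle hIin.ne_zero.1 hIz] at h1
    rw [Snell, sqrt_mul_sinAngle hI'.ne_zero.1 hZ', ← h1] at h2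
    have h3 : √2 * ‖deriv (bdry f ε) ξm‖ ≠ 0 :=
      mul_ne_zero s2 (norm_ne_zero_iff.2 hIin.ne_zero.2)
    rw [div_left_inj' h3] at h2
    exact eq_of_inner_eq' h2.symm (hIz.norm_sq_eq hZ') hIin hI'
  subst eI
  obtain ⟨eq1, rfl⟩ := IsInnerArc.unique hD h0D (bdry_mem_frontier hR hε ξm) hinn hinn'
  have eξ := hR.curve_inj hε eq1
  obtain ⟨e1, d1⟩ := bdry_congr hR hε eξ
  refine ⟨eξ, ?_⟩
  simp only [PointsOutward, ZeroEnergy, Snell, sinAngle, action, ← e1, ← d1] at hv1' hv1z' hsn2' hact'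
  have ev : v₁ = v₁' := by
    have h1 : Snell E ω h μ (bdry f ε) ξ₁ v₁ wI := hsn'
    have h2 : Snell E ω h μ (bdry f ε) ξ₁ v₁' wI := hsn2'
    have ho' : PointsOutward (bdry f ε) ξ₁ v₁' := hv1'
    have hZ' : ZeroEnergy (outerPotential E ω) (bdry f ε ξ₁) v₁' := hv1z'
    rw [Snell, sqrt_mul_sinAngle hv1.ne_zero.1 hv1z] at h1
    rw [Snell, sqrt_mul_sinAngle ho'.ne_zero.1 hZ', h1] at h2
    have h3 : √2 * ‖deriv (bdry f ε) ξ₁‖ ≠ 0 :=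
      mul_ne_zero s2 (norm_ne_zero_iff.2 hv1.ne_zero.2)
    rw [div_left_inj' h3] at h2
    exact eq_of_inner_eq h2 (hv1z.norm_sq_eq hZ') hv1 ho'
  subst ev
  rw [← hact, ← hact']
  rfl

/-- The construction is read backwards with reversed arcs. The definition does not prescribe the
energies of the arriving velocities `wI` and `vE`; conservation along the arcs supplies them, and
then Snell's law can be inverted. -/
theorem IsFirstReturn.injective (hω : 0 < ω) (hR : RadialFamily n δ (bdryRadius f)) (hε : |ε| < δ)
    {ξ₀ I₀ ξ₀' I₀' ξ₁ I₁ : ℝ} (hret : IsFirstReturn E ω h μ f ε ξ₀ I₀ ξ₁ I₁)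
    (hret' : IsFirstReturn E ω h μ f ε ξ₀' I₀' ξ₁ I₁) :
    (ξ₀ : AddCircle (2 * Real.pi)) = ξ₀' ∧ I₀ = I₀' := by
  have hD := isOpen_domain hR hε
  have h0D := zero_mem_domain hR hε
  have hfr := bdry_mem_frontier hR hε
  obtain ⟨ξm, v₀, vE, vI, wI, v₁, ⟨ho, hz, ha⟩, hout, ⟨hEin, hIin, hIz, hsn⟩, hinn,
    ⟨hwo, hv1, hv1z, hsn'⟩, hact⟩ := hret
  obtain ⟨ξm', v₀', vE', vI', wI', v₁', ⟨ho', hz', ha'⟩, hout', ⟨hEin', hIin', hIz', hsn2⟩, hinn',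
    ⟨hwo', hv1', hv1z', hsn2'⟩, hact'⟩ := hret'
  have s2 : √2 ≠ 0 := by positivity
  have energyI : ∀ {ξ ξ' : ℝ} {v w : ℂ}, ZeroEnergy (innerPotential E h μ) (bdry f ε ξ) v →
      IsInnerArc μ (domain f ε) (bdry f ε ξ) v (bdry f ε ξ') w →
      ZeroEnergy (innerPotential E h μ) (bdry f ε ξ') w := fun hv harc => by
    have := harc.energy hD h0D (hfr _)
    simp only [ZeroEnergy, innerPotential] at hv ⊢
    linarith
  have energyE : ∀ {ξ ξ' : ℝ} {v w : ℂ}, ZeroEnergy (outerPotential E ω) (bdry f ε ξ) v →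
      IsOuterArc ω (domain f ε) (bdry f ε ξ) v (bdry f ε ξ') w →
      ZeroEnergy (outerPotential E ω) (bdry f ε ξ') w := fun hv harc => by
    have := harc.energy (linearFlow_cos hω)
    simp only [ZeroEnergy, outerPotential] at hv ⊢
    linarith
  have hd1 := hv1.ne_zero.2
  have ev : v₁ = v₁' := by
    rw [action_eq hd1 hv1.ne_zero.1 hv1z] at hact
    rw [action_eq hd1 hv1'.ne_zero.1 hv1z', ← hact, div_left_inj' s2] at hact'
    exact eq_of_inner_eq hact'.symm (hv1z.norm_sq_eq hv1z') hv1 hv1'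
  subst ev
  have hwz := energyI hIz hinn
  have hwz' := energyI hIz' hinn'
  have ew : wI = wI' := by
    rw [snell_iff hd1 hv1.ne_zero.1 hwo.ne_zero.1 hv1z hwz] at hsn'
    rw [snell_iff hd1 hv1.ne_zero.1 hwo'.ne_zero.1 hv1z hwz'] at hsn2'
    exact eq_of_inner_eq (hsn'.trans hsn2'.symm) (hwz.norm_sq_eq hwz') hwo hwo'
  subst ew
  obtain ⟨eq1, e2⟩ := IsInnerArc.unique hD h0D (hfr ξ₁) (hinn.reverse (hfr ξm))
    (hinn'.reverse (hfr ξm'))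
  obtain rfl := neg_injective e2
  obtain ⟨em, dm⟩ := bdry_congr hR hε (hR.curve_inj hε eq1)
  have hEz := energyE hz hout
  have hEz' := energyE hz' hout'
  have hdm := hIin.ne_zero.2
  have eE : vE = vE' := by
    rw [snell_iff hdm hEin.ne_zero.1 hIin.ne_zero.1 hEz hIz] at hsn
    rw [snell_iff hIin'.ne_zero.2 hEin'.ne_zero.1 hIin'.ne_zero.1 hEz' hIz'] at hsn2
    unfold PointsInward at hEin'
    rw [← dm] at hsn2 hEin'
    rw [← em] at hEz'
    exact eq_of_inner_eq' (hsn.symm.trans hsn2) (hEz.norm_sq_eq hEz') hEin hEin'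
  subst eE
  rw [← em] at hout'
  obtain ⟨eq0, e0⟩ := IsOuterArc.unique (linearFlow_cos hω) (hout.reverse (hfr ξ₀))
    (hout'.reverse (hfr ξ₀'))
  obtain rfl := neg_injective e0
  have eξ := hR.curve_inj hε eq0
  obtain ⟨e1, d1⟩ := bdry_congr hR hε eξ
  refine ⟨eξ, ?_⟩
  rw [← ha, ← ha', action, action, sinAngle, sinAngle, e1, d1]

end FirstReturn

/-! ### First return of a trajectory depending on parameters -/

theorem isInvertible_of_apply_one_ne_zero {L : ℝ →L[ℝ] ℝ} (h : L 1 ≠ 0) : L.IsInvertible := by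
  refine ⟨ContinuousLinearEquiv.unitsEquivAut ℝ (Units.mk0 (L 1) h), ?_⟩
  ext
  simp

/-- The implicit function theorem at `T₀` gives the zero `τ`. Before it `G` stays positive: it
increases from `0` near time `0`, decreases to `0` near `T₀`, and is handled by compactness in
between. The condition `hmid` asks only for local positivity because the gap function need not be
continuous where an orbit meets the origin. -/
theorem exists_first_return {X : Type*} [NormedAddCommGroup X] [NormedSpace ℝ X] [CompleteSpace X]
    {G : X × ℝ → ℝ} {x₀ : X} {T₀ : ℝ} {n : WithTop ℕ∞} (hn : 1 ≤ n) (hT₀ : 0 < T₀)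
    (h0 : ContDiffAt ℝ n G (x₀, 0)) (hT : ContDiffAt ℝ n G (x₀, T₀))
    (hz : ∀ᶠ x in 𝓝 x₀, G (x, 0) = 0) (hd0 : 0 < fderiv ℝ G (x₀, 0) (0, 1))
    (hzT : G (x₀, T₀) = 0) (hdT : fderiv ℝ G (x₀, T₀) (0, 1) < 0)
    (hmid : ∀ t ∈ Ioo 0 T₀, ∀ᶠ p in 𝓝 (x₀, t), 0 < G p) :
    ∃ τ : X → ℝ, ContDiffAt ℝ n τ x₀ ∧ τ x₀ = T₀ ∧
      ∀ᶠ x in 𝓝 x₀, 0 < τ x ∧ G (x, τ x) = 0 ∧ ∀ t ∈ Ioo 0 (τ x), 0 < G (x, t) := by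
  have hn0 : n ≠ 0 := fun h => by simp [h] at hn
  have hinv : (fderiv ℝ G (x₀, T₀) ∘L .inr ℝ X ℝ).IsInvertible :=
    isInvertible_of_apply_one_ne_zero (by simpa using hdT.ne)
  have hτ0 := hT.implicitFunction_apply_self hn0 hinv
  have hτz := hT.eventually_apply_implicitFunction hn0 hinv
  have hτc := hT.contDiffAt_implicitFunction hn0 hinv
  set τ := hT.implicitFunction hn0 hinv
  simp only [hzT] at hτz hτ0
  refine ⟨τ, hτc, hτ0, ?_⟩
  -- differentiability and sign of the time derivative near a point
  have hnear : ∀ t₁, ContDiffAt ℝ n G (x₀, t₁) → ∀ᶠ p in 𝓝 (x₀, t₁),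
      HasDerivAt (fun t => G (p.1, t)) (fderiv ℝ G p (0, 1)) p.2 := fun t₁ h => by
    have h1 := (h.of_le hn).eventually (by simp)
    filter_upwards [h1] with p hp
    have h2 := (hp.differentiableAt (by simp)).hasFDerivAt
    have h3 : HasDerivAt (fun t : ℝ => (p.1, t)) ((0 : X), (1 : ℝ)) p.2 :=
      (hasDerivAt_const p.2 p.1).prodMk (hasDerivAt_id p.2)
    exact HasFDerivAt.comp_hasDerivAt p.2 (f := fun t : ℝ => (p.1, t)) h2 h3
  have hcont : ∀ t₁, ContDiffAt ℝ n G (x₀, t₁) →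
      ContinuousAt (fun p => fderiv ℝ G p (0, 1)) (x₀, t₁) := fun t₁ h =>
    (((h.of_le hn).fderiv_right (m := 0) (by simp)).continuousAt).clm_apply continuousAt_const
  have hA : ∀ᶠ p in 𝓝 (x₀, (0 : ℝ)), HasDerivAt (fun t => G (p.1, t)) (fderiv ℝ G p (0, 1)) p.2 ∧
      0 < fderiv ℝ G p (0, 1) :=
    (hnear 0 h0).and (continuousAt_const.eventually_lt (hcont 0 h0) hd0)
  have hB : ∀ᶠ p in 𝓝 (x₀, T₀), HasDerivAt (fun t => G (p.1, t)) (fderiv ℝ G p (0, 1)) p.2 ∧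
      fderiv ℝ G p (0, 1) < 0 :=
    (hnear T₀ hT).and ((hcont T₀ hT).eventually_lt continuousAt_const hdT)
  rw [nhds_prod_eq, eventually_prod_iff] at hA hB
  obtain ⟨pa, hpa, qa, hqa, hA⟩ := hA
  obtain ⟨pb, hpb, qb, hqb, hB⟩ := hB
  obtain ⟨r₀, hr₀, hqa⟩ := Metric.eventually_nhds_iff.1 hqa
  obtain ⟨r₁, hr₁, hqb⟩ := Metric.eventually_nhds_iff.1 hqb
  -- One radius for which the two monotone zones and the compact interval `[r, T₀ - r]` cover `(0, τ
  -- x)`.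
  set r := min (min (r₀ / 2) (r₁ / 2)) (T₀ / 2) with hr
  have hr0 : 0 < r := by positivity
  have hrr0 : r < r₀ := lt_of_le_of_lt ((min_le_left _ _).trans (min_le_left _ _)) (by linarith)
  have hrr1 : r < r₁ := lt_of_le_of_lt ((min_le_left _ _).trans (min_le_right _ _)) (by linarith)
  have hrT : r ≤ T₀ / 2 := min_le_right _ _
  have hC : ∀ᶠ x in 𝓝 x₀, ∀ t ∈ Icc r (T₀ - r), 0 < G (x, t) :=
    isCompact_Icc.eventually_forall_of_forall_eventually (P := fun x t => 0 < G (x, t))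
      fun t ht => hmid t ⟨by linarith [ht.1], by linarith [ht.2]⟩
  have hτT : ∀ᶠ x in 𝓝 x₀, |τ x - T₀| < r := by
    have := hτc.continuousAt.tendsto
    rw [hτ0] at this
    simpa [Real.dist_eq] using this.eventually (Metric.ball_mem_nhds T₀ hr0)
  filter_upwards [hz, hpa, hpb, hC, hτT, hτz] with x hz hpa hpb hC hτT hτz
  rw [abs_lt] at hτT
  refine ⟨by linarith, hτz, fun t ht => ?_⟩
  rcases le_or_gt t r with h1 | h1
  · have hm : StrictMonoOn (fun t => G (x, t)) (Icc 0 r) := by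
      have hd : ∀ s ∈ Icc 0 r, _ := fun s hs => hA hpa (hqa (y := s) (by
        rw [Real.dist_eq, sub_zero, abs_of_nonneg hs.1]; exact hs.2.trans_lt hrr0))
      refine strictMonoOn_of_deriv_pos (convex_Icc _ _)
        (fun s hs => (hd s hs).1.continuousAt.continuousWithinAt) fun s hs => ?_
      have := hd s (interior_subset hs)
      rw [this.1.deriv]; exact this.2
    have := hm ⟨le_rfl, hr0.le⟩ ⟨ht.1.le, h1⟩ ht.1
    simpa only [hz] using this
  · rcases le_or_gt t (T₀ - r) with h2 | h2
    · exact hC t ⟨h1.le, h2⟩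
    · have hm : StrictAntiOn (fun t => G (x, t)) (Icc (T₀ - r) (T₀ + r)) := by
        have hd : ∀ s ∈ Icc (T₀ - r) (T₀ + r), _ := fun s hs => hB hpb (hqb (y := s) (by
          rw [Real.dist_eq, abs_lt]; constructor <;> linarith [hs.1, hs.2]))
        refine strictAntiOn_of_deriv_neg (convex_Icc _ _)
          (fun s hs => (hd s hs).1.continuousAt.continuousWithinAt) fun s hs => ?_
        have := hd s (interior_subset hs)
        rw [this.1.deriv]; exact this.2
      have := hm ⟨h2.le, by linarith [ht.2]⟩ ⟨by linarith, by linarith⟩ ht.2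
      simpa only [hτz] using this

/-! ### Arc systems -/

/-- The data of a linear flow `w'' = l w` with energy `|w'|² - l |w|² = e`, followed on the side
`σ` of a family of curves `|w| = R (arg w) ε` (`σ = 1`: outside, `σ = -1`: inside). The point of
arrival is looked for near the direction obtained by a rotation by the angle `c`. -/
structure ArcSystem where
  l : ℝ
  e : ℝ
  σ : ℝ
  c : ℝ
  C : ℝ → ℝ
  S : ℝ → ℝ
  R : ℝ → ℝ → ℝ

namespace ArcSystem

/-- The first zero at the return, in the circular case with radial velocity `a` and energy `e`, is
a condition on the fundamental solutions. -/
structure Valid (A : ArcSystem) (n : ℕ) (δ : ℝ) : Prop where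
  flow : LinearFlow A.l A.C A.S
  fam : RadialFamily n δ A.R
  sigma : A.σ = 1 ∨ A.σ = -1
  e_pos : 0 < A.e
  l_ne : A.l ≠ 0
  -- On the circle the radial orbit returns at its starting point outside, and at the opposite point
  -- inside; the latter has the same square, which is the bounce at a collision.
  exp_c : Complex.exp (A.c * Complex.I) = A.σ
  -- From `w = 1` with velocity `a + i J` and `a² + J² = e + l` one gets `|w|² - 1 = S (2 a C + (e +
  -- 2 l) S)`. The return is thus a zero of the second factor before `S` vanishes.
  ret : ∀ a, 0 < A.σ * a → a ^ 2 ≤ A.e + A.l → ∃ T, 0 < T ∧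
    2 * a * A.C T + (A.e + 2 * A.l) * A.S T = 0 ∧ ∀ t ∈ Ioc 0 T, 0 < A.S t

variable (A : ArcSystem)

/-- The square of the normal component of the initial velocity, times `‖dcurve‖²`. A point
`x = (η, J, ε)` consists of the parameter on the curve, the tangential momentum and the
parameter of the family. -/
def disc (x : ℝ × ℝ × ℝ) : ℝ :=
  (A.e + A.l * A.R x.1 x.2.2 ^ 2) * (deriv (fun θ => A.R θ x.2.2) x.1 ^ 2 + A.R x.1 x.2.2 ^ 2)
    - x.2.1 ^ 2

/-- The initial velocity with tangential momentum `x.2.1` and energy `A.e`, on the side `A.σ`. -/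
def startVel (x : ℝ × ℝ × ℝ) : ℂ :=
  (((deriv (fun θ => A.R θ x.2.2) x.1 ^ 2 + A.R x.1 x.2.2 ^ 2)⁻¹ : ℝ) : ℂ) *
    (((x.2.1 : ℝ) : ℂ) - Complex.I * ((A.σ * √(A.disc x) : ℝ) : ℂ)) * dcurve A.R x.2.2 x.1

/-- The trajectory. -/
def orbit (x : ℝ × ℝ × ℝ) (t : ℝ) : ℂ := sol A.C A.S (curve A.R x.2.2 x.1) (A.startVel x) t

/-- The velocity along the trajectory. -/
def orbitVel (x : ℝ × ℝ × ℝ) (t : ℝ) : ℂ :=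
  solVel A.l A.C A.S (curve A.R x.2.2 x.1) (A.startVel x) t

/-- A function which is positive when the trajectory is on the side `A.σ` of the curve. -/
def gap (x : ℝ × ℝ × ℝ) (t : ℝ) : ℝ :=
  A.σ * (‖A.orbit x t‖ ^ 2 - rad A.R x.2.2 (A.orbit x t) ^ 2)

/-- `T` is the time of the first return to the curve. -/
def IsReturnTime (x : ℝ × ℝ × ℝ) (T : ℝ) : Prop :=
  0 < T ∧ A.gap x T = 0 ∧ ∀ t ∈ Ioo 0 T, 0 < A.gap x t

open Classical in
/-- The time of the first return to the curve. -/
def retTime (x : ℝ × ℝ × ℝ) : ℝ :=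
  if h : ∃ T, A.IsReturnTime x T then h.choose else 0

/-- The parameter of the point of arrival. -/
def arcAngle (x : ℝ × ℝ × ℝ) : ℝ :=
  -- Rotating back by `x.1 + c` before taking the argument keeps it off the cut near the circular
  -- case. The result is a smooth lift, not just an angle modulo `2π`.
  x.1 + A.c + Complex.arg (Complex.exp (-((x.1 + A.c : ℝ) * Complex.I)) * A.orbit x (A.retTime x))

/-- The tangential momentum at the point of arrival. -/
def arcMom (x : ℝ × ℝ × ℝ) : ℝ :=
  inner ℝ (dcurve A.R x.2.2 (A.arcAngle x)) (A.orbitVel x (A.retTime x))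

/-- The transition map of the arc system. -/
def arcMap (x : ℝ × ℝ × ℝ) : ℝ × ℝ := (A.arcAngle x, A.arcMom x)

/-- The angular shift for the unit circle. -/
def shift (J : ℝ) : ℝ :=
  Complex.arg ⟨A.e - 2 * J ^ 2, 2 * A.σ * J * √(A.e + A.l - J ^ 2)⟩

/-- The arc from `x` returns transversally to the curve, and depends smoothly on `x`. -/
structure Good (n : ℕ) (δ : ℝ) (x : ℝ × ℝ × ℝ) : Prop where
  small : |x.2.2| < δ
  disc_pos : 0 < A.disc x
  isReturnTime : A.IsReturnTime x (A.retTime x)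
  landing : A.orbit x (A.retTime x) = curve A.R x.2.2 (A.arcAngle x)
  transversal : A.σ * inner ℝ (-Complex.I * dcurve A.R x.2.2 (A.arcAngle x))
    (A.orbitVel x (A.retTime x)) < 0
  contDiffAt_retTime : ContDiffAt ℝ n A.retTime x
  contDiffAt_arcMap : ContDiffAt ℝ n A.arcMap x

variable {A} {n : ℕ} {δ : ℝ}

theorem IsReturnTime.unique {x : ℝ × ℝ × ℝ} {T T' : ℝ} (h : A.IsReturnTime x T)
    (h' : A.IsReturnTime x T') : T = T' := by
  rcases lt_trichotomy T T' with hlt | heq | hlt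
  · exact absurd h.2.1 (h'.2.2 T ⟨h.1, hlt⟩).ne'
  · exact heq
  · exact absurd h'.2.1 (h.2.2 T' ⟨h'.1, hlt⟩).ne'

theorem IsReturnTime.retTime_eq {x : ℝ × ℝ × ℝ} {T : ℝ} (h : A.IsReturnTime x T) :
    A.retTime x = T := by
  have hex : ∃ T, A.IsReturnTime x T := ⟨T, h⟩
  rw [retTime, dif_pos hex]
  exact hex.choose_spec.unique h

theorem Valid.sigma_sq (hA : A.Valid n δ) : A.σ ^ 2 = 1 := by
  rcases hA.sigma with h | h <;> rw [h] <;> norm_num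

end ArcSystem

/-! ### Smoothness -/

namespace RadialFamily

variable {n : ℕ} {δ : ℝ} {R : ℝ → ℝ → ℝ}

theorem contDiffAt_R (hR : RadialFamily n δ R) {ε : ℝ} (hε : |ε| < δ) (θ : ℝ) :
    ContDiffAt ℝ n (fun x : ℝ × ℝ => R x.1 x.2) (θ, ε) :=
  (hR.smooth ε hε θ).of_le (by exact_mod_cast n.le_succ)

theorem contDiffAt_deriv (hR : RadialFamily n δ R) {ε : ℝ} (hε : |ε| < δ) (θ : ℝ) :
    ContDiffAt ℝ n (fun x : ℝ × ℝ => deriv (fun y => R y x.2) x.1) (θ, ε) := by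
  have h1 : ContDiffAt ℝ n (fderiv ℝ (fun x : ℝ × ℝ => R x.1 x.2)) (θ, ε) :=
    (hR.smooth ε hε θ).fderiv_right (by norm_cast)
  have h2 : ContDiffAt ℝ n (fun x => fderiv ℝ (fun x : ℝ × ℝ => R x.1 x.2) x (1, 0)) (θ, ε) :=
    h1.clm_apply contDiffAt_const
  refine h2.congr_of_eventuallyEq ?_
  have e2 : ∀ᶠ x : ℝ × ℝ in 𝓝 (θ, ε), |x.2| < δ :=
    (continuous_abs.continuousAt.comp continuousAt_snd).eventually_lt continuousAt_const hε
  filter_upwards [e2] with x hx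
  have h3 := ((hR.smooth x.2 hx x.1).differentiableAt (by simp)).hasFDerivAt
  have h4 : HasDerivAt (fun y : ℝ => (y, x.2)) ((1 : ℝ), (0 : ℝ)) x.1 :=
    (hasDerivAt_id x.1).prodMk (hasDerivAt_const x.1 x.2)
  exact (HasFDerivAt.comp_hasDerivAt x.1 (f := fun y : ℝ => (y, x.2)) h3 h4).deriv

theorem contDiffAt_expI {m : WithTop ℕ∞} (θ : ℝ) :
    ContDiffAt ℝ m (fun x : ℝ => Complex.exp (x * Complex.I)) θ :=
  ((Complex.ofRealCLM.contDiff.mul contDiff_const).cexp).contDiffAt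

theorem contDiffAt_curve (hR : RadialFamily n δ R) {ε : ℝ} (hε : |ε| < δ) (θ : ℝ) :
    ContDiffAt ℝ n (fun x : ℝ × ℝ => curve R x.2 x.1) (θ, ε) :=
  (Complex.ofRealCLM.contDiff.contDiffAt.comp _ (hR.contDiffAt_R hε θ)).mul
    (ContDiffAt.comp (θ, ε) (f := Prod.fst) (g := fun y : ℝ => Complex.exp (y * Complex.I))
      (contDiffAt_expI θ) contDiffAt_fst)

theorem contDiffAt_dcurve (hR : RadialFamily n δ R) {ε : ℝ} (hε : |ε| < δ) (θ : ℝ) :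
    ContDiffAt ℝ n (fun x : ℝ × ℝ => dcurve R x.2 x.1) (θ, ε) :=
  ((Complex.ofRealCLM.contDiff.contDiffAt.comp _ (hR.contDiffAt_deriv hε θ)).add
    ((Complex.ofRealCLM.contDiff.contDiffAt.comp _ (hR.contDiffAt_R hε θ)).mul
      contDiffAt_const)).mul (ContDiffAt.comp (θ, ε) (f := Prod.fst) (g := fun y : ℝ => Complex.exp (y * Complex.I))
      (contDiffAt_expI θ) contDiffAt_fst)

end RadialFamily

namespace ArcSystem

variable {A : ArcSystem} {n : ℕ} {δ : ℝ}

theorem contDiffAt_coord {m : WithTop ℕ∞} (x : ℝ × ℝ × ℝ) :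
    ContDiffAt ℝ m (fun x : ℝ × ℝ × ℝ => (x.1, x.2.2)) x := by fun_prop

theorem normSq_pos (hA : A.Valid n δ) {x : ℝ × ℝ × ℝ} (hx : |x.2.2| < δ) :
    0 < deriv (fun θ => A.R θ x.2.2) x.1 ^ 2 + A.R x.1 x.2.2 ^ 2 := by
  have := hA.fam.pos_R hx x.1
  positivity

theorem contDiffAt_disc (hA : A.Valid n δ) {x : ℝ × ℝ × ℝ} (hx : |x.2.2| < δ) :
    ContDiffAt ℝ n A.disc x := by
  have h1 : ContDiffAt ℝ n (fun x : ℝ × ℝ × ℝ => A.R x.1 x.2.2) x :=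
    (hA.fam.contDiffAt_R hx x.1).comp x (contDiffAt_coord x)
  have h2 : ContDiffAt ℝ n (fun x : ℝ × ℝ × ℝ => deriv (fun θ => A.R θ x.2.2) x.1) x :=
    (hA.fam.contDiffAt_deriv hx x.1).comp x (contDiffAt_coord x)
  unfold disc
  fun_prop

theorem contDiffAt_startVel (hA : A.Valid n δ) {x : ℝ × ℝ × ℝ} (hx : |x.2.2| < δ)
    (hd : 0 < A.disc x) : ContDiffAt ℝ n A.startVel x := by
  have h1 : ContDiffAt ℝ n (fun x : ℝ × ℝ × ℝ => A.R x.1 x.2.2) x :=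
    (hA.fam.contDiffAt_R hx x.1).comp x (contDiffAt_coord x)
  have h2 : ContDiffAt ℝ n (fun x : ℝ × ℝ × ℝ => deriv (fun θ => A.R θ x.2.2) x.1) x :=
    (hA.fam.contDiffAt_deriv hx x.1).comp x (contDiffAt_coord x)
  have h3 : ContDiffAt ℝ n (fun x : ℝ × ℝ × ℝ => dcurve A.R x.2.2 x.1) x :=
    (hA.fam.contDiffAt_dcurve hx x.1).comp x (contDiffAt_coord x)
  have h4 : ContDiffAt ℝ n (fun x => A.σ * √(A.disc x)) x :=
    contDiffAt_const.mul ((contDiffAt_disc hA hx).sqrt hd.ne')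
  have h5 : ContDiffAt ℝ n (fun x : ℝ × ℝ × ℝ =>
      (deriv (fun θ => A.R θ x.2.2) x.1 ^ 2 + A.R x.1 x.2.2 ^ 2)⁻¹) x :=
    ((h2.pow 2).add (h1.pow 2)).inv (normSq_pos hA hx).ne'
  have h6 : ContDiffAt ℝ n (fun x : ℝ × ℝ × ℝ => x.2.1) x := by fun_prop
  exact ((Complex.ofRealCLM.contDiff.contDiffAt.comp x h5).mul
    ((Complex.ofRealCLM.contDiff.contDiffAt.comp x h6).sub
      (contDiffAt_const.mul (Complex.ofRealCLM.contDiff.contDiffAt.comp x h4)))).mul h3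

theorem contDiffAt_orbit (hA : A.Valid n δ) {x : ℝ × ℝ × ℝ} (hx : |x.2.2| < δ)
    (hd : 0 < A.disc x) (t : ℝ) :
    ContDiffAt ℝ n (fun p : (ℝ × ℝ × ℝ) × ℝ => A.orbit p.1 p.2) (x, t) ∧
    ContDiffAt ℝ n (fun p : (ℝ × ℝ × ℝ) × ℝ => A.orbitVel p.1 p.2) (x, t) := by
  have h1 : ContDiffAt ℝ n (fun p : (ℝ × ℝ × ℝ) × ℝ => curve A.R p.1.2.2 p.1.1) (x, t) :=
    ((hA.fam.contDiffAt_curve hx x.1).comp x (contDiffAt_coord x)).comp (x, t) contDiffAt_fst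
  have h2 : ContDiffAt ℝ n (fun p : (ℝ × ℝ × ℝ) × ℝ => A.startVel p.1) (x, t) :=
    (contDiffAt_startVel hA hx hd).comp (x, t) contDiffAt_fst
  have hC : ContDiffAt ℝ n (fun p : (ℝ × ℝ × ℝ) × ℝ => ((A.C p.2 : ℝ) : ℂ)) (x, t) :=
    Complex.ofRealCLM.contDiff.contDiffAt.comp _
      ((hA.flow.contDiff_C n).contDiffAt.comp (x, t) contDiffAt_snd)
  have hS : ContDiffAt ℝ n (fun p : (ℝ × ℝ × ℝ) × ℝ => ((A.S p.2 : ℝ) : ℂ)) (x, t) :=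
    Complex.ofRealCLM.contDiff.contDiffAt.comp _
      ((hA.flow.contDiff_S n).contDiffAt.comp (x, t) contDiffAt_snd)
  exact ⟨(hC.mul h1).add (hS.mul h2), ((contDiffAt_const.mul hS).mul h1).add (hC.mul h2)⟩

theorem contDiffAt_gap (hA : A.Valid n δ) {x : ℝ × ℝ × ℝ} (hx : |x.2.2| < δ)
    (hd : 0 < A.disc x) {t : ℝ} (hw : A.orbit x t ≠ 0) :
    ContDiffAt ℝ n (fun p : (ℝ × ℝ × ℝ) × ℝ => A.gap p.1 p.2) (x, t) := by
  have h1 := (contDiffAt_orbit hA hx hd t).1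
  have h2 : ContDiffAt ℝ n (fun p : (ℝ × ℝ × ℝ) × ℝ => (A.orbit p.1 p.2, p.1.2.2)) (x, t) :=
    h1.prodMk (by fun_prop)
  have h3 : ContDiffAt ℝ n (fun p : (ℝ × ℝ × ℝ) × ℝ => rad A.R p.1.2.2 (A.orbit p.1 p.2)) (x, t) :=
    ContDiffAt.comp (x, t) (g := fun y : ℂ × ℝ => rad A.R y.2 y.1)
      ((hA.fam.contDiffAt_rad hx hw).of_le (by exact_mod_cast n.le_succ)) h2
  exact contDiffAt_const.mul ((h1.norm_sq ℝ).sub (h3.pow 2))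

/-! ### The initial velocity -/

/-- The initial velocity is written in the orthogonal frame given by the tangent `d` and the normal
`-i d`; `disc` is the square of the normal coefficient that the energy leaves once the tangential
one is chosen. -/
theorem startVel_facts (hA : A.Valid n δ) {x : ℝ × ℝ × ℝ} (hx : |x.2.2| < δ) (hd : 0 < A.disc x) :
    inner ℝ (dcurve A.R x.2.2 x.1) (A.startVel x) = x.2.1 ∧
    inner ℝ (-Complex.I * dcurve A.R x.2.2 x.1) (A.startVel x) = A.σ * √(A.disc x) ∧
    ‖A.startVel x‖ ^ 2 = A.e + A.l * ‖curve A.R x.2.2 x.1‖ ^ 2 := by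
  have hN := normSq_pos hA hx
  have hdc := dcurve_sq A.R x.2.2 x.1
  rw [hA.fam.norm_curve hx]
  have hs := Real.sq_sqrt hd.le
  have hd' : A.disc x = (A.e + A.l * A.R x.1 x.2.2 ^ 2) *
    (deriv (fun θ => A.R θ x.2.2) x.1 ^ 2 + A.R x.1 x.2.2 ^ 2) - x.2.1 ^ 2 := rfl
  rw [startVel]
  set N := deriv (fun θ => A.R θ x.2.2) x.1 ^ 2 + A.R x.1 x.2.2 ^ 2
  set s := √(A.disc x)
  set d := dcurve A.R x.2.2 x.1
  have hσ := hA.sigma_sq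
  rw [← Complex.normSq_eq_norm_sq, Complex.normSq_apply] at hdc
  have hN' : N⁻¹ * N = 1 := inv_mul_cancel₀ hN.ne'
  refine ⟨?_, ?_, ?_⟩
  · simp
    linear_combination (N⁻¹ * x.2.1) * hdc + x.2.1 * hN'
  · simp
    linear_combination (N⁻¹ * A.σ * s) * hdc + A.σ * s * hN'
  · rw [← Complex.normSq_eq_norm_sq, Complex.normSq_mul, Complex.normSq_mul,
      Complex.normSq_apply d, hdc]
    simp [Complex.normSq_apply]
    linear_combination (N⁻¹ * s ^ 2 * N⁻¹ * N) * hσ + (N⁻¹ * N⁻¹ * N) * (hs.trans hd') +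
      (N⁻¹ * N + 1) * (A.e + A.l * A.R x.1 x.2.2 ^ 2) * hN'

end ArcSystem

namespace ArcSystem

variable {A : ArcSystem} {n : ℕ} {δ : ℝ}

/-! ### The circular case -/

theorem curve_zero (hA : A.Valid n δ) (η : ℝ) : curve A.R 0 η = Complex.exp (η * Complex.I) := by
  rw [curve, hA.fam.circle, Complex.ofReal_one, one_mul]

theorem deriv_R_zero (hA : A.Valid n δ) (η : ℝ) : deriv (fun θ => A.R θ 0) η = 0 := by
  simp [hA.fam.circle]

theorem dcurve_zero (hA : A.Valid n δ) (η : ℝ) :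
    dcurve A.R 0 η = Complex.I * Complex.exp (η * Complex.I) := by
  rw [dcurve, deriv_R_zero hA, hA.fam.circle]; simp

theorem disc_zero (hA : A.Valid n δ) (η J : ℝ) : A.disc (η, J, 0) = A.e + A.l - J ^ 2 := by
  simp [disc, hA.fam.circle]

theorem startVel_zero (hA : A.Valid n δ) (η J : ℝ) : A.startVel (η, J, 0) =
    Complex.exp (η * Complex.I) *
      (((A.σ * √(A.e + A.l - J ^ 2) : ℝ) : ℂ) + (J : ℂ) * Complex.I) := by
  rw [startVel, disc_zero hA, dcurve_zero hA, deriv_R_zero hA, hA.fam.circle]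
  simp only [ne_eq, OfNat.ofNat_ne_zero, not_false_eq_true, zero_pow, one_pow, zero_add, inv_one,
    Complex.ofReal_one, one_mul]
  linear_combination (-(((A.σ * √(A.e + A.l - J ^ 2) : ℝ) : ℂ)) *
    Complex.exp (η * Complex.I)) * Complex.I_sq

theorem orbit_zero (hA : A.Valid n δ) {η J a : ℝ} (ha : a = A.σ * √(A.e + A.l - J ^ 2)) (t : ℝ) :
    A.orbit (η, J, 0) t = Complex.exp (η * Complex.I) *
      (((A.C t + A.S t * a : ℝ) : ℂ) + ((A.S t * J : ℝ) : ℂ) * Complex.I) := by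
  rw [orbit, startVel_zero hA, curve_zero hA, ← ha, sol]
  push_cast; ring

theorem orbitVel_zero (hA : A.Valid n δ) {η J a : ℝ} (ha : a = A.σ * √(A.e + A.l - J ^ 2))
    (t : ℝ) : A.orbitVel (η, J, 0) t = Complex.exp (η * Complex.I) *
      (((A.l * A.S t + A.C t * a : ℝ) : ℂ) + ((A.C t * J : ℝ) : ℂ) * Complex.I) := by
  rw [orbitVel, startVel_zero hA, curve_zero hA, ← ha, solVel]
  push_cast; ring

theorem gap_zero (hA : A.Valid n δ) {η J a : ℝ} (hJ : J ^ 2 < A.e + A.l)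
    (ha : a = A.σ * √(A.e + A.l - J ^ 2)) (t : ℝ) :
    A.gap (η, J, 0) t = A.σ * (A.S t * (2 * a * A.C t + (A.e + 2 * A.l) * A.S t)) := by
  have ha2 : a ^ 2 = A.e + A.l - J ^ 2 := by
    rw [ha, mul_pow, hA.sigma_sq, one_mul, Real.sq_sqrt (by linarith)]
  rw [gap, orbit_zero hA ha, rad, hA.fam.circle, norm_mul, Complex.norm_exp_ofReal_mul_I, one_mul,
    ← Complex.normSq_eq_norm_sq, Complex.normSq_add_mul_I]
  linear_combination A.σ * hA.flow.C_sq t + A.σ * A.S t ^ 2 * ha2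

theorem gap_zero' (hA : A.Valid n δ) {η J : ℝ} (t : ℝ) :
    A.gap (η, J, 0) t = A.σ * (‖A.orbit (η, J, 0) t‖ ^ 2 - 1) := by
  rw [gap, rad, hA.fam.circle, one_pow]

theorem curve_of_norm_eq_rad (hA : A.Valid n δ) {ε : ℝ} (hε : |ε| < δ) {w : ℂ}
    (hw : ‖w‖ = rad A.R ε w) (θ : ℝ) :
    w = curve A.R ε (θ + Complex.arg (Complex.exp (-(θ * Complex.I)) * w)) := by
  have h0 : 0 < ‖w‖ := by
    rw [hw]; exact lt_trans (by norm_num) (hA.fam.rad_lower hε w)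
  have hn : ‖Complex.exp (-(θ * Complex.I)) * w‖ = ‖w‖ := by
    rw [norm_mul, ← neg_mul, ← Complex.ofReal_neg, Complex.norm_exp_ofReal_mul_I, one_mul]
  have h1 : w = (‖w‖ : ℂ) * Complex.exp
      ((θ + Complex.arg (Complex.exp (-(θ * Complex.I)) * w) : ℝ) * Complex.I) := by
    have h2 := Complex.norm_mul_exp_arg_mul_I (Complex.exp (-(θ * Complex.I)) * w)
    rw [hn] at h2
    rw [Complex.ofReal_add, add_mul, Complex.exp_add, mul_left_comm, h2, ← mul_assoc,
      ← Complex.exp_add, add_neg_cancel, Complex.exp_zero, one_mul]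
  have h3 := rad_polar (hA.fam.periodic ε hε) h0
    (θ + Complex.arg (Complex.exp (-(θ * Complex.I)) * w))
  rw [← h1, ← hw] at h3
  rw [curve, ← h3]
  exact h1

theorem landing_of_isReturnTime (hA : A.Valid n δ) {x : ℝ × ℝ × ℝ} (hx : |x.2.2| < δ)
    (h : A.IsReturnTime x (A.retTime x)) :
    A.orbit x (A.retTime x) = curve A.R x.2.2 (A.arcAngle x) := by
  refine curve_of_norm_eq_rad hA hx ?_ (x.1 + A.c)
  have hσ : A.σ ≠ 0 := fun h0 => by simpa [h0] using hA.sigma_sq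
  have h1 := (mul_eq_zero.1 h.2.1).resolve_left hσ
  have h2 : (0 : ℝ) < rad A.R x.2.2 (A.orbit x (A.retTime x)) :=
    lt_trans (by norm_num) (hA.fam.rad_lower hx _)
  exact (sq_eq_sq₀ (norm_nonneg _) h2.le).1 (sub_eq_zero.1 h1)

theorem shift_arg_mem_slitPlane (hA : A.Valid n δ) {J : ℝ} (hJ : J ^ 2 < A.e + A.l) :
    (⟨A.e - 2 * J ^ 2, 2 * A.σ * J * √(A.e + A.l - J ^ 2)⟩ : ℂ) ∈ Complex.slitPlane := by
  rw [Complex.mem_slitPlane_iff]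
  have hσ : A.σ ≠ 0 := fun h0 => by simpa [h0] using hA.sigma_sq
  by_cases h0 : J = 0
  · left; simp [h0, hA.e_pos]
  · right
    have : √(A.e + A.l - J ^ 2) ≠ 0 := (Real.sqrt_pos.2 (by linarith)).ne'
    simp [h0, hσ, this]

/-- The unperturbed return. -/
theorem exists_return_zero (hA : A.Valid n δ) {J a : ℝ} (hJ : J ^ 2 < A.e + A.l)
    (ha : a = A.σ * √(A.e + A.l - J ^ 2)) :
    ∃ T, 0 < T ∧ 0 < A.S T ∧ 2 * a * A.C T + (A.e + 2 * A.l) * A.S T = 0 ∧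
      A.σ * (A.S T * (2 * a * A.l * A.S T + (A.e + 2 * A.l) * A.C T)) < 0 ∧
      (∀ η, ∀ t ∈ Ioo 0 T, 0 < A.gap (η, J, 0) t) := by
  have hs : 0 < √(A.e + A.l - J ^ 2) := Real.sqrt_pos.2 (by linarith)
  have hσa : 0 < A.σ * a := by
    rw [ha, ← mul_assoc, ← sq, hA.sigma_sq, one_mul]; exact hs
  have ha2 : a ^ 2 = A.e + A.l - J ^ 2 := by
    rw [ha, mul_pow, hA.sigma_sq, one_mul, Real.sq_sqrt (by linarith)]
  have ha0 : a ≠ 0 := fun h => by simp [h] at hσa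
  obtain ⟨T, hT, hB, hS⟩ := hA.ret a hσa (by nlinarith)
  have hST := hS T ⟨hT, le_rfl⟩
  refine ⟨T, hT, hST, hB, ?_, fun η t ht => ?_⟩
  · have h1 : 4 * a ^ 2 * A.l < (A.e + 2 * A.l) ^ 2 := by
      have he := hA.e_pos
      rcases hA.l_ne.lt_or_gt with hl | hl
      · have : 0 < a ^ 2 := by positivity
        nlinarith [sq_nonneg (A.e + 2 * A.l)]
      · nlinarith [sq_nonneg J]
    have h2 : (A.σ * a) * (A.σ * (A.S T * (2 * a * A.l * A.S T + (A.e + 2 * A.l) * A.C T))) =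
        A.S T ^ 2 * (4 * a ^ 2 * A.l - (A.e + 2 * A.l) ^ 2) / 2 := by
      linear_combination (A.S T * a * (2 * a * A.l * A.S T + (A.e + 2 * A.l) * A.C T)) * hA.sigma_sq
        + (A.S T * (A.e + 2 * A.l) / 2) * hB
    by_contra hcon
    push Not at hcon
    have h3 := mul_nonneg hσa.le hcon
    rw [h2] at h3
    have h4 : 0 < A.S T ^ 2 := by positivity
    nlinarith
  · rw [gap_zero hA hJ ha]
    have h1 := hA.flow.S_sub T t
    -- By `hB` and the addition formula, `(2 a C(t) + (e + 2 l) S(t)) S(T) = 2 a S(T - t)`, whose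
    -- sign is known on `(0, T)`.
    have h2 : (A.σ * (A.S t * (2 * a * A.C t + (A.e + 2 * A.l) * A.S t))) * A.S T =
        2 * (A.σ * a) * A.S t * A.S (T - t) := by
      linear_combination (A.σ * A.S t ^ 2) * hB - (2 * (A.σ * a) * A.S t) * h1
    have h3 := hS t ⟨ht.1, ht.2.le⟩
    have h4 := hS (T - t) ⟨by linarith [ht.2], by linarith [ht.1]⟩
    have h5 : 0 < 2 * (A.σ * a) * A.S t * A.S (T - t) := by positivity
    rw [← h2] at h5
    exact (mul_pos_iff_of_pos_right hST).1 h5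

theorem exp_neg_c (hA : A.Valid n δ) : Complex.exp (-(A.c * Complex.I)) = A.σ := by
  rw [Complex.exp_neg, hA.exp_c]
  rcases hA.sigma with h | h <;> rw [h] <;> norm_num

/-- The equation `hB` fixes the ratio of `C T` to `S T`, hence the direction of arrival, without any
formula for `T`. -/
theorem landing_direction (hA : A.Valid n δ) {η J a T : ℝ} (hJ : J ^ 2 < A.e + A.l)
    (ha : a = A.σ * √(A.e + A.l - J ^ 2)) (hST : 0 < A.S T)
    (hB : 2 * a * A.C T + (A.e + 2 * A.l) * A.S T = 0) :
    ∃ r : ℝ, 0 < r ∧ Complex.exp (-((η + A.c : ℝ) * Complex.I)) * A.orbit (η, J, 0) T =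
      r * (⟨A.e - 2 * J ^ 2, 2 * A.σ * J * √(A.e + A.l - J ^ 2)⟩ : ℂ) := by
  have hs : 0 < √(A.e + A.l - J ^ 2) := Real.sqrt_pos.2 (by linarith)
  have hσa : A.σ * a = √(A.e + A.l - J ^ 2) := by
    rw [ha, ← mul_assoc, ← sq, hA.sigma_sq, one_mul]
  have ha2 : a ^ 2 = A.e + A.l - J ^ 2 := by
    rw [ha, mul_pow, hA.sigma_sq, one_mul, Real.sq_sqrt (by linarith)]
  obtain ⟨r, hr, hrS⟩ : ∃ r : ℝ, 0 < r ∧ A.S T = r * (2 * (A.σ * a)) :=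
    ⟨A.S T / (2 * (A.σ * a)), by rw [hσa]; positivity, by rw [hσa]; field_simp⟩
  have hC : A.C T = -(A.e + 2 * A.l) * r * A.σ := by
    have ha0 : a ≠ 0 := fun h => by rw [h, mul_zero] at hσa; exact hs.ne hσa
    refine mul_left_cancel₀ ha0 ?_
    rw [hrS] at hB
    linear_combination hB / 2
  refine ⟨r, hr, ?_⟩
  rw [orbit_zero hA ha, Complex.ofReal_add, add_mul, neg_add, Complex.exp_add, exp_neg_c hA]
  have h1 : Complex.exp (-(η * Complex.I)) * Complex.exp (η * Complex.I) = 1 := by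
    rw [← Complex.exp_add, neg_add_cancel, Complex.exp_zero]
  have h2 : ∀ z : ℂ, Complex.exp (-(η * Complex.I)) * A.σ * (Complex.exp (η * Complex.I) * z) =
      A.σ * z := fun z => by linear_combination (A.σ * z) * h1
  rw [h2]
  rw [← hσa]
  apply Complex.ext
  · simp
    linear_combination A.σ * hC + A.σ * a * hrS + (2 * r * a ^ 2 - (A.e + 2 * A.l) * r) * hA.sigma_sq
      + 2 * r * ha2
  · simp
    linear_combination A.σ * J * hrS

/-- On the circle `dcurve` is `i w`, so the tangential momentum is the angular momentum, which the
linear flow conserves. The angle comes from `landing_direction`. -/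
theorem arcMap_zero (hA : A.Valid n δ) {J : ℝ} (hJ : J ^ 2 < A.e + A.l) (η : ℝ) :
    A.arcMap (η, J, 0) = (η + A.c + A.shift J, J) := by
  obtain ⟨T, hT, hST, hB, -, hpos⟩ := exists_return_zero hA hJ rfl
  have h0 : A.gap (η, J, 0) T = 0 := by rw [gap_zero hA hJ rfl, hB]; ring
  have hret : A.IsReturnTime (η, J, 0) T := ⟨hT, h0, hpos η⟩
  have hrt := hret.retTime_eq
  have hland := landing_of_isReturnTime hA (x := (η, J, 0)) (by simpa using hA.fam.pos)
    (by rw [hrt]; exact hret)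
  refine Prod.ext ?_ ?_
  · simp only [arcMap, arcAngle, hrt]
    obtain ⟨r, hr, h1⟩ := landing_direction hA (η := η) hJ rfl hST hB
    rw [h1, Complex.arg_real_mul _ hr, shift]
  · simp only [arcMap, arcMom]
    rw [dcurve_zero hA, ← curve_zero hA, ← hland, hrt, orbit_zero hA rfl, orbitVel_zero hA rfl]
    have h1 : ‖Complex.exp (η * Complex.I)‖ ^ 2 = 1 := by
      rw [Complex.norm_exp_ofReal_mul_I, one_pow]
    rw [← Complex.normSq_eq_norm_sq, Complex.normSq_apply] at h1
    generalize Complex.exp (η * Complex.I) = z at h1 ⊢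
    simp only [inner_eq_re_im, Complex.mul_re, Complex.mul_im, Complex.add_re, Complex.add_im,
      Complex.ofReal_re, Complex.ofReal_im, Complex.I_re, Complex.I_im]
    have h2 := hA.flow.C_sq T
    linear_combination (A.C T ^ 2 - A.l * A.S T ^ 2) * J * h1 + J * h2

end ArcSystem

namespace ArcSystem

variable {A : ArcSystem} {n : ℕ} {δ : ℝ}

/-! ### The perturbed arcs -/

theorem fderiv_gap_apply {x : ℝ × ℝ × ℝ} {t d : ℝ}
    (h : DifferentiableAt ℝ (fun p : (ℝ × ℝ × ℝ) × ℝ => A.gap p.1 p.2) (x, t))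
    (hd : HasDerivAt (A.gap x) d t) :
    fderiv ℝ (fun p : (ℝ × ℝ × ℝ) × ℝ => A.gap p.1 p.2) (x, t) (0, 1) = d := by
  have h3 : HasDerivAt (fun s : ℝ => (x, s)) ((0 : ℝ × ℝ × ℝ), (1 : ℝ)) t :=
    (hasDerivAt_const t x).prodMk (hasDerivAt_id t)
  exact (HasFDerivAt.comp_hasDerivAt t (f := fun s : ℝ => (x, s)) h.hasFDerivAt h3).unique hd

theorem hasDerivAt_gap_zero (hA : A.Valid n δ) {η J a : ℝ} (hJ : J ^ 2 < A.e + A.l)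
    (ha : a = A.σ * √(A.e + A.l - J ^ 2)) (t : ℝ) :
    HasDerivAt (A.gap (η, J, 0))
      (A.σ * (A.C t * (2 * a * A.C t + (A.e + 2 * A.l) * A.S t) +
        A.S t * (2 * a * A.l * A.S t + (A.e + 2 * A.l) * A.C t))) t := by
  have h1 : HasDerivAt (fun t => A.σ * (A.S t * (2 * a * A.C t + (A.e + 2 * A.l) * A.S t))) _ t :=
    ((hA.flow.hasDerivAt_S t).mul (((hA.flow.hasDerivAt_C t).const_mul (2 * a)).add
      ((hA.flow.hasDerivAt_S t).const_mul (A.e + 2 * A.l)))).const_mul A.σ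
  rw [show A.gap (η, J, 0) = _ from funext (gap_zero hA hJ ha)]
  convert! h1 using 1
  simp only [Pi.add_apply]
  ring

theorem orbit_at_zero (hA : A.Valid n δ) (x : ℝ × ℝ × ℝ) :
    A.orbit x 0 = curve A.R x.2.2 x.1 := by
  simp [orbit, sol, hA.flow.C_zero, hA.flow.S_zero]

theorem eventually_small {x : ℝ × ℝ × ℝ} (hx : |x.2.2| < δ) : ∀ᶠ y : ℝ × ℝ × ℝ in 𝓝 x, |y.2.2| < δ :=
  (by fun_prop : ContinuousAt (fun y : ℝ × ℝ × ℝ => |y.2.2|) x).eventually_lt continuousAt_const hx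

/-- Continuity suffices except at the origin, which only an inner orbit can meet with a positive
gap. There `|w| < 1 / 2 < rad` holds on a whole neighbourhood. -/
theorem eventually_gap_pos (hA : A.Valid n δ) {x : ℝ × ℝ × ℝ} (hx : |x.2.2| < δ)
    (hd : 0 < A.disc x) {t : ℝ} (hg : 0 < A.gap x t) :
    ∀ᶠ p : (ℝ × ℝ × ℝ) × ℝ in 𝓝 (x, t), 0 < A.gap p.1 p.2 := by
  by_cases h0 : A.orbit x t = 0
  · have hσ : A.σ = -1 := by
      rcases hA.sigma with h | h
      · rw [gap, h, h0, norm_zero] at hg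
        nlinarith [sq_nonneg (rad A.R x.2.2 0)]
      · exact h
    have h1 := (contDiffAt_orbit hA hx hd t).1.continuousAt.norm
    have h2 : ∀ᶠ p : (ℝ × ℝ × ℝ) × ℝ in 𝓝 (x, t), ‖A.orbit p.1 p.2‖ < 1 / 2 :=
      h1.eventually_lt continuousAt_const (by simp [h0])
    have h3 : ∀ᶠ p : (ℝ × ℝ × ℝ) × ℝ in 𝓝 (x, t), |p.1.2.2| < δ :=
      (by fun_prop : ContinuousAt (fun p : (ℝ × ℝ × ℝ) × ℝ => |p.1.2.2|) (x, t)).eventually_lt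
        continuousAt_const hx
    filter_upwards [h2, h3] with p hp hp'
    have h4 := hA.fam.rad_lower hp' (A.orbit p.1 p.2)
    rw [gap, hσ]
    nlinarith [norm_nonneg (A.orbit p.1 p.2)]
  · exact continuousAt_const.eventually_lt (contDiffAt_gap hA hx hd h0).continuousAt hg

/-- The circular return is transversal at both ends, so `exists_first_return` applies to the gap.
Uniqueness of return times then identifies the chosen `retTime` with the smooth implicit function.
-/
theorem eventually_good (hA : A.Valid n δ) (hn : 1 ≤ n) {J : ℝ} (hJ : J ^ 2 < A.e + A.l) (η : ℝ) :
    ∀ᶠ x in 𝓝 ((η, J, 0) : ℝ × ℝ × ℝ), A.Good n δ x := by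
  set x₀ : ℝ × ℝ × ℝ := (η, J, 0) with hx₀
  have hn' : (1 : WithTop ℕ∞) ≤ n := by exact_mod_cast hn
  have hn0 : (n : WithTop ℕ∞) ≠ 0 := fun h => by simp [h] at hn'
  have hnt : (n : WithTop ℕ∞) ≠ ((⊤ : ℕ∞) : WithTop ℕ∞) := by simp
  have hx0 : |x₀.2.2| < δ := by simpa [hx₀] using hA.fam.pos
  have hd0 : 0 < A.disc x₀ := by rw [hx₀, disc_zero hA]; linarith
  have hs : 0 < √(A.e + A.l - J ^ 2) := Real.sqrt_pos.2 (by linarith)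
  obtain ⟨T, hT, hST, hB, hdT, hpos⟩ := exists_return_zero hA hJ rfl
  set a := A.σ * √(A.e + A.l - J ^ 2) with ha
  have hσa : 0 < A.σ * a := by rw [ha, ← mul_assoc, ← sq, hA.sigma_sq, one_mul]; exact hs
  have hgT : A.gap x₀ T = 0 := by rw [hx₀, gap_zero hA hJ ha, hB]; ring
  have hret : A.IsReturnTime x₀ T := ⟨hT, hgT, hpos η⟩
  have hrt := hret.retTime_eq
  have hland := landing_of_isReturnTime hA hx0 (by rw [hrt]; exact hret)
  rw [hrt] at hland
  have hwT : A.orbit x₀ T ≠ 0 := by rw [hland]; exact hA.fam.curve_ne_zero hx0 _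
  have hw0 : A.orbit x₀ 0 ≠ 0 := by rw [orbit_at_zero hA]; exact hA.fam.curve_ne_zero hx0 _
  have hc0 := contDiffAt_gap hA hx0 hd0 hw0
  have hcT := contDiffAt_gap hA hx0 hd0 hwT
  have hzero : ∀ᶠ x in 𝓝 x₀, A.gap x 0 = 0 := by
    filter_upwards [eventually_small hx0] with x hx
    rw [gap, orbit_at_zero hA, hA.fam.norm_curve hx, hA.fam.rad_curve hx]; ring
  have hD0 := hasDerivAt_gap_zero hA (η := η) hJ ha 0
  have hDT := hasDerivAt_gap_zero hA (η := η) hJ ha T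
  obtain ⟨τ, hτc, hτ0, hτ⟩ := exists_first_return hn' hT hc0 hcT hzero
    (by
      rw [fderiv_gap_apply (hc0.differentiableAt hn0) hD0, hA.flow.C_zero, hA.flow.S_zero]
      linarith) hgT
    (by
      rw [fderiv_gap_apply (hcT.differentiableAt hn0) hDT, hB]
      linarith)
    (fun t ht => eventually_gap_pos hA hx0 hd0 (hpos η t ht))
  have hretτ : ∀ᶠ x in 𝓝 x₀, A.IsReturnTime x (τ x) := hτ
  have hrc : ContDiffAt ℝ n A.retTime x₀ :=
    hτc.congr_of_eventuallyEq (hretτ.mono fun x hx => hx.retTime_eq)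
  have hoc : ContDiffAt ℝ n (fun x => A.orbit x (A.retTime x)) x₀ := by
    refine ContDiffAt.comp x₀ (g := fun p : (ℝ × ℝ × ℝ) × ℝ => A.orbit p.1 p.2)
      (f := fun x => (x, A.retTime x)) ?_ (contDiffAt_id.prodMk hrc)
    exact (contDiffAt_orbit hA hx0 hd0 _).1
  have hvc : ContDiffAt ℝ n (fun x => A.orbitVel x (A.retTime x)) x₀ := by
    refine ContDiffAt.comp x₀ (g := fun p : (ℝ × ℝ × ℝ) × ℝ => A.orbitVel p.1 p.2)
      (f := fun x => (x, A.retTime x)) ?_ (contDiffAt_id.prodMk hrc)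
    exact (contDiffAt_orbit hA hx0 hd0 _).2
  have hac : ContDiffAt ℝ n A.arcAngle x₀ := by
    have h1 : ContDiffAt ℝ n (fun x : ℝ × ℝ × ℝ => x.1 + A.c) x₀ := by fun_prop
    have h2 : ContDiffAt ℝ n (fun x : ℝ × ℝ × ℝ =>
        Complex.exp (-((x.1 + A.c : ℝ) * Complex.I)) * A.orbit x (A.retTime x)) x₀ := by
      refine ContDiffAt.mul ?_ hoc
      exact (((Complex.ofRealCLM.contDiff.contDiffAt.comp x₀ h1).mul contDiffAt_const).neg).cexp
    refine h1.add (ContDiffAt.comp x₀ (contDiffAt_arg ?_) h2)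
    obtain ⟨r, hr, h3⟩ := landing_direction hA (η := η) hJ ha hST hB
    rw [hrt, hx₀, h3]
    have := shift_arg_mem_slitPlane hA hJ
    rw [Complex.mem_slitPlane_iff] at this ⊢
    rw [Complex.re_ofReal_mul, Complex.im_ofReal_mul]
    exact this.imp (fun h => mul_pos hr h) (fun h => mul_ne_zero hr.ne' h)
  have hdc : ContDiffAt ℝ n (fun x => dcurve A.R x.2.2 (A.arcAngle x)) x₀ :=
    ContDiffAt.comp x₀ (g := fun y : ℝ × ℝ => dcurve A.R y.2 y.1)
      (f := fun x => (A.arcAngle x, x.2.2)) (hA.fam.contDiffAt_dcurve hx0 _)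
      (hac.prodMk (by fun_prop))
  have hmc : ContDiffAt ℝ n A.arcMap x₀ := hac.prodMk (hdc.inner ℝ hvc)
  -- On the circle the outward normal at the arrival is the position itself, so the normal velocity
  -- is, up to a factor, the time derivative of the gap.
  have htr : A.σ * inner ℝ (-Complex.I * dcurve A.R x₀.2.2 (A.arcAngle x₀))
      (A.orbitVel x₀ (A.retTime x₀)) < 0 := by
    have h1 : -Complex.I * dcurve A.R x₀.2.2 (A.arcAngle x₀) = A.orbit x₀ T := by
      rw [hland]
      simp only [hx₀]
      rw [dcurve_zero hA, curve_zero hA, ← mul_assoc, neg_mul, Complex.I_mul_I, neg_neg, one_mul]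
    have h2 : HasDerivAt (A.gap x₀) (A.σ * (2 * inner ℝ (A.orbit x₀ T) (A.orbitVel x₀ T))) T := by
      rw [hx₀, show A.gap (η, J, 0) = _ from funext (gap_zero' hA)]
      exact ((hA.flow.hasDerivAt_sol _ _ T).norm_sq.sub_const 1).const_mul A.σ
    have h3 := h2.unique hDT
    rw [h1, hrt]
    rw [hB] at h3
    linarith
  have htr' : ∀ᶠ x in 𝓝 x₀, A.σ * inner ℝ (-Complex.I * dcurve A.R x.2.2 (A.arcAngle x))
      (A.orbitVel x (A.retTime x)) < 0 :=
    (continuousAt_const.mul ((continuousAt_const.mul hdc.continuousAt).inner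
      hvc.continuousAt)).eventually_lt continuousAt_const htr
  filter_upwards [eventually_small hx0, continuousAt_const.eventually_lt
    (contDiffAt_disc hA hx0).continuousAt hd0, hretτ, htr', hrc.eventually hnt,
    hmc.eventually hnt] with x h1 h2 h3 h4 h5 h6
  have h3' : A.IsReturnTime x (A.retTime x) := by rw [h3.retTime_eq]; exact h3
  exact ⟨h1, h2, h3', landing_of_isReturnTime hA h1 h3', h4, h5, h6⟩

/-! ### Periodicity -/

theorem arcMap_add_two_pi (hA : A.Valid n δ) {η J ε : ℝ} (hε : |ε| < δ) :
    A.arcMap (η + 2 * Real.pi, J, ε) = A.arcMap (η, J, ε) + (2 * Real.pi, 0) := by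
  have hc : curve A.R ε (η + 2 * Real.pi) = curve A.R ε η := hA.fam.curve_periodic hε η
  have hd : dcurve A.R ε (η + 2 * Real.pi) = dcurve A.R ε η := hA.fam.dcurve_periodic hε η
  have hR : A.R (η + 2 * Real.pi) ε = A.R η ε := hA.fam.periodic ε hε η
  have hR' : deriv (fun θ => A.R θ ε) (η + 2 * Real.pi) = deriv (fun θ => A.R θ ε) η := by
    rw [← deriv_comp_add_const]
    congr 1
    funext x
    exact hA.fam.periodic ε hε x
  have hv : A.startVel (η + 2 * Real.pi, J, ε) = A.startVel (η, J, ε) := by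
    simp only [startVel, disc, hd, hR, hR']
  have ho : A.orbit (η + 2 * Real.pi, J, ε) = A.orbit (η, J, ε) := by
    funext t; simp only [orbit, hc, hv]
  have hov : A.orbitVel (η + 2 * Real.pi, J, ε) = A.orbitVel (η, J, ε) := by
    funext t; simp only [orbitVel, hc, hv]
  have hg : A.gap (η + 2 * Real.pi, J, ε) = A.gap (η, J, ε) := by
    funext t; simp only [gap, ho]
  have hr : A.retTime (η + 2 * Real.pi, J, ε) = A.retTime (η, J, ε) := by
    have h1 : A.IsReturnTime (η + 2 * Real.pi, J, ε) = A.IsReturnTime (η, J, ε) := by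
      funext T; simp only [IsReturnTime, hg]
    by_cases h2 : ∃ T, A.IsReturnTime (η, J, ε) T
    · obtain ⟨T, hT⟩ := h2
      rw [hT.retTime_eq]
      exact IsReturnTime.retTime_eq (h1 ▸ hT)
    · rw [retTime, retTime, dif_neg h2, dif_neg (by rwa [h1])]
  have ha : A.arcAngle (η + 2 * Real.pi, J, ε) = A.arcAngle (η, J, ε) + 2 * Real.pi := by
    have h1 : Complex.exp (-((η + 2 * Real.pi + A.c : ℝ) * Complex.I)) =
        Complex.exp (-((η + A.c : ℝ) * Complex.I)) := by
      rw [Complex.exp_neg, Complex.exp_neg]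
      congr 1
      push_cast
      rw [show ((η : ℂ) + 2 * Real.pi + A.c) * Complex.I =
        (η + A.c) * Complex.I + 2 * Real.pi * Complex.I by ring, Complex.exp_add,
        Complex.exp_two_pi_mul_I, mul_one]
    simp only [arcAngle, hr, ho, h1]
    ring
  have hm : A.arcMom (η + 2 * Real.pi, J, ε) = A.arcMom (η, J, ε) := by
    have h1 := hA.fam.dcurve_periodic hε (A.arcAngle (η, J, ε))
    simp only [arcMom, ha, hr, hov, h1]
  simp only [arcMap, ha, hm, Prod.mk_add_mk, add_zero]

end ArcSystem

/-! ### The transition map is symplectic -/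

theorem det_eq_prod (L : ℝ × ℝ →L[ℝ] ℝ × ℝ) :
    L.det = (L (1, 0)).1 * (L (0, 1)).2 - (L (0, 1)).1 * (L (1, 0)).2 := by
  rw [ContinuousLinearMap.det, ← LinearMap.det_toMatrix (Module.Basis.finTwoProd ℝ),
    Matrix.det_fin_two]
  simp [LinearMap.toMatrix_apply]

/-- Here `(p, v)` is the starting state, `pᵢ, vᵢ, Tᵢ` are two variations of it and of the return
time, `θᵢ, Jᵢ` those of the arrival parameter and momentum, `d` and `k` the first two derivatives of
the curve at the arrival. The flow preserves the symplectic form; the `Tᵢ` terms pair a variation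
with the flow direction and vanish by the energy relations `he₁`, `he₂`; the `k` terms cancel by
antisymmetry. -/
theorem symplectic_identity {l c s : ℝ} (hcs : c ^ 2 - l * s ^ 2 = 1) {p v d k : ℂ}
    {p₁ v₁ p₂ v₂ : ℂ} {T₁ T₂ θ₁ θ₂ J₁ J₂ : ℝ}
    (h₁ : (c : ℂ) * p₁ + (s : ℂ) * v₁ + T₁ * ((l : ℂ) * s * p + c * v) = θ₁ * d)
    (h₂ : (c : ℂ) * p₂ + (s : ℂ) * v₂ + T₂ * ((l : ℂ) * s * p + c * v) = θ₂ * d)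
    (hJ₁ : J₁ = inner ℝ d ((l : ℂ) * s * p₁ + c * v₁ + T₁ * ((l : ℂ) * (c * p + s * v))) +
      inner ℝ (θ₁ * k) ((l : ℂ) * s * p + c * v))
    (hJ₂ : J₂ = inner ℝ d ((l : ℂ) * s * p₂ + c * v₂ + T₂ * ((l : ℂ) * (c * p + s * v))) +
      inner ℝ (θ₂ * k) ((l : ℂ) * s * p + c * v))
    (he₁ : inner ℝ v v₁ = l * inner ℝ p p₁) (he₂ : inner ℝ v v₂ = l * inner ℝ p p₂) :
    θ₁ * J₂ - θ₂ * J₁ = inner ℝ p₁ v₂ - inner ℝ p₂ v₁ := by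
  have h1r := congrArg Complex.re h₁
  have h1i := congrArg Complex.im h₁
  have h2r := congrArg Complex.re h₂
  have h2i := congrArg Complex.im h₂
  simp only [inner_eq_re_im, Complex.add_re, Complex.add_im, Complex.mul_re, Complex.mul_im,
    Complex.ofReal_re, Complex.ofReal_im, zero_mul, sub_zero, add_zero, mul_zero]
    at h1r h1i h2r h2i hJ₁ hJ₂ he₁ he₂ ⊢
  linear_combination θ₁ * hJ₂ - θ₂ * hJ₁
    - (l * s * p₂.re + c * v₂.re + T₂ * (l * (c * p.re + s * v.re))) * h1r
    - (l * s * p₂.im + c * v₂.im + T₂ * (l * (c * p.im + s * v.im))) * h1i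
    + (l * s * p₁.re + c * v₁.re + T₁ * (l * (c * p.re + s * v.re))) * h2r
    + (l * s * p₁.im + c * v₁.im + T₁ * (l * (c * p.im + s * v.im))) * h2i
    + (p₁.re * v₂.re + p₁.im * v₂.im - p₂.re * v₁.re - p₂.im * v₁.im
      - T₂ * (v.re * v₁.re + v.im * v₁.im - l * (p.re * p₁.re + p.im * p₁.im))
      + T₁ * (v.re * v₂.re + v.im * v₂.im - l * (p.re * p₂.re + p.im * p₂.im))) * hcs
    - T₂ * he₁ + T₁ * he₂

namespace ArcSystem

variable {A : ArcSystem} {n : ℕ} {δ : ℝ}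

/-- The first variation of an arc in a direction with constant `ε`. -/
theorem exists_variation (hA : A.Valid n δ) (hn : 1 ≤ n) {x : ℝ × ℝ × ℝ}
    (h : ∀ᶠ y in 𝓝 x, A.Good n δ y) (u₁ u₂ : ℝ) :
    ∃ (v' : ℂ) (T' : ℝ),
      ((A.C (A.retTime x) : ℂ) * (u₁ * dcurve A.R x.2.2 x.1) + (A.S (A.retTime x) : ℂ) * v' +
        T' * ((A.l : ℂ) * (A.S (A.retTime x)) * curve A.R x.2.2 x.1 +
          (A.C (A.retTime x)) * A.startVel x) =
        (fderiv ℝ A.arcMap x (u₁, u₂, 0)).1 * dcurve A.R x.2.2 (A.arcAngle x)) ∧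
      ((fderiv ℝ A.arcMap x (u₁, u₂, 0)).2 = inner ℝ (dcurve A.R x.2.2 (A.arcAngle x))
        ((A.l : ℂ) * (A.S (A.retTime x)) * (u₁ * dcurve A.R x.2.2 x.1) +
          (A.C (A.retTime x)) * v' +
          T' * ((A.l : ℂ) * ((A.C (A.retTime x)) * curve A.R x.2.2 x.1 +
            (A.S (A.retTime x)) * A.startVel x))) +
        inner ℝ ((fderiv ℝ A.arcMap x (u₁, u₂, 0)).1 *
          deriv (dcurve A.R x.2.2) (A.arcAngle x))
          ((A.l : ℂ) * (A.S (A.retTime x)) * curve A.R x.2.2 x.1 +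
            (A.C (A.retTime x)) * A.startVel x)) ∧
      inner ℝ (A.startVel x) v' =
        A.l * inner ℝ (curve A.R x.2.2 x.1) (u₁ * dcurve A.R x.2.2 x.1) ∧
      inner ℝ (dcurve A.R x.2.2 x.1) v' +
        u₁ * inner ℝ (deriv (dcurve A.R x.2.2) x.1) (A.startVel x) = u₂ := by
  have hx := h.self_of_nhds
  have hn0 : (n : WithTop ℕ∞) ≠ 0 := by exact_mod_cast (by omega : n ≠ 0)
  obtain ⟨η, J, ε⟩ := x
  have hε : |ε| < δ := hx.small
  set y : ℝ → ℝ × ℝ × ℝ := fun s => (η + s * u₁, J + s * u₂, ε) with hy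
  have hy0 : y 0 = (η, J, ε) := by simp [hy]
  have hyd : HasDerivAt y (u₁, u₂, 0) 0 := by
    refine HasDerivAt.prodMk ?_ (HasDerivAt.prodMk ?_ (hasDerivAt_const _ _))
    · simpa using ((hasDerivAt_id (0 : ℝ)).mul_const u₁).const_add η
    · simpa using ((hasDerivAt_id (0 : ℝ)).mul_const u₂).const_add J
  have hgood : ∀ᶠ s in 𝓝 (0 : ℝ), A.Good n δ (y s) := by
    have := hyd.continuousAt.tendsto
    rw [hy0] at this
    exact this.eventually h
  have hcomp : ∀ {F : Type} [NormedAddCommGroup F] [NormedSpace ℝ F] {g : ℝ × ℝ × ℝ → F},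
      DifferentiableAt ℝ g (η, J, ε) →
      HasDerivAt (fun s => g (y s)) (fderiv ℝ g (η, J, ε) (u₁, u₂, 0)) 0 := fun {F} _ _ {g} hg => by
    have h1 : HasFDerivAt g (fderiv ℝ g (η, J, ε)) (y 0) := by rw [hy0]; exact hg.hasFDerivAt
    exact h1.comp_hasDerivAt 0 hyd
  have hv := hcomp ((contDiffAt_startVel hA hε hx.disc_pos).differentiableAt hn0)
  have hT := hcomp (hx.contDiffAt_retTime.differentiableAt hn0)
  have hm := hcomp (hx.contDiffAt_arcMap.differentiableAt hn0)
  have hdd : ∀ θ, HasDerivAt (dcurve A.R ε) (deriv (dcurve A.R ε) θ) θ := fun θ => by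
    have h1 := (hA.fam.contDiffAt_dcurve hε θ).differentiableAt hn0
    exact (h1.comp (f := fun x : ℝ => (x, ε)) θ
      (differentiableAt_id.prodMk (differentiableAt_const ε))).hasDerivAt
  have hη : HasDerivAt (fun s => (y s).1) u₁ 0 := by
    simpa [hy] using ((hasDerivAt_id (0 : ℝ)).mul_const u₁).const_add η
  have hJ : HasDerivAt (fun s => (y s).2.1) u₂ 0 := by
    simpa [hy] using ((hasDerivAt_id (0 : ℝ)).mul_const u₂).const_add J
  have hp : HasDerivAt (fun s => curve A.R ε (y s).1) (u₁ * dcurve A.R ε η) 0 := by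
    have h1 : HasDerivAt (curve A.R ε) (dcurve A.R ε η) (y 0).1 := by
      rw [hy0]; exact hA.fam.hasDerivAt_curve hε η
    have h2 := h1.scomp 0 hη
    rwa [Complex.real_smul] at h2
  have hd : HasDerivAt (fun s => dcurve A.R ε (y s).1) (u₁ * deriv (dcurve A.R ε) η) 0 := by
    have h1 : HasDerivAt (dcurve A.R ε) (deriv (dcurve A.R ε) η) (y 0).1 := by
      rw [hy0]; exact hdd η
    have h2 := h1.scomp 0 hη
    rwa [Complex.real_smul] at h2
  have hθ : HasDerivAt (fun s => A.arcAngle (y s))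
      (fderiv ℝ A.arcMap (η, J, ε) (u₁, u₂, 0)).1 0 :=
    HasFDerivAt.comp_hasDerivAt 0 (f := fun s => A.arcMap (y s))
      (ContinuousLinearMap.fst ℝ ℝ ℝ).hasFDerivAt hm
  have hM : HasDerivAt (fun s => A.arcMom (y s))
      (fderiv ℝ A.arcMap (η, J, ε) (u₁, u₂, 0)).2 0 :=
    HasFDerivAt.comp_hasDerivAt 0 (f := fun s => A.arcMap (y s))
      (ContinuousLinearMap.snd ℝ ℝ ℝ).hasFDerivAt hm
  have hq : HasDerivAt (fun s => curve A.R ε (A.arcAngle (y s)))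
      ((fderiv ℝ A.arcMap (η, J, ε) (u₁, u₂, 0)).1 * dcurve A.R ε (A.arcAngle (η, J, ε))) 0 := by
    have h1 : HasDerivAt (curve A.R ε) (dcurve A.R ε (A.arcAngle (η, J, ε)))
        (A.arcAngle (y 0)) := by
      rw [hy0]; exact hA.fam.hasDerivAt_curve hε _
    have h2 := h1.scomp 0 hθ
    rwa [Complex.real_smul] at h2
  have hdq : HasDerivAt (fun s => dcurve A.R ε (A.arcAngle (y s)))
      ((fderiv ℝ A.arcMap (η, J, ε) (u₁, u₂, 0)).1 *
        deriv (dcurve A.R ε) (A.arcAngle (η, J, ε))) 0 := by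
    have h1 : HasDerivAt (dcurve A.R ε) (deriv (dcurve A.R ε) (A.arcAngle (η, J, ε)))
        (A.arcAngle (y 0)) := by
      rw [hy0]; exact hdd _
    have h2 := h1.scomp 0 hθ
    rwa [Complex.real_smul] at h2
  have hCT : HasDerivAt (fun s => ((A.C (A.retTime (y s)) : ℝ) : ℂ)) _ 0 :=
    ((hA.flow.hasDerivAt_C _).comp 0 hT).ofReal_comp
  have hST : HasDerivAt (fun s => ((A.S (A.retTime (y s)) : ℝ) : ℂ)) _ 0 :=
    ((hA.flow.hasDerivAt_S _).comp 0 hT).ofReal_comp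
  have ho : HasDerivAt (fun s => A.orbit (y s) (A.retTime (y s))) _ 0 := (hCT.mul hp).add (hST.mul hv)
  have hw : HasDerivAt (fun s => A.orbitVel (y s) (A.retTime (y s))) _ 0 :=
    ((hST.const_mul (A.l : ℂ)).mul hp).add (hCT.mul hv)
  -- The four identities are the derivatives along `y` of the landing equation, the definition of
  -- `arcMom`, the energy of the initial velocity, and its prescribed tangential momentum.
  refine ⟨fderiv ℝ A.startVel (η, J, ε) (u₁, u₂, 0), fderiv ℝ A.retTime (η, J, ε) (u₁, u₂, 0),
    ?_, ?_, ?_, ?_⟩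
  · have h1 := ho.congr_of_eventuallyEq (f₁ := fun s => curve A.R ε (A.arcAngle (y s)))
      (hgood.mono fun s hs => hs.landing.symm)
    rw [← h1.unique hq]
    simp only [hy0]
    push_cast
    ring
  · have h1 : HasDerivAt (fun s => A.arcMom (y s)) _ 0 := hdq.inner ℝ hw
    rw [hM.unique h1]
    simp only [hy0]
    congr 2
    push_cast
    ring
  · have h1 : HasDerivAt (fun s => ‖A.startVel (y s)‖ ^ 2) _ 0 := hv.norm_sq
    have h2 : HasDerivAt (fun s => A.e + A.l * ‖curve A.R ε (y s).1‖ ^ 2) _ 0 :=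
      (hp.norm_sq.const_mul A.l).const_add A.e
    have h3 := h2.congr_of_eventuallyEq (f₁ := fun s => ‖A.startVel (y s)‖ ^ 2)
      (hgood.mono fun s hs => (startVel_facts hA hs.small hs.disc_pos).2.2)
    have h4 := h1.unique h3
    simp only [hy0] at h4
    linarith
  · have h1 : HasDerivAt (fun s => inner ℝ (dcurve A.R ε (y s).1) (A.startVel (y s))) _ 0 :=
      hd.inner ℝ hv
    have h3 := hJ.congr_of_eventuallyEq
      (f₁ := fun s => inner ℝ (dcurve A.R ε (y s).1) (A.startVel (y s)))
      (hgood.mono fun s hs => (startVel_facts hA hs.small hs.disc_pos).1)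
    have h4 := h1.unique h3
    simp only [hy0, ← Complex.real_smul, inner_smul_left] at h4
    simpa using h4

/-- For constant `ε` the transition map has Jacobian determinant one. -/
theorem hasFDerivAt_arcMap (hA : A.Valid n δ) (hn : 1 ≤ n) {η J ε : ℝ}
    (h : ∀ᶠ y in 𝓝 ((η, J, ε) : ℝ × ℝ × ℝ), A.Good n δ y) :
    ∃ L : ℝ × ℝ →L[ℝ] ℝ × ℝ,
      HasFDerivAt (fun p : ℝ × ℝ => A.arcMap (p.1, p.2, ε)) L (η, J) ∧ L.det = 1 := by
  have hx := h.self_of_nhds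
  have hn0 : (n : WithTop ℕ∞) ≠ 0 := by exact_mod_cast (by omega : n ≠ 0)
  have hi : HasFDerivAt (fun p : ℝ × ℝ => (p.1, p.2, ε))
      ((ContinuousLinearMap.fst ℝ ℝ ℝ).prod ((ContinuousLinearMap.snd ℝ ℝ ℝ).prod 0)) (η, J) :=
    hasFDerivAt_fst.prodMk (hasFDerivAt_snd.prodMk (hasFDerivAt_const _ _))
  have hm := (hx.contDiffAt_arcMap.differentiableAt hn0).hasFDerivAt
  refine ⟨_, HasFDerivAt.comp (η, J) (f := fun p : ℝ × ℝ => (p.1, p.2, ε)) hm hi, ?_⟩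
  rw [det_eq_prod]
  simp only [ContinuousLinearMap.comp_apply, ContinuousLinearMap.prod_apply,
    ContinuousLinearMap.coe_fst', ContinuousLinearMap.coe_snd', zero_apply]
  -- In the direction `(0, 1)` the starting point is fixed, so the symplectic form at the start
  -- reduces to the scalar product of `dcurve` with `v₂`, which is `1` by `hi2`.
  obtain ⟨v₁, T₁, h1, hJ1, he1, -⟩ := exists_variation hA hn h 1 0
  obtain ⟨v₂, T₂, h2, hJ2, he2, hi2⟩ := exists_variation hA hn h 0 1
  have := symplectic_identity (hA.flow.C_sq _) h1 h2 hJ1 hJ2 he1 he2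
  rw [this]
  simpa using hi2

end ArcSystem

/-! ### The angular shifts -/

theorem arg_eq_arccot {x y : ℝ} (hy : 0 < y) : Complex.arg ⟨x, y⟩ = arccot (x / y) := by
  have hθ : Real.pi / 2 - Real.arctan (x / y) ∈ Ioc (-Real.pi) Real.pi := by
    have h1 := Real.neg_pi_div_two_lt_arctan (x / y)
    have h2 := Real.arctan_lt_pi_div_two (x / y)
    constructor <;> linarith [Real.pi_pos]
  have hs : 0 < √(1 + (x / y) ^ 2) := by positivity
  have := Complex.arg_mul_cos_add_sin_mul_I (mul_pos hy hs) hθ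
  rw [arccot]
  conv_rhs => rw [← this]
  congr 1
  rw [← Complex.ofReal_cos, ← Complex.ofReal_sin, Real.cos_pi_div_two_sub, Real.sin_pi_div_two_sub,
    Real.sin_arctan, Real.cos_arctan]
  apply Complex.ext
  · simp only [Complex.add_re, Complex.ofReal_re, Complex.mul_re,
      Complex.I_re, Complex.ofReal_im, Complex.I_im]
    field_simp
    simp
  · simp only [Complex.add_im, Complex.ofReal_re, Complex.mul_im,
      Complex.I_re, Complex.ofReal_im, Complex.I_im]
    field_simp
    simp

theorem arg_eq_arccot_sub_pi {x y : ℝ} (hy : y < 0) :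
    Complex.arg ⟨x, y⟩ = arccot (x / y) - Real.pi := by
  have h1 := arg_eq_arccot (x := x) (y := -y) (by linarith)
  have h2 : (⟨x, y⟩ : ℂ) = (starRingEnd ℂ) ⟨x, -y⟩ := by apply Complex.ext <;> simp
  have h3 : Complex.arg ⟨x, -y⟩ ≠ Real.pi := by
    rw [h1, arccot]
    have := Real.neg_pi_div_two_lt_arctan (x / -y)
    intro h; linarith
  rw [h2, Complex.arg_conj, if_neg h3, h1, arccot, arccot, div_neg, Real.arctan_neg]
  ring

theorem hasDerivAt_arg {x y : ℝ → ℝ} {x' y' t : ℝ} (hx : HasDerivAt x x' t) (hy : HasDerivAt y y' t)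
    (hs : (⟨x t, y t⟩ : ℂ) ∈ Complex.slitPlane) :
    HasDerivAt (fun t => Complex.arg ⟨x t, y t⟩)
      ((x t * y' - y t * x') / (x t ^ 2 + y t ^ 2)) t := by
  have he : ∀ a b : ℝ, (⟨a, b⟩ : ℂ) = (a : ℂ) + (b : ℂ) * Complex.I := fun a b => by
    apply Complex.ext <;> simp
  have h1 : HasDerivAt (fun t => (⟨x t, y t⟩ : ℂ)) (⟨x', y'⟩ : ℂ) t := by
    simp only [he]
    exact hx.ofReal_comp.add (hy.ofReal_comp.mul_const _)
  have h2 := (Complex.imCLM.hasFDerivAt).comp_hasDerivAt t (h1.clog_real hs)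
  have h3 : HasDerivAt (fun t => Complex.arg ⟨x t, y t⟩) ((⟨x', y'⟩ : ℂ) / ⟨x t, y t⟩).im t := by
    simpa [Function.comp_def, Complex.log_im] using h2
  convert! h3 using 1
  rw [Complex.div_im, Complex.normSq_mk]
  ring

theorem criticalAction_sq {E ω : ℝ} (hEω : ω ^ 2 / 2 < E) :
    criticalAction E ω ^ 2 = E - ω ^ 2 / 2 := Real.sq_sqrt (by linarith)

theorem sq_lt_of_mem {E ω I : ℝ} (hEω : ω ^ 2 / 2 < E)
    (hI : I ∈ Ioo (-criticalAction E ω) (criticalAction E ω)) : I ^ 2 < E - ω ^ 2 / 2 := by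
  rw [← criticalAction_sq hEω]
  exact sq_lt_sq' hI.1 hI.2

/-- The three branches of the shift are those of the argument of a single point that stays off the
negative axis, so the shift is smooth across `I = 0` as well. -/
theorem outerShift_eq_arg {E ω I : ℝ} (hE : 0 < E) (hI : I ^ 2 < E - ω ^ 2 / 2) :
    outerShift E ω I =
      Complex.arg ⟨E - 2 * I ^ 2, I * √(4 * E - 2 * (2 * I ^ 2 + ω ^ 2))⟩ := by
  have hq : 0 < √(4 * E - 2 * (2 * I ^ 2 + ω ^ 2)) := Real.sqrt_pos.2 (by linarith)
  rw [outerShift]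
  split_ifs with h1 h2
  · rw [arg_eq_arccot (mul_pos h1 hq)]
  · subst h2
    have : (⟨E - 2 * 0 ^ 2, 0 * √(4 * E - 2 * (2 * 0 ^ 2 + ω ^ 2))⟩ : ℂ) = (E : ℂ) := by
      apply Complex.ext <;> simp
    rw [this, Complex.arg_ofReal_of_nonneg hE.le]
  · have : I < 0 := lt_of_le_of_ne (not_lt.1 h1) h2
    rw [arg_eq_arccot_sub_pi (mul_neg_of_neg_of_pos this hq)]

/-- The factor `2` is the doubling of angles by `z = w²`; the arccosine is the angle of a point of
norm `√(4(E + h)I² + μ²) / 2`. -/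
theorem innerShift_eq_arg {E h μ I : ℝ} (hμ : 0 < μ) (hI : I ^ 2 < E + h + μ) :
    innerShift E h μ I = 2 * Complex.arg ⟨μ / 2 - I ^ 2, -(I * √(E + h + μ - I ^ 2))⟩ := by
  have hp : 0 < √(E + h + μ - I ^ 2) := Real.sqrt_pos.2 (by linarith)
  set z : ℂ := ⟨μ / 2 - I ^ 2, -(I * √(E + h + μ - I ^ 2))⟩ with hz
  have hn : ‖z‖ = √(4 * (E + h) * I ^ 2 + μ ^ 2) / 2 := by
    rw [Complex.norm_def, Complex.normSq_mk, eq_div_iff two_ne_zero,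
      show (2 : ℝ) = √(2 ^ 2) by rw [Real.sqrt_sq]; norm_num, ← Real.sqrt_mul']
    · congr 1
      have := Real.sq_sqrt (by linarith : 0 ≤ E + h + μ - I ^ 2)
      rw [Real.sqrt_sq (by norm_num)]
      linear_combination (4 * I ^ 2) * this
    · positivity
  have hr : z.re / ‖z‖ = -((2 * I ^ 2 - μ) / √(4 * (E + h) * I ^ 2 + μ ^ 2)) := by
    rw [hn, hz, div_div_eq_mul_div, ← neg_div]
    congr 1
    ring
  rw [innerShift]
  split_ifs with h1 h2
  · rw [Complex.arg_of_im_neg (by simp only [hz]; nlinarith), hr, Real.arccos_neg]; ring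
  · have : z = ((μ / 2 : ℝ) : ℂ) := by rw [hz, h2]; apply Complex.ext <;> simp
    rw [this, Complex.arg_ofReal_of_nonneg (by positivity), mul_zero]
  · have : I < 0 := lt_of_le_of_ne (not_lt.1 h1) h2
    rw [Complex.arg_of_im_nonneg_of_ne_zero (by simp only [hz]; nlinarith)
      (fun h0 => by
        have := congrArg Complex.im h0
        simp only [hz, Complex.zero_im] at this
        nlinarith), hr, Real.arccos_neg]
    ring

theorem hasDerivAt_outerShift {E ω I : ℝ} (hE : 0 < E) (hI : I ^ 2 < E - ω ^ 2 / 2) :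
    HasDerivAt (outerShift E ω)
      ((4 * E ^ 2 - 2 * E * ω ^ 2 - 4 * ω ^ 2 * I ^ 2) /
        (√(4 * E - 2 * (2 * I ^ 2 + ω ^ 2)) * (E ^ 2 - 2 * ω ^ 2 * I ^ 2))) I := by
  have hq2 : 0 < 4 * E - 2 * (2 * I ^ 2 + ω ^ 2) := by linarith
  have hq : 0 < √(4 * E - 2 * (2 * I ^ 2 + ω ^ 2)) := Real.sqrt_pos.2 hq2
  have hqs := Real.sq_sqrt hq2.le
  -- For `ω ≠ 0` the bound on `I²` makes this expression larger than `(E - ω²)²`.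
  have hD : 0 < E ^ 2 - 2 * ω ^ 2 * I ^ 2 := by
    by_cases hω : ω = 0
    · rw [hω]; nlinarith
    · have : 0 < ω ^ 2 := by positivity
      nlinarith [sq_nonneg (E - ω ^ 2)]
  have h0 : HasDerivAt (fun I : ℝ => I ^ 2) (2 * I) I := by simpa using hasDerivAt_pow 2 I
  have h1 : HasDerivAt (fun I : ℝ => E - 2 * I ^ 2) (-(2 * (2 * I))) I :=
    (h0.const_mul 2).const_sub E
  have h2 : HasDerivAt (fun I : ℝ => 4 * E - 2 * (2 * I ^ 2 + ω ^ 2)) (-(2 * (2 * (2 * I)))) I :=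
    (((h0.const_mul 2).add_const (ω ^ 2)).const_mul 2).const_sub (4 * E)
  have h3 := (hasDerivAt_id I).mul (h2.sqrt hq2.ne')
  have hs : (⟨E - 2 * I ^ 2, I * √(4 * E - 2 * (2 * I ^ 2 + ω ^ 2))⟩ : ℂ) ∈ Complex.slitPlane := by
    rw [Complex.mem_slitPlane_iff]
    by_cases hI0 : I = 0
    · left; simp [hI0, hE]
    · right; exact mul_ne_zero hI0 hq.ne'
  have h4 := hasDerivAt_arg h1 h3 hs
  have h5 : ∀ᶠ J in 𝓝 I, outerShift E ω J =
      Complex.arg ⟨E - 2 * J ^ 2, J * √(4 * E - 2 * (2 * J ^ 2 + ω ^ 2))⟩ := by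
    have : ∀ᶠ J : ℝ in 𝓝 I, J ^ 2 < E - ω ^ 2 / 2 :=
      (by fun_prop : ContinuousAt (fun J : ℝ => J ^ 2) I).eventually_lt continuousAt_const hI
    exact this.mono fun J hJ => outerShift_eq_arg hE hJ
  convert! h4.congr_of_eventuallyEq h5 using 1
  simp only [id, Pi.mul_apply]
  have hden : (E - 2 * I ^ 2) ^ 2 + (I * √(4 * E - 2 * (2 * I ^ 2 + ω ^ 2))) ^ 2 =
      E ^ 2 - 2 * ω ^ 2 * I ^ 2 := by rw [mul_pow, hqs]; ring
  rw [hden]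
  set q := √(4 * E - 2 * (2 * I ^ 2 + ω ^ 2))
  rw [div_eq_div_iff (by positivity) hD.ne']
  field_simp
  linear_combination (-(E + 2 * I ^ 2)) * hqs

theorem hasDerivAt_innerShift {E h μ I : ℝ} (hEh : 0 < E + h) (hμ : 0 < μ)
    (hI : I ^ 2 < E + h + μ) :
    HasDerivAt (innerShift E h μ)
      (-(μ * (E + h + μ) + 2 * (E + h) * I ^ 2) /
        (√(E + h + μ - I ^ 2) * (μ ^ 2 / 4 + (E + h) * I ^ 2))) I := by
  have hp2 : 0 < E + h + μ - I ^ 2 := by linarith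
  have hp : 0 < √(E + h + μ - I ^ 2) := Real.sqrt_pos.2 hp2
  have hps := Real.sq_sqrt hp2.le
  have h0 : HasDerivAt (fun I : ℝ => I ^ 2) (2 * I) I := by simpa using hasDerivAt_pow 2 I
  have h1 : HasDerivAt (fun I : ℝ => μ / 2 - I ^ 2) (-(2 * I)) I := h0.const_sub (μ / 2)
  have h2 : HasDerivAt (fun I : ℝ => E + h + μ - I ^ 2) (-(2 * I)) I := h0.const_sub (E + h + μ)
  have h3 : HasDerivAt (fun I : ℝ => -(I * √(E + h + μ - I ^ 2)))
      (-(1 * √(E + h + μ - I ^ 2) + I * (-(2 * I) / (2 * √(E + h + μ - I ^ 2))))) I :=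
    ((hasDerivAt_id I).mul (h2.sqrt hp2.ne')).neg
  have hs : (⟨μ / 2 - I ^ 2, -(I * √(E + h + μ - I ^ 2))⟩ : ℂ) ∈ Complex.slitPlane := by
    rw [Complex.mem_slitPlane_iff]
    by_cases hI0 : I = 0
    · left; simp [hI0, hμ]
    · right; exact neg_ne_zero.2 (mul_ne_zero hI0 hp.ne')
  have h4 := (hasDerivAt_arg h1 h3 hs).const_mul 2
  have h5 : ∀ᶠ J in 𝓝 I, innerShift E h μ J =
      2 * Complex.arg ⟨μ / 2 - J ^ 2, -(J * √(E + h + μ - J ^ 2))⟩ := by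
    have : ∀ᶠ J : ℝ in 𝓝 I, J ^ 2 < E + h + μ :=
      (by fun_prop : ContinuousAt (fun J : ℝ => J ^ 2) I).eventually_lt continuousAt_const hI
    exact this.mono fun J hJ => innerShift_eq_arg hμ hJ
  convert! h4.congr_of_eventuallyEq h5 using 1
  have hden : (μ / 2 - I ^ 2) ^ 2 + (-(I * √(E + h + μ - I ^ 2))) ^ 2 =
      μ ^ 2 / 4 + (E + h) * I ^ 2 := by rw [neg_sq, mul_pow, hps]; ring
  rw [hden]
  set p := √(E + h + μ - I ^ 2)
  have hD : 0 < μ ^ 2 / 4 + (E + h) * I ^ 2 := by positivity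
  rw [← mul_div_assoc, div_eq_div_iff (by positivity) hD.ne']
  field_simp
  linear_combination (2 * I ^ 2 + μ) * hps

/-- Moving one shift derivative to the other side and squaring removes both square roots, so
critical actions are roots of `P`. As a polynomial in `I²`, `P` has degree five with leading
coefficient `48 ω⁴ (E + h)²`. -/
theorem criticalSet_finite {E ω h μ : ℝ} (hE : 0 < E) (hω : 0 < ω) (hh : 0 < h) (hμ : 0 < μ)
    (hEω : ω ^ 2 / 2 < E) : (criticalSet E ω h μ).Finite := by
  open Polynomial in
  let P : ℝ[X] :=
    (C (4 * E ^ 2 - 2 * E * ω ^ 2) - C (4 * ω ^ 2) * X ^ 2) ^ 2 * (C (E + h + μ) - X ^ 2) *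
      (C (μ ^ 2 / 4) + C (E + h) * X ^ 2) ^ 2 -
    (C (μ * (E + h + μ)) + C (2 * (E + h)) * X ^ 2) ^ 2 * (C (4 * E - 2 * ω ^ 2) - C 4 * X ^ 2) *
      (C (E ^ 2) - C (2 * ω ^ 2) * X ^ 2) ^ 2
  have hP : ∀ I : ℝ, P.eval I =
      (4 * E ^ 2 - 2 * E * ω ^ 2 - 4 * ω ^ 2 * I ^ 2) ^ 2 * (E + h + μ - I ^ 2) *
        (μ ^ 2 / 4 + (E + h) * I ^ 2) ^ 2 -
      (μ * (E + h + μ) + 2 * (E + h) * I ^ 2) ^ 2 * (4 * E - 2 * ω ^ 2 - 4 * I ^ 2) *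
        (E ^ 2 - 2 * ω ^ 2 * I ^ 2) ^ 2 := fun I => by
    simp only [P, Polynomial.eval_sub, Polynomial.eval_mul, Polynomial.eval_pow,
      Polynomial.eval_add, Polynomial.eval_C, Polynomial.eval_X]
  have hP0 : P ≠ 0 := by
    intro h0
    -- the fifth difference in the variable `I ^ 2` is a multiple of the leading coefficient
    have hz : ∀ m : ℝ, 0 ≤ m →
        (4 * E ^ 2 - 2 * E * ω ^ 2 - 4 * ω ^ 2 * m) ^ 2 * (E + h + μ - m) *
          (μ ^ 2 / 4 + (E + h) * m) ^ 2 -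
        (μ * (E + h + μ) + 2 * (E + h) * m) ^ 2 * (4 * E - 2 * ω ^ 2 - 4 * m) *
          (E ^ 2 - 2 * ω ^ 2 * m) ^ 2 = 0 := fun m hm => by
      have := hP (√m)
      rw [h0, Polynomial.eval_zero, Real.sq_sqrt hm] at this
      exact this.symm
    have h1 : 48 * ω ^ 4 * (E + h) ^ 2 = 0 := by
      linear_combination (hz 5 (by norm_num) - 5 * hz 4 (by norm_num) + 10 * hz 3 (by norm_num)
        - 10 * hz 2 (by norm_num) + 5 * hz 1 (by norm_num) - hz 0 le_rfl) / 120
    have : 0 < 48 * ω ^ 4 * (E + h) ^ 2 := by positivity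
    exact this.ne' h1
  refine (P.rootSet_finite ℝ).subset fun I hI => ?_
  obtain ⟨hI, hd⟩ := hI
  have hI2 := sq_lt_of_mem hEω hI
  have hEh : 0 < E + h := by linarith
  have hI3 : I ^ 2 < E + h + μ := by nlinarith
  rw [(hasDerivAt_outerShift hE hI2).deriv, (hasDerivAt_innerShift hEh hμ hI3).deriv] at hd
  rw [Polynomial.mem_rootSet]
  refine ⟨hP0, ?_⟩
  rw [Polynomial.coe_aeval_eq_eval, hP]
  have hq2 : 0 < 4 * E - 2 * (2 * I ^ 2 + ω ^ 2) := by linarith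
  have hq : 0 < √(4 * E - 2 * (2 * I ^ 2 + ω ^ 2)) := Real.sqrt_pos.2 hq2
  have hqs := Real.sq_sqrt hq2.le
  have hp2 : 0 < E + h + μ - I ^ 2 := by linarith
  have hp : 0 < √(E + h + μ - I ^ 2) := Real.sqrt_pos.2 hp2
  have hps := Real.sq_sqrt hp2.le
  have hD1 : 0 < E ^ 2 - 2 * ω ^ 2 * I ^ 2 := by
    have : 0 < ω ^ 2 := by positivity
    nlinarith [sq_nonneg (E - ω ^ 2)]
  have hD2 : 0 < μ ^ 2 / 4 + (E + h) * I ^ 2 := by positivity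
  set q := √(4 * E - 2 * (2 * I ^ 2 + ω ^ 2))
  set p := √(E + h + μ - I ^ 2)
  set D₁ := E ^ 2 - 2 * ω ^ 2 * I ^ 2
  set D₂ := μ ^ 2 / 4 + (E + h) * I ^ 2
  set N₁ := 4 * E ^ 2 - 2 * E * ω ^ 2 - 4 * ω ^ 2 * I ^ 2
  set N₂ := μ * (E + h + μ) + 2 * (E + h) * I ^ 2
  have h1 : N₁ * (p * D₂) = N₂ * (q * D₁) := by
    rw [neg_div, ← sub_eq_add_neg, sub_eq_zero, div_eq_div_iff (by positivity) (by positivity)] at hd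
    exact hd
  rw [← hps, show 4 * E - 2 * ω ^ 2 - 4 * I ^ 2 = q ^ 2 by rw [hqs]; ring]
  linear_combination (N₁ * (p * D₂) + N₂ * (q * D₁)) * h1

/-! ### The outer and the inner arc systems -/

theorem exists_radialFamily {n : ℕ} {C : ℝ} (hC : 0 < C) {f : ℝ → ℝ → ℝ}
    (hper : ∀ ε ∈ Icc (-C) C, Function.Periodic (fun ξ => f ξ ε) (2 * Real.pi))
    (hf : ContDiffOn ℝ ((n + 1 : ℕ) : WithTop ℕ∞) (fun x : ℝ × ℝ => f x.1 x.2)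
      (univ ×ˢ Icc (-C) C)) : ∃ δ, RadialFamily n δ (bdryRadius f) := by
  have hK : IsCompact (Icc 0 (2 * Real.pi) ×ˢ Icc (-C) C) := isCompact_Icc.prod isCompact_Icc
  obtain ⟨M, hM⟩ := hK.exists_bound_of_continuousOn
    (hf.continuousOn.mono (prod_mono_left (subset_univ _)))
  have hM0 : 0 ≤ M := (norm_nonneg _).trans (hM (0, 0)
    ⟨⟨le_rfl, Real.two_pi_pos.le⟩, ⟨by simpa using hC.le, hC.le⟩⟩)
  have hmem : ∀ ε, |ε| < min C (1 / (2 * M + 2)) → ε ∈ Ioo (-C) C := fun ε hε =>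
    abs_lt.1 (hε.trans_le (min_le_left _ _))
  -- With `M` a bound of `|f|` over one period, this gives `|ε f| < 1 / 2`. The strict inequality
  -- `|ε| < C` puts `ε` in the interior of the domain of smoothness.
  refine ⟨min C (1 / (2 * M + 2)), by positivity, fun ε hε θ => ?_, fun ε hε θ => ?_,
    fun ε hε θ => ?_, fun θ => by simp [bdryRadius]⟩
  · have : f (θ + 2 * Real.pi) ε = f θ ε := hper ε (Ioo_subset_Icc_self (hmem ε hε)) θ
    simp only [bdryRadius, this]
  · have hεC := Ioo_subset_Icc_self (hmem ε hε)
    obtain ⟨y, hy, hfy⟩ := (hper ε hεC).exists_mem_Ico₀ Real.two_pi_pos θ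
    have h1 : |f θ ε| ≤ M := by
      have : f θ ε = f y ε := hfy
      rw [this]
      exact hM (y, ε) ⟨Ico_subset_Icc_self hy, hεC⟩
    have h2 : |ε * f θ ε| < 1 / 2 := by
      rw [abs_mul]
      calc |ε| * |f θ ε| ≤ 1 / (2 * M + 2) * M :=
            mul_le_mul (hε.le.trans (min_le_right _ _)) h1 (abs_nonneg _) (by positivity)
        _ < 1 / 2 := by rw [div_mul_eq_mul_div, div_lt_div_iff₀ (by positivity) two_pos]; linarith
    rw [bdryRadius]
    linarith [(abs_lt.1 h2).1]
  · have h1 : ContDiffAt ℝ ((n + 1 : ℕ) : WithTop ℕ∞) (fun x : ℝ × ℝ => f x.1 x.2) (θ, ε) :=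
      hf.contDiffAt (prod_mem_nhds univ_mem (Icc_mem_nhds (hmem ε hε).1 (hmem ε hε).2))
    exact contDiffAt_const.add (contDiffAt_snd.mul h1)

/-- The outer problem. -/
def outerSystem (E ω : ℝ) (f : ℝ → ℝ → ℝ) : ArcSystem where
  l := -ω ^ 2
  e := 2 * E
  σ := 1
  c := 0
  C := fun t => Real.cos (ω * t)
  S := fun t => Real.sin (ω * t) / ω
  R := bdryRadius f

/-- The inner problem in the Levi-Civita coordinate `w`, `z = w ^ 2`. -/
def innerSystem (E h μ : ℝ) (f : ℝ → ℝ → ℝ) : ArcSystem where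
  -- Substituting `v = 2 w' / conj w` in the zero energy relation gives `|w'|² = μ/2 + ((E + h)/2)
  -- |w|²`. The radius in the field `R` is that of the preimage of the boundary under squaring.
  l := √((E + h) / 2) ^ 2
  e := μ / 2
  σ := -1
  c := Real.pi
  C := fun t => Real.cosh (√((E + h) / 2) * t)
  S := fun t => Real.sinh (√((E + h) / 2) * t) / √((E + h) / 2)
  R := fun η ε => √(bdryRadius f (2 * η) ε)

variable {E ω h μ : ℝ} {f : ℝ → ℝ → ℝ} {n : ℕ} {δ ε : ℝ}

theorem outerSystem_valid (hE : 0 < E) (hω : 0 < ω) (hR : RadialFamily n δ (bdryRadius f)) :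
    (outerSystem E ω f).Valid n δ where
  flow := linearFlow_cos hω
  fam := hR
  sigma := Or.inl rfl
  e_pos := by simp [outerSystem, hE]
  l_ne := by simp [outerSystem, hω.ne']
  exp_c := by simp [outerSystem]
  ret a ha _ := by
    simp only [outerSystem, one_mul] at ha ⊢
    -- Over half a period `g` goes from `2 a > 0` to `-2 a`, while the sine stays positive: the
    -- intermediate value theorem gives the return.
    set g : ℝ → ℝ := fun t => 2 * a * Real.cos (ω * t) +
      (2 * E + 2 * -ω ^ 2) * (Real.sin (ω * t) / ω) with hg
    have hπ : 0 < Real.pi / ω := div_pos Real.pi_pos hω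
    have hgc : ContinuousOn g (Icc 0 (Real.pi / ω)) := by fun_prop
    have h0 : g 0 = 2 * a := by simp [hg]
    have h1 : g (Real.pi / ω) = -(2 * a) := by
      simp [hg, mul_div_cancel₀ _ hω.ne']
    obtain ⟨T, hT, hgT⟩ := intermediate_value_Icc' hπ.le hgc
      (show (0 : ℝ) ∈ Icc (g (Real.pi / ω)) (g 0) by rw [h0, h1]; constructor <;> linarith)
    have hT0 : 0 < T := hT.1.lt_of_ne fun h => by rw [← h, h0] at hgT; linarith
    have hTπ : T < Real.pi / ω := hT.2.lt_of_ne fun h => by rw [h, h1] at hgT; linarith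
    refine ⟨T, hT0, hgT, fun t ht => div_pos (Real.sin_pos_of_pos_of_lt_pi
      (mul_pos hω ht.1) ?_) hω⟩
    rw [mul_comm]
    exact (lt_div_iff₀ hω).1 (ht.2.trans_lt hTπ)

theorem innerFamily (hR : RadialFamily n δ (bdryRadius f)) :
    RadialFamily n δ (fun η ε => √(bdryRadius f (2 * η) ε)) where
  pos := hR.pos
  periodic ε hε θ := by
    have h1 : ∀ θ, bdryRadius f (θ + 2 * Real.pi) ε = bdryRadius f θ ε := hR.periodic ε hε
    simp only
    rw [show 2 * (θ + 2 * Real.pi) = 2 * θ + 2 * Real.pi + 2 * Real.pi by ring, h1, h1]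
  lower ε hε θ := by
    have := hR.lower ε hε (2 * θ)
    exact Real.lt_sqrt_of_sq_lt (by linarith)
  smooth ε hε θ := by
    have h1 := hR.smooth ε hε (2 * θ)
    have h2 : ContDiffAt ℝ ((n + 1 : ℕ) : WithTop ℕ∞) (fun x : ℝ × ℝ => (2 * x.1, x.2)) (θ, ε) := by
      fun_prop
    have h3 : ContDiffAt ℝ ((n + 1 : ℕ) : WithTop ℕ∞) (fun x : ℝ × ℝ => bdryRadius f (2 * x.1) x.2)
        (θ, ε) :=
      ContDiffAt.comp (θ, ε) (g := fun x : ℝ × ℝ => bdryRadius f x.1 x.2)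
        (f := fun x : ℝ × ℝ => (2 * x.1, x.2)) h1 h2
    exact h3.sqrt
      (hR.pos_R hε _).ne'
  circle θ := by simp [hR.circle]

theorem innerSystem_valid (hEh : 0 < E + h) (hμ : 0 < μ) (hR : RadialFamily n δ (bdryRadius f)) :
    (innerSystem E h μ f).Valid n δ where
  flow := linearFlow_cosh (by positivity)
  fam := innerFamily hR
  sigma := Or.inr rfl
  e_pos := by simp [innerSystem, hμ]
  l_ne := by simp only [innerSystem]; positivity
  exp_c := by simp [innerSystem, Complex.exp_pi_mul_I]
  ret a ha hal := by
    simp only [innerSystem] at ha hal ⊢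
    have hκ : 0 < √((E + h) / 2) := by positivity
    set κ := √((E + h) / 2)
    -- The return equation is `tanh (κ T) = -2 a κ / M`, with `M = e + 2 l`. The bound on `a²` gives
    -- `M² - 4 a² κ² ≥ μ²/4`, so it is solvable, and the arsinh form gives `cosh (κ T) = M / s`.
    set M := μ / 2 + 2 * κ ^ 2 with hM
    have hM0 : 0 < M := by positivity
    have hd : 0 < M ^ 2 - 4 * a ^ 2 * κ ^ 2 := by
      have : 4 * a ^ 2 * κ ^ 2 ≤ 4 * (μ / 2 + κ ^ 2) * κ ^ 2 := by gcongr
      have : 0 < μ ^ 2 := by positivity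
      rw [hM]; nlinarith
    have hs := Real.sqrt_pos.2 hd
    have hss := Real.sq_sqrt hd.le
    set s := √(M ^ 2 - 4 * a ^ 2 * κ ^ 2)
    have hy : 0 < 2 * -a * κ / s := by
      have : 0 < -a := by linarith
      positivity
    have hc : √(1 + (2 * -a * κ / s) ^ 2) = M / s := by
      rw [Real.sqrt_eq_iff_mul_self_eq (by positivity) (by positivity)]
      field_simp
      linear_combination hss
    refine ⟨Real.arsinh (2 * -a * κ / s) / κ, div_pos (Real.arsinh_pos_iff.2 hy) hκ, ?_,
      fun t ht => div_pos (Real.sinh_pos_iff.2 (mul_pos hκ ht.1)) hκ⟩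
    rw [mul_div_cancel₀ _ hκ.ne', Real.cosh_arsinh, Real.sinh_arsinh, hc]
    field_simp
    ring

theorem innerSystem_l (hEh : 0 < E + h) : (innerSystem E h μ f).l = (E + h) / 2 :=
  Real.sq_sqrt (by positivity)

/-! ### The shifts -/

theorem outerSystem_shift (hE : 0 < E) {I : ℝ} (hI : I ^ 2 < E - ω ^ 2 / 2) :
    (outerSystem E ω f).shift (√2 * I) = outerShift E ω I := by
  have h2 : √2 ^ 2 = (2 : ℝ) := Real.sq_sqrt (by norm_num)
  rw [outerShift_eq_arg hE hI, ArcSystem.shift, 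
    ← Complex.arg_real_mul ⟨E - 2 * I ^ 2, _⟩ (two_pos : (0 : ℝ) < 2)]
  congr 1
  have h3 : √(4 * E - 2 * (2 * I ^ 2 + ω ^ 2)) = √2 * √(2 * E + -ω ^ 2 - (√2 * I) ^ 2) := by
    rw [← Real.sqrt_mul two_pos.le, mul_pow, h2]; ring_nf
  apply Complex.ext
  · simp [outerSystem, mul_pow]; ring
  · simp [outerSystem, h3]; ring

/-- The tangential momentum is `√2 I`, and in the `w`-plane half of that; the angle is halved too,
hence the factor `2` in front. -/
theorem innerSystem_shift (hEh : 0 < E + h) (hμ : 0 < μ) {I : ℝ} (hI : I ^ 2 < E + h + μ) :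
    2 * (innerSystem E h μ f).shift (√2 * I / 2) = innerShift E h μ I := by
  have h2 : √2 ^ 2 = (2 : ℝ) := Real.sq_sqrt (by norm_num)
  rw [innerShift_eq_arg hμ hI, ArcSystem.shift, innerSystem_l hEh]
  congr 2
  have h3 : √(E + h + μ - I ^ 2) = √2 * √(μ / 2 + (E + h) / 2 - (√2 * I / 2) ^ 2) := by
    rw [← Real.sqrt_mul two_pos.le, div_pow, mul_pow, h2]; ring_nf
  apply Complex.ext
  · simp [innerSystem, mul_pow, div_pow]; ring
  · simp [innerSystem, h3]; ring

/-! ### The first return map in terms of the arc systems -/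

theorem curve_inner_sq (hR : RadialFamily n δ (bdryRadius f)) (hε : |ε| < δ) (η : ℝ) :
    curve (innerSystem E h μ f).R ε η ^ 2 = bdry f ε (2 * η) := by
  have h1 : ((√(bdryRadius f (2 * η) ε) : ℝ) : ℂ) ^ 2 = (bdryRadius f (2 * η) ε : ℝ) := by
    rw [← Complex.ofReal_pow, Real.sq_sqrt (hR.pos_R hε _).le]
  rw [bdry_eq, curve, curve, innerSystem, mul_pow, h1, ← Complex.exp_nat_mul]
  push_cast
  ring_nf

theorem curve_inner_mul_dcurve (hR : RadialFamily n δ (bdryRadius f)) (hε : |ε| < δ) (η : ℝ) :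
    curve (innerSystem E h μ f).R ε η * dcurve (innerSystem E h μ f).R ε η =
      deriv (bdry f ε) (2 * η) := by
  have hI : RadialFamily n δ (innerSystem E h μ f).R := innerFamily hR
  have h1 : HasDerivAt (fun η => bdry f ε (2 * η))
      (2 * (curve (innerSystem E h μ f).R ε η * dcurve (innerSystem E h μ f).R ε η)) η := by
    have := (hI.hasDerivAt_curve hε η).pow 2
    refine (this.congr_deriv (by push_cast; ring)).congr_of_eventuallyEq
      (Eventually.of_forall fun x => (curve_inner_sq hR hε x).symm)
  have h2 : HasDerivAt (fun η => bdry f ε (2 * η)) ((2 : ℝ) • dcurve (bdryRadius f) ε (2 * η)) η :=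
    (hR.hasDerivAt_curve hε (2 * η)).scomp η (by simpa using (hasDerivAt_id η).const_mul 2)
  rw [deriv_bdry hR hε]
  have := h1.unique h2
  rw [Complex.real_smul] at this
  exact mul_left_cancel₀ two_ne_zero (by exact_mod_cast this)

theorem sq_mem_domain (hR : RadialFamily n δ (bdryRadius f)) (hε : |ε| < δ) {w : ℂ}
    (hw : ‖w‖ ^ 2 < rad (innerSystem E h μ f).R ε w ^ 2) : w ^ 2 ∈ domain f ε := by
  rw [rad, innerSystem, Real.sq_sqrt (hR.pos_R hε _).le] at hw
  refine ⟨‖w‖ ^ 2, 2 * Complex.arg w, by positivity, hw, ?_⟩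
  conv_lhs => rw [← Complex.norm_mul_exp_arg_mul_I w, mul_pow, ← Complex.exp_nat_mul]
  push_cast
  ring_nf

/-- Squaring is conformal: the tangent of the boundary is `p k` for `k` tangent to the preimage
curve. So tangential and normal components in the two planes differ by the constant factor `2`. -/
theorem inner_levi_civita {p : ℂ} (hp : p ≠ 0) (k v : ℂ) :
    inner ℝ (p * k) (2 * v / (starRingEnd ℂ) p) = 2 * inner ℝ k v := by
  have hp' : (starRingEnd ℂ) p ≠ 0 := by simpa using hp
  simp only [Complex.inner, map_mul]
  rw [show 2 * v / (starRingEnd ℂ) p * ((starRingEnd ℂ) p * (starRingEnd ℂ) k) =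
    ((2 : ℝ) : ℂ) * (v * (starRingEnd ℂ) k) by field_simp; push_cast; ring, Complex.re_ofReal_mul]

theorem zeroEnergy_levi_civita (hEh : 0 < E + h) {p v : ℂ} (hp : p ≠ 0)
    (hv : ‖v‖ ^ 2 = (innerSystem E h μ f).e + (innerSystem E h μ f).l * ‖p‖ ^ 2) :
    ZeroEnergy (innerPotential E h μ) (p ^ 2) (2 * v / (starRingEnd ℂ) p) := by
  have hp' : ‖p‖ ≠ 0 := norm_ne_zero_iff.2 hp
  rw [innerSystem_l hEh] at hv
  simp only [innerSystem] at hv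
  rw [ZeroEnergy, innerPotential, norm_div, norm_mul, RCLike.norm_conj, div_pow, mul_pow, hv,
    norm_pow, Complex.norm_two]
  field_simp
  ring

/-- The state on arrival at the outer arc: parameter and tangential momentum. -/
def outerReturn (E ω : ℝ) (f : ℝ → ℝ → ℝ) (x : ℝ × ℝ × ℝ) : ℝ × ℝ :=
  (outerSystem E ω f).arcMap (x.1, √2 * x.2.1, x.2.2)

/-- The starting state of the inner arc in the Levi-Civita coordinate. -/
def innerStart (E ω : ℝ) (f : ℝ → ℝ → ℝ) (x : ℝ × ℝ × ℝ) : ℝ × ℝ × ℝ :=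
  ((outerReturn E ω f x).1 / 2, (outerReturn E ω f x).2 / 2, x.2.2)

/-- The state on arrival of the inner arc in the Levi-Civita coordinate. -/
def innerReturn (E ω h μ : ℝ) (f : ℝ → ℝ → ℝ) (x : ℝ × ℝ × ℝ) : ℝ × ℝ :=
  (innerSystem E h μ f).arcMap (innerStart E ω f x)

/-- The lift of the first return map. -/
def returnLift (E ω h μ : ℝ) (f : ℝ → ℝ → ℝ) (x : ℝ × ℝ × ℝ) : ℝ × ℝ :=
  (2 * (innerReturn E ω h μ f x).1, √2 * (innerReturn E ω h μ f x).2)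

/-- Both arcs from points near `x = (ξ, I, ε)` return transversally and the last refraction is
possible. -/
structure GoodReturn (E ω h μ : ℝ) (f : ℝ → ℝ → ℝ) (n : ℕ) (δ : ℝ) (x : ℝ × ℝ × ℝ) : Prop where
  outer_good : ∀ᶠ y in 𝓝 (x.1, √2 * x.2.1, x.2.2), (outerSystem E ω f).Good n δ y
  inner_good : ∀ᶠ y in 𝓝 (innerStart E ω f x), (innerSystem E h μ f).Good n δ y
  refracted : 0 < (outerSystem E ω f).disc
    (2 * (innerReturn E ω h μ f x).1, 2 * (innerReturn E ω h μ f x).2, x.2.2)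

theorem outer_startVel_facts (hE : 0 < E) (hω : 0 < ω) (hR : RadialFamily n δ (bdryRadius f))
    {ξ J : ℝ} (hε : |ε| < δ) (hd : 0 < (outerSystem E ω f).disc (ξ, J, ε)) :
    inner ℝ (deriv (bdry f ε) ξ) ((outerSystem E ω f).startVel (ξ, J, ε)) = J ∧
    PointsOutward (bdry f ε) ξ ((outerSystem E ω f).startVel (ξ, J, ε)) ∧
    ZeroEnergy (outerPotential E ω) (bdry f ε ξ) ((outerSystem E ω f).startVel (ξ, J, ε)) := by
  obtain ⟨h1, h2, h3⟩ := ArcSystem.startVel_facts (outerSystem_valid hE hω hR) hε hd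
  rw [PointsOutward, deriv_bdry hR hε, ZeroEnergy, outerPotential]
  refine ⟨h1, ?_, ?_⟩
  · have : 0 < (outerSystem E ω f).σ * √((outerSystem E ω f).disc (ξ, J, ε)) := by
      rw [show (outerSystem E ω f).σ = 1 from rfl, one_mul]; exact Real.sqrt_pos.2 hd
    exact h2 ▸ this
  · rw [h3, bdry_eq]
    simp only [outerSystem]
    ring

/-- The inner arc is the square of the `w`-orbit. Both refractions hold because consecutive arcs are
started with the tangential momentum with which the previous one arrived. -/
theorem GoodReturn.isFirstReturn (hE : 0 < E) (hω : 0 < ω) (hh : 0 < h) (hμ : 0 < μ)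
    (hR : RadialFamily n δ (bdryRadius f)) {ξ I : ℝ}
    (H : GoodReturn E ω h μ f n δ (ξ, I, ε)) :
    IsFirstReturn E ω h μ f ε ξ I (returnLift E ω h μ f (ξ, I, ε)).1
      (returnLift E ω h μ f (ξ, I, ε)).2 := by
  have hEh : 0 < E + h := by positivity
  have hO := H.outer_good.self_of_nhds
  have hN := H.inner_good.self_of_nhds
  have hε : |ε| < δ := hO.small
  have hI : RadialFamily n δ (innerSystem E h μ f).R := innerFamily hR
  have hdom := domain_eq hR hε
  have hfr := bdry_mem_frontier hR hε
  set x₀ : ℝ × ℝ × ℝ := (ξ, √2 * I, ε)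
  set ξm := (outerSystem E ω f).arcAngle x₀
  set Jm := (outerSystem E ω f).arcMom x₀
  set y₀ := innerStart E ω f (ξ, I, ε)
  set η₁ := (innerSystem E h μ f).arcAngle y₀
  set J₁ := (innerSystem E h μ f).arcMom y₀
  have hd₁ : 0 < (outerSystem E ω f).disc (2 * η₁, 2 * J₁, ε) := H.refracted
  obtain ⟨a0, b0, c0⟩ := outer_startVel_facts hE hω hR hε hO.disc_pos
  obtain ⟨a1, b1, c1⟩ := outer_startVel_facts hE hω hR hε hd₁
  set v₀ := (outerSystem E ω f).startVel x₀
  set v₁ := (outerSystem E ω f).startVel (2 * η₁, 2 * J₁, ε)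
  set T := (outerSystem E ω f).retTime x₀
  set vE := (outerSystem E ω f).orbitVel x₀ T
  set S := (innerSystem E h μ f).retTime y₀
  set w₀ := (innerSystem E h μ f).startVel y₀
  set w₁ := (innerSystem E h μ f).orbitVel y₀ S
  set p := curve (innerSystem E h μ f).R ε (ξm / 2) with hp
  set q := curve (innerSystem E h μ f).R ε η₁ with hq
  have hp0 : p ≠ 0 := hI.curve_ne_zero hε _
  have hq0 : q ≠ 0 := hI.curve_ne_zero hε _
  have hp2 : p ^ 2 = bdry f ε ξm := by
    rw [hp, curve_inner_sq hR hε, mul_div_cancel₀ _ two_ne_zero]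
  have hq2 : q ^ 2 = bdry f ε (2 * η₁) := curve_inner_sq hR hε _
  have hp' : p * dcurve (innerSystem E h μ f).R ε (ξm / 2) = deriv (bdry f ε) ξm := by
    rw [hp, curve_inner_mul_dcurve hR hε, mul_div_cancel₀ _ two_ne_zero]
  have hq' : q * dcurve (innerSystem E h μ f).R ε η₁ = deriv (bdry f ε) (2 * η₁) :=
    curve_inner_mul_dcurve hR hε _
  obtain ⟨f1, f2, f3⟩ := ArcSystem.startVel_facts (innerSystem_valid hEh hμ hR) hN.small
    hN.disc_pos
  replace f3 : ‖w₀‖ ^ 2 = (innerSystem E h μ f).e + (innerSystem E h μ f).l * ‖p‖ ^ 2 := f3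
  have hlandE : (outerSystem E ω f).orbit x₀ T = bdry f ε ξm := hO.landing
  have hlandI : (innerSystem E h μ f).orbit y₀ S = q := hN.landing
  have hfrE : sol (outerSystem E ω f).C (outerSystem E ω f).S (bdry f ε ξ) v₀ T ∈
      frontier (domain f ε) := by
    have := hfr ξm
    rwa [← hlandE] at this
  have houter : IsOuterArc ω (domain f ε) (bdry f ε ξ) v₀ (bdry f ε ξm) vE := by
    have := isOuterArc_sol (D := domain f ε) (p := bdry f ε ξ) (v := v₀) (linearFlow_cos hω)
      (T := T) hO.isReturnTime.1 (fun t ht => ?_) hfrE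
    · rw [← hlandE]; exact this
    · have hg := hO.isReturnTime.2.2 t ht
      rw [ArcSystem.gap, show (outerSystem E ω f).σ = 1 from rfl, one_mul, sub_pos] at hg
      rw [hdom]
      exact hR.notMem_closure_domain hε (lt_of_pow_lt_pow_left₀ 2 (norm_nonneg _) hg)
  have hzE : ZeroEnergy (outerPotential E ω) (bdry f ε ξm) vE := by
    have := houter.energy (linearFlow_cos hω)
    unfold ZeroEnergy outerPotential at c0 ⊢
    linarith
  have hEin : PointsInward (bdry f ε) ξm vE := by
    have := hO.transversal
    rw [show (outerSystem E ω f).σ = 1 from rfl, one_mul] at this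
    rw [PointsInward, deriv_bdry hR hε]
    exact this
  have hJm' : inner ℝ (deriv (bdry f ε) ξm) vE = Jm := by
    rw [deriv_bdry hR hε]; rfl
  set vI := 2 * w₀ / (starRingEnd ℂ) p with hvI
  set wI := 2 * w₁ / (starRingEnd ℂ) q with hwI
  have hmul : ∀ a b : ℂ, -Complex.I * (a * b) = a * (-Complex.I * b) := fun a b => by ring
  have hIin : PointsInward (bdry f ε) ξm vI := by
    rw [PointsInward, ← hp', hmul, hvI, inner_levi_civita hp0]
    have h1 := Real.sqrt_pos.2 hN.disc_pos
    have h2 : inner ℝ (-Complex.I * dcurve (innerSystem E h μ f).R ε (ξm / 2)) w₀ =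
      -1 * √((innerSystem E h μ f).disc y₀) := f2
    rw [h2]
    linarith
  have hzI : ZeroEnergy (innerPotential E h μ) (bdry f ε ξm) vI := by
    rw [← hp2]; exact zeroEnergy_levi_civita hEh hp0 f3
  have hvI' : inner ℝ (deriv (bdry f ε) ξm) vI = Jm := by
    rw [← hp', hvI, inner_levi_civita hp0]
    have : inner ℝ (dcurve (innerSystem E h μ f).R ε (ξm / 2)) w₀ = Jm / 2 := f1
    rw [this]; ring
  have henI : ‖w₁‖ ^ 2 = (innerSystem E h μ f).e + (innerSystem E h μ f).l * ‖q‖ ^ 2 := by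
    have := (innerSystem_valid hEh hμ hR).flow.energy p w₀ S
    rw [← hlandI]
    rw [f3] at this
    have h2 : ‖w₁‖ ^ 2 - (innerSystem E h μ f).l * ‖(innerSystem E h μ f).orbit y₀ S‖ ^ 2 = _ := this
    linarith
  have hinner : IsInnerArc μ (domain f ε) (bdry f ε ξm) vI (bdry f ε (2 * η₁)) wI := by
    have := isInnerArc_sol (D := domain f ε) (p := p) (v := w₀) (innerSystem_valid hEh hμ hR).flow
      hμ (b := S) (by rw [f3]; simp only [innerSystem]; ring) hN.isReturnTime.1
      (fun t ht => ?_) ?_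
    · rw [← hp2, ← hq2, hwI, ← hlandI]; exact this
    · have hg := hN.isReturnTime.2.2 t ht
      rw [ArcSystem.gap, show (innerSystem E h μ f).σ = -1 from rfl] at hg
      exact sq_mem_domain hR hε (E := E) (h := h) (μ := μ) (by
        have h1 : 0 < -1 * (‖(innerSystem E h μ f).orbit y₀ t‖ ^ 2 -
          rad (innerSystem E h μ f).R ε ((innerSystem E h μ f).orbit y₀ t) ^ 2) := hg
        have h2 : ‖(innerSystem E h μ f).orbit y₀ t‖ ^ 2 <
          rad (innerSystem E h μ f).R ε ((innerSystem E h μ f).orbit y₀ t) ^ 2 := by linarith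
        exact h2)
    · have := hfr (2 * η₁)
      rw [← hq2, ← hlandI] at this
      exact this
  have hwout : PointsOutward (bdry f ε) (2 * η₁) wI := by
    rw [PointsOutward, ← hq', hmul, hwI, inner_levi_civita hq0]
    have := hN.transversal
    rw [show (innerSystem E h μ f).σ = -1 from rfl] at this
    have h2 : -1 * inner ℝ (-Complex.I * dcurve (innerSystem E h μ f).R ε η₁) w₁ < 0 := this
    linarith
  have hwI' : inner ℝ (deriv (bdry f ε) (2 * η₁)) wI = 2 * J₁ := by
    rw [← hq', hwI, inner_levi_civita hq0]; rfl
  have hzw : ZeroEnergy (innerPotential E h μ) (bdry f ε (2 * η₁)) wI := by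
    rw [← hq2]; exact zeroEnergy_levi_civita hEh hq0 henI
  have h2 : √2 ^ 2 = (2 : ℝ) := Real.sq_sqrt (by norm_num)
  have hs2 : (0 : ℝ) < √2 := by positivity
  refine ⟨ξm, v₀, vE, vI, wI, v₁, ⟨b0, c0, ?_⟩, houter, ⟨hEin, hIin, hzI, ?_⟩, hinner,
    ⟨hwout, b1, c1, ?_⟩, ?_⟩
  · rw [action_eq b0.ne_zero.2 b0.ne_zero.1 c0, a0]
    field_simp
  · rw [snell_iff hEin.ne_zero.2 hEin.ne_zero.1 hIin.ne_zero.1 hzE hzI, hvI', hJm']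
  · exact (snell_iff b1.ne_zero.2 b1.ne_zero.1 hwout.ne_zero.1 c1 hzw).2 (hwI'.trans a1.symm)
  · refine (action_eq b1.ne_zero.2 b1.ne_zero.1 c1).trans ?_
    rw [a1, div_eq_iff hs2.ne']
    change 2 * J₁ = √2 * J₁ * √2
    linear_combination -J₁ * h2

/-! ### The lift of the first return map near the circular case -/

theorem outerReturn_zero (hE : 0 < E) (hω : 0 < ω) (hR : RadialFamily n δ (bdryRadius f)) {I : ℝ}
    (hI : I ^ 2 < E - ω ^ 2 / 2) (ξ : ℝ) :
    outerReturn E ω f (ξ, I, 0) = (ξ + outerShift E ω I, √2 * I) := by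
  have h2 : √2 ^ 2 = (2 : ℝ) := Real.sq_sqrt (by norm_num)
  have h1 : (√2 * I) ^ 2 < (outerSystem E ω f).e + (outerSystem E ω f).l := by
    rw [mul_pow, h2]; simp only [outerSystem]; linarith
  rw [outerReturn, ArcSystem.arcMap_zero (outerSystem_valid hE hω hR) h1, outerSystem_shift hE hI]
  simp [outerSystem]

theorem inner_momentum_sq_lt (hE : 0 < E) (hh : 0 < h) (hμ : 0 < μ) {I : ℝ}
    (hI : I ^ 2 < E - ω ^ 2 / 2) :
    (√2 * I / 2) ^ 2 < (innerSystem E h μ f).e + (innerSystem E h μ f).l := by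
  have h2 : √2 ^ 2 = (2 : ℝ) := Real.sq_sqrt (by norm_num)
  rw [div_pow, mul_pow, h2, innerSystem_l (by positivity)]
  simp only [innerSystem]
  nlinarith [sq_nonneg ω]

theorem innerReturn_zero (hE : 0 < E) (hω : 0 < ω) (hh : 0 < h) (hμ : 0 < μ)
    (hR : RadialFamily n δ (bdryRadius f)) {I : ℝ} (hI : I ^ 2 < E - ω ^ 2 / 2) (ξ : ℝ) :
    innerReturn E ω h μ f (ξ, I, 0) =
      ((ξ + outerShift E ω I) / 2 + Real.pi + innerShift E h μ I / 2, √2 * I / 2) := by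
  have hI' : I ^ 2 < E + h + μ := by nlinarith [sq_nonneg ω]
  rw [innerReturn, innerStart, outerReturn_zero hE hω hR hI, ArcSystem.arcMap_zero
    (innerSystem_valid (by positivity) hμ hR) (inner_momentum_sq_lt hE hh hμ hI),
    ← innerSystem_shift (f := f) (by positivity) hμ hI', mul_div_cancel_left₀ _ two_ne_zero]
  rfl

theorem returnLift_zero (hE : 0 < E) (hω : 0 < ω) (hh : 0 < h) (hμ : 0 < μ)
    (hR : RadialFamily n δ (bdryRadius f)) {I : ℝ} (hI : I ^ 2 < E - ω ^ 2 / 2) (ξ : ℝ) :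
    returnLift E ω h μ f (ξ, I, 0) =
      (ξ + outerShift E ω I + innerShift E h μ I + 2 * Real.pi, I) := by
  have h2 : √2 ^ 2 = (2 : ℝ) := Real.sq_sqrt (by norm_num)
  rw [returnLift, innerReturn_zero hE hω hh hμ hR hI]
  ext
  · simp only; ring
  · simp only; linear_combination I / 2 * h2

theorem contDiffAt_outerReturn {x : ℝ × ℝ × ℝ}
    (H : (outerSystem E ω f).Good n δ (x.1, √2 * x.2.1, x.2.2)) :
    ContDiffAt ℝ n (outerReturn E ω f) x :=
  H.contDiffAt_arcMap.comp x (f := fun x : ℝ × ℝ × ℝ => (x.1, √2 * x.2.1, x.2.2)) (by fun_prop)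

theorem contDiffAt_innerStart {x : ℝ × ℝ × ℝ}
    (H : (outerSystem E ω f).Good n δ (x.1, √2 * x.2.1, x.2.2)) :
    ContDiffAt ℝ n (innerStart E ω f) x := by
  have h1 := contDiffAt_outerReturn H
  unfold innerStart
  exact (h1.fst.div_const 2).prodMk ((h1.snd.div_const 2).prodMk (by fun_prop))

theorem contDiffAt_innerReturn {x : ℝ × ℝ × ℝ}
    (H : (outerSystem E ω f).Good n δ (x.1, √2 * x.2.1, x.2.2))
    (H' : (innerSystem E h μ f).Good n δ (innerStart E ω f x)) :
    ContDiffAt ℝ n (innerReturn E ω h μ f) x :=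
  H'.contDiffAt_arcMap.comp x (contDiffAt_innerStart H)

theorem GoodReturn.contDiffAt {x : ℝ × ℝ × ℝ} (H : GoodReturn E ω h μ f n δ x) :
    ContDiffAt ℝ n (returnLift E ω h μ f) x := by
  have h1 := contDiffAt_innerReturn H.outer_good.self_of_nhds H.inner_good.self_of_nhds
  exact (contDiffAt_const.mul h1.fst).prodMk (contDiffAt_const.mul h1.snd)

theorem eventually_goodReturn (hE : 0 < E) (hω : 0 < ω) (hh : 0 < h) (hμ : 0 < μ) (hn : 1 ≤ n)
    (hR : RadialFamily n δ (bdryRadius f)) {I : ℝ} (hI : I ^ 2 < E - ω ^ 2 / 2) (ξ : ℝ) :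
    ∀ᶠ x in 𝓝 ((ξ, I, 0) : ℝ × ℝ × ℝ), GoodReturn E ω h μ f n δ x := by
  have h2 : √2 ^ 2 = (2 : ℝ) := Real.sq_sqrt (by norm_num)
  have hO := outerSystem_valid hE hω hR
  have hN : (innerSystem E h μ f).Valid n δ := innerSystem_valid (by positivity) hμ hR
  have e1 : (√2 * I) ^ 2 < (outerSystem E ω f).e + (outerSystem E ω f).l := by
    rw [mul_pow, h2]; simp only [outerSystem]; linarith
  have hs : ContinuousAt (fun x : ℝ × ℝ × ℝ => (x.1, √2 * x.2.1, x.2.2)) (ξ, I, 0) := by fun_prop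
  have g1 := hs.eventually (ArcSystem.eventually_good hO hn e1 ξ).eventually_nhds
  have c1 := contDiffAt_innerStart g1.self_of_nhds.self_of_nhds
  have e2 : innerStart E ω f (ξ, I, 0) = ((ξ + outerShift E ω I) / 2, √2 * I / 2, 0) := by
    rw [innerStart, outerReturn_zero hE hω hR hI]
  have g2 := c1.continuousAt.eventually (p := fun y => ∀ᶠ z in 𝓝 y, (innerSystem E h μ f).Good n δ z)
    (by rw [e2]; exact (ArcSystem.eventually_good hN hn (inner_momentum_sq_lt hE hh hμ hI)
      ((ξ + outerShift E ω I) / 2)).eventually_nhds)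
  have c2 := (contDiffAt_innerReturn g1.self_of_nhds.self_of_nhds
    g2.self_of_nhds.self_of_nhds).continuousAt
  have c3 : ContinuousAt (fun x : ℝ × ℝ × ℝ => (outerSystem E ω f).disc
      (2 * (innerReturn E ω h μ f x).1, 2 * (innerReturn E ω h μ f x).2, x.2.2)) (ξ, I, 0) := by
    refine ContinuousAt.comp (g := (outerSystem E ω f).disc) (f := fun x : ℝ × ℝ × ℝ =>
      (2 * (innerReturn E ω h μ f x).1, 2 * (innerReturn E ω h μ f x).2, x.2.2))
      (ArcSystem.contDiffAt_disc hO (by simpa using hR.pos)).continuousAt ?_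
    exact (continuousAt_const.mul c2.fst).prodMk ((continuousAt_const.mul c2.snd).prodMk
      (by fun_prop))
  -- At `ε = 0` the particle leaves with the momentum `√2 I` it started with, so the last refraction
  -- is possible because `|I| < I_c`.
  have g3 := continuousAt_const.eventually_lt (f := fun _ => (0 : ℝ)) c3 (by
    rw [innerReturn_zero hE hω hh hμ hR hI, ArcSystem.disc_zero hO]
    simp only
    rw [mul_div_cancel₀ _ two_ne_zero]
    linarith)
  filter_upwards [g1, g2, g3] with x h1 h2 h3 using ⟨h1, h2, h3⟩

/-- The twist condition holds near the circular case. -/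
theorem eventually_twist (hE : 0 < E) (hω : 0 < ω) (hh : 0 < h) (hμ : 0 < μ) (hn : 1 ≤ n)
    (hR : RadialFamily n δ (bdryRadius f)) {I : ℝ} (hI : I ^ 2 < E - ω ^ 2 / 2)
    (hne : deriv (outerShift E ω) I + deriv (innerShift E h μ) I ≠ 0) (ξ : ℝ) :
    ∀ᶠ x in 𝓝 ((ξ, I, 0) : ℝ × ℝ × ℝ), (fderiv ℝ (returnLift E ω h μ f) x (0, 1, 0)).1 ≠ 0 := by
  have hI' : I ^ 2 < E + h + μ := by nlinarith [sq_nonneg ω]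
  have hn' : (1 : WithTop ℕ∞) ≤ n := by exact_mod_cast hn
  have hc := (eventually_goodReturn hE hω hh hμ hn hR hI ξ).self_of_nhds.contDiffAt.of_le hn'
  have hcont : ContinuousAt (fun x => (fderiv ℝ (returnLift E ω h μ f) x (0, 1, 0)).1) (ξ, I, 0) :=
    ((hc.fderiv_right (m := 0) (by simp)).continuousAt.clm_apply continuousAt_const).fst
  refine hcont.eventually_ne ?_
  have h1 : HasDerivAt (fun J : ℝ => ((ξ, J, 0) : ℝ × ℝ × ℝ)) (0, 1, 0) I :=
    (hasDerivAt_const I ξ).prodMk ((hasDerivAt_id I).prodMk (hasDerivAt_const I 0))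
  have h2 : HasDerivAt (fun J : ℝ => (returnLift E ω h μ f (ξ, J, 0)).1)
      (fderiv ℝ (returnLift E ω h μ f) (ξ, I, 0) (0, 1, 0)).1 I :=
    (ContinuousLinearMap.fst ℝ ℝ ℝ).hasFDerivAt.comp_hasDerivAt I
      (HasFDerivAt.comp_hasDerivAt I (f := fun J : ℝ => ((ξ, J, 0) : ℝ × ℝ × ℝ))
        (hc.differentiableAt (by simp)).hasFDerivAt h1)
  have h3 : HasDerivAt (fun J => ξ + outerShift E ω J + innerShift E h μ J + 2 * Real.pi)
      (0 + deriv (outerShift E ω) I + deriv (innerShift E h μ) I) I :=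
    (((hasDerivAt_const I ξ).add (hasDerivAt_outerShift hE hI).differentiableAt.hasDerivAt).add
      (hasDerivAt_innerShift (by positivity) hμ hI').differentiableAt.hasDerivAt).add_const _
  have h4 : ∀ᶠ J : ℝ in 𝓝 I, J ^ 2 < E - ω ^ 2 / 2 :=
    (by fun_prop : ContinuousAt (fun J : ℝ => J ^ 2) I).eventually_lt continuousAt_const hI
  have h5 := h2.congr_of_eventuallyEq (f₁ := fun J =>
    ξ + outerShift E ω J + innerShift E h μ J + 2 * Real.pi) (by
      filter_upwards [h4] with J hJ
      rw [returnLift_zero hE hω hh hμ hR hJ])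
  have h6 := h5.unique h3
  rw [zero_add] at h6
  rw [h6]
  exact hne

/-- The linear map `(ξ, I) ↦ (a ξ, b I)`. -/
def scaling (a b : ℝ) : ℝ × ℝ →L[ℝ] ℝ × ℝ :=
  (a • ContinuousLinearMap.fst ℝ ℝ ℝ).prod (b • ContinuousLinearMap.snd ℝ ℝ ℝ)

theorem det_scaling (a b : ℝ) : (scaling a b).det = a * b := by
  rw [det_eq_prod]; simp [scaling]

theorem det_comp (L M : ℝ × ℝ →L[ℝ] ℝ × ℝ) : (L ∘L M).det = L.det * M.det :=
  LinearMap.det_comp _ _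

/-- Both arc maps have determinant `1`, and the scalings between them multiply to `√2 · (1/4) · 2√2
= 1`. -/
theorem GoodReturn.hasFDerivAt (hE : 0 < E) (hω : 0 < ω) (hh : 0 < h) (hμ : 0 < μ) (hn : 1 ≤ n)
    (hR : RadialFamily n δ (bdryRadius f)) {ξ I : ℝ}
    (H : GoodReturn E ω h μ f n δ (ξ, I, ε)) :
    ∃ L : ℝ × ℝ →L[ℝ] ℝ × ℝ,
      HasFDerivAt (fun p : ℝ × ℝ => returnLift E ω h μ f (p.1, p.2, ε)) L (ξ, I) ∧ L.det = 1 := by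
  obtain ⟨L₁, h1, d1⟩ := ArcSystem.hasFDerivAt_arcMap (outerSystem_valid hE hω hR) hn H.outer_good
  obtain ⟨L₂, h2, d2⟩ := ArcSystem.hasFDerivAt_arcMap
    (innerSystem_valid (by positivity) hμ hR) hn H.inner_good
  have s1 : HasFDerivAt (fun p : ℝ × ℝ => (p.1, √2 * p.2)) (scaling 1 √2) (ξ, I) :=
    (scaling 1 √2).hasFDerivAt.congr_of_eventuallyEq
      (Eventually.of_forall fun p => by simp [scaling])
  have s2 : ∀ q : ℝ × ℝ, HasFDerivAt (fun p : ℝ × ℝ => (p.1 / 2, p.2 / 2))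
      (scaling (1 / 2) (1 / 2)) q := fun q =>
    (scaling (1 / 2) (1 / 2)).hasFDerivAt.congr_of_eventuallyEq
      (Eventually.of_forall fun p => by ext <;> simp [scaling] <;> ring)
  have s3 : ∀ q : ℝ × ℝ, HasFDerivAt (fun p : ℝ × ℝ => (2 * p.1, √2 * p.2)) (scaling 2 √2) q :=
    fun q => (scaling 2 √2).hasFDerivAt.congr_of_eventuallyEq
      (Eventually.of_forall fun p => by simp [scaling])
  have h3 := HasFDerivAt.comp (ξ, I) (f := fun p : ℝ × ℝ => (p.1, √2 * p.2)) h1 s1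
  have h4 := (s2 _).comp (ξ, I) h3
  have h5 := HasFDerivAt.comp (ξ, I) (g := fun p : ℝ × ℝ => (innerSystem E h μ f).arcMap
    (p.1, p.2, ε)) h2 h4
  have h6 := (s3 _).comp (ξ, I) h5
  refine ⟨_, h6, ?_⟩
  have h2 : √2 ^ 2 = (2 : ℝ) := Real.sq_sqrt (by norm_num)
  simp only [det_comp, det_scaling, d1, d2]
  linear_combination h2 / 2

/-- A shift of `ξ` by `4π` is a shift by `2π` in the half-angle coordinate of the inner problem,
where `arcMap_add_two_pi` applies. -/
theorem returnLift_add_four_pi (hE : 0 < E) (hω : 0 < ω) (hh : 0 < h) (hμ : 0 < μ)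
    (hR : RadialFamily n δ (bdryRadius f)) (hε : |ε| < δ) (ξ I : ℝ) :
    returnLift E ω h μ f (ξ + 4 * Real.pi, I, ε) =
      returnLift E ω h μ f (ξ, I, ε) + (4 * Real.pi, 0) := by
  have h1 : outerReturn E ω f (ξ + 4 * Real.pi, I, ε) =
      outerReturn E ω f (ξ, I, ε) + (4 * Real.pi, 0) := by
    have hO := outerSystem_valid hE hω hR
    simp only [outerReturn]
    rw [show ξ + 4 * Real.pi = ξ + 2 * Real.pi + 2 * Real.pi by ring,
      ArcSystem.arcMap_add_two_pi hO hε, ArcSystem.arcMap_add_two_pi hO hε, add_assoc]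
    congr 1
    ext <;> simp
    ring
  have h2 : innerStart E ω f (ξ + 4 * Real.pi, I, ε) =
      ((innerStart E ω f (ξ, I, ε)).1 + 2 * Real.pi, (innerStart E ω f (ξ, I, ε)).2.1, ε) := by
    simp only [innerStart, h1, Prod.fst_add, Prod.snd_add, add_zero]
    ring_nf
  have h3 : innerReturn E ω h μ f (ξ + 4 * Real.pi, I, ε) =
      innerReturn E ω h μ f (ξ, I, ε) + (2 * Real.pi, 0) := by
    rw [innerReturn, h2, ArcSystem.arcMap_add_two_pi (innerSystem_valid (by positivity) hμ hR) hε]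
    rfl
  rw [returnLift, h3, returnLift]
  ext <;> simp
  ring

/-! ### Area on the cylinder -/

/-- The projection of the plane onto the cylinder. -/
def proj (p : ℝ × ℝ) : Cylinder := ((p.1 : AddCircle (2 * Real.pi)), p.2)

theorem measurable_proj : Measurable proj :=
  ((AddCircle.measurable_mk' (a := 2 * Real.pi)).comp measurable_fst).prodMk measurable_snd

theorem injOn_coe_Ioc (t : ℝ) :
    InjOn (fun x : ℝ => (x : AddCircle (2 * Real.pi))) (Ioc t (t + 2 * Real.pi)) := by
  intro x hx y hy hxy
  have h0 : ((x - y : ℝ) : AddCircle (2 * Real.pi)) = 0 := by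
    rw [AddCircle.coe_sub, sub_eq_zero]; exact hxy
  obtain ⟨m, hm⟩ := (AddCircle.coe_eq_zero_iff _).1 h0
  rw [zsmul_eq_mul] at hm
  have hπ := Real.two_pi_pos
  have h1 : (m : ℝ) < 1 := by
    by_contra! h
    nlinarith [hx.2, hy.1]
  have h2 : (-1 : ℝ) < m := by
    by_contra! h
    nlinarith [hx.1, hy.2]
  have h3 : m = 0 := by
    have h1' : m < 1 := by exact_mod_cast h1
    have h2' : -1 < m := by exact_mod_cast h2
    omega
  rw [h3, Int.cast_zero, zero_mul] at hm
  linarith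

/-- The strip over one fundamental interval. -/
def strip (t : ℝ) : Set (ℝ × ℝ) := Ioc t (t + 2 * Real.pi) ×ˢ univ

theorem injOn_proj_strip (t : ℝ) : InjOn proj (strip t) := fun p hp q hq hpq => by
  simp only [proj, Prod.mk.injEq] at hpq
  exact Prod.ext (injOn_coe_Ioc t hp.1 hq.1 hpq.1) hpq.2

theorem measurableSet_strip (t : ℝ) : MeasurableSet (strip t) := measurableSet_Ioc.prod .univ

theorem volume_proj_image_of_subset {t : ℝ} {W : Set (ℝ × ℝ)} (hW : MeasurableSet W)
    (hWt : W ⊆ strip t) : volume (proj '' W) = volume W := by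
  have hm : MeasurableSet (proj '' W) :=
    hW.image_of_measurable_injOn measurable_proj ((injOn_proj_strip t).mono hWt)
  have h1 : MeasurePreserving proj ((volume.restrict (Ioc t (t + 2 * Real.pi))).prod volume)
      volume := (AddCircle.measurePreserving_mk (2 * Real.pi) t).prod (MeasurePreserving.id volume)
  have h2 : (volume.restrict (Ioc t (t + 2 * Real.pi))).prod (volume : Measure ℝ) =
      (volume : Measure (ℝ × ℝ)).restrict (strip t) := by
    rw [strip, Measure.volume_eq_prod, ← Measure.prod_restrict, Measure.restrict_univ]
  rw [← h1.measure_preimage hm.nullMeasurableSet, h2,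
    Measure.restrict_apply (measurable_proj hm)]
  congr 1
  ext p
  constructor
  · rintro ⟨⟨q, hq, hqp⟩, hp⟩
    rwa [← injOn_proj_strip t (hWt hq) hp hqp]
  · exact fun hp => ⟨mem_image_of_mem _ hp, hWt hp⟩

/-- The set is cut along the fundamental strips; injectivity of `proj` on it keeps the images of the
pieces disjoint. -/
theorem volume_proj_image {W : Set (ℝ × ℝ)} (hW : MeasurableSet W) (hinj : InjOn proj W) :
    volume (proj '' W) = volume W := by
  set B : ℤ → Set (ℝ × ℝ) := fun m => W ∩ strip (m • (2 * Real.pi)) with hB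
  have hBm : ∀ m, MeasurableSet (B m) := fun m => hW.inter (measurableSet_strip _)
  have hBd : Pairwise (Function.onFun Disjoint B) := fun i j hij => by
    have := pairwise_disjoint_Ioc_zsmul (2 * Real.pi) hij
    simp only [Function.onFun, add_smul, one_smul] at this
    exact (this.set_prod_left univ univ).mono inter_subset_right inter_subset_right
  have hBW : ⋃ m, B m = W := by
    rw [hB, ← inter_iUnion, inter_eq_left]
    rintro p -
    have : p.1 ∈ ⋃ m : ℤ, Ioc (m • (2 * Real.pi)) ((m + 1) • (2 * Real.pi)) := by
      rw [iUnion_Ioc_zsmul Real.two_pi_pos]; trivial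
    simp only [mem_iUnion, add_smul, one_smul] at this ⊢
    obtain ⟨m, hm⟩ := this
    exact ⟨m, hm, trivial⟩
  have hinjB : ∀ m, InjOn proj (B m) := fun m => hinj.mono inter_subset_left
  conv_lhs => rw [← hBW, image_iUnion]
  conv_rhs => rw [← hBW]
  rw [measure_iUnion hBd hBm, measure_iUnion (fun i j hij => ?_)
    fun m => (hBm m).image_of_measurable_injOn measurable_proj (hinjB m)]
  · exact tsum_congr fun m => volume_proj_image_of_subset (hBm m) inter_subset_right
  · rw [Function.onFun, disjoint_left]
    rintro _ ⟨p, hp, rfl⟩ ⟨q, hq, hqp⟩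
    exact disjoint_left.1 (hBd hij) hp (hinj hq.1 hp.1 hqp ▸ hq)

/-- A map of the annulus with a lift of Jacobian determinant `1` preserves the area. -/
theorem preservesAreaOn_of_lift {F : Cylinder → Cylinder} {Φ : ℝ × ℝ → ℝ × ℝ} {a b : ℝ}
    (hF : ∀ p ∈ univ ×ˢ Icc a b, F (proj p) = proj (Φ p))
    (hinj : ∀ p ∈ univ ×ˢ Icc a b, ∀ q ∈ univ ×ˢ Icc a b, F (proj p) = F (proj q) →
      proj p = proj q)
    (hΦ : ∀ p ∈ univ ×ˢ Icc a b, ∃ L : ℝ × ℝ →L[ℝ] ℝ × ℝ, HasFDerivAt Φ L p ∧ L.det = 1) :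
    PreservesAreaOn F (annulus a b) := by
  intro A hA hAm
  set W := proj ⁻¹' A ∩ strip 0 with hW
  have hWm : MeasurableSet W := (measurable_proj hAm).inter (measurableSet_strip 0)
  have hWs : W ⊆ univ ×ˢ Icc a b := fun p hp => ⟨trivial, (hA hp.1).2⟩
  have hWA : proj '' W = A := by
    rw [hW, image_preimage_inter, inter_eq_left]
    rintro ⟨c, I⟩ -
    obtain ⟨x, rfl⟩ := QuotientAddGroup.mk_surjective c
    refine ⟨(toIocMod Real.two_pi_pos 0 x, I), ⟨toIocMod_mem_Ioc _ _ _, trivial⟩, ?_⟩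
    simp only [proj, Prod.mk.injEq, and_true]
    exact QuotientAddGroup.eq.2 (AddSubgroup.mem_zmultiples_iff.2
      ⟨toIocDiv Real.two_pi_pos 0 x, by rw [toIocMod]; abel⟩)
  have hΦi : InjOn (proj ∘ Φ) W := fun p hp q hq hpq => by
    refine injOn_proj_strip 0 hp.2 hq.2 (hinj p (hWs hp) q (hWs hq) ?_)
    rw [hF p (hWs hp), hF q (hWs hq)]; exact hpq
  have hΦi' : InjOn Φ W := fun p hp q hq hpq => hΦi hp hq (congrArg proj hpq)
  choose! L hL hdet using hΦ
  have hd : ∀ p ∈ W, HasFDerivWithinAt Φ (L p) W p := fun p hp =>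
    (hL p (hWs hp)).hasFDerivWithinAt
  have hvol : volume (Φ '' W) = volume W := by
    rw [← lintegral_abs_det_fderiv_eq_addHaar_image volume hWm hd hΦi',
      setLIntegral_congr_fun hWm (g := fun _ => 1) fun p hp => by simp [hdet p (hWs hp)]]
    simp
  have hFA : F '' A = proj '' (Φ '' W) := by
    rw [← hWA, image_image, image_image]
    exact image_congr fun p hp => hF p (hWs hp)
  -- The image of `W` under `Φ` may spread over several strips; `proj` is injective on it because
  -- `F` is injective on the annulus.
  rw [hFA, volume_proj_image (measurable_image_of_fderivWithin hWm hd hΦi') hΦi.image_of_comp,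
    hvol, ← volume_proj_image_of_subset hWm inter_subset_right, hWA]

/-! ### Uniformity -/

/-- The local statements near `ε = 0` become uniform over the compact set of one period `4π` times
`[a, b]`. -/
theorem exists_uniform_goodReturn (hE : 0 < E) (hω : 0 < ω) (hh : 0 < h) (hμ : 0 < μ)
    (hEω : ω ^ 2 / 2 < E) (hn : 1 ≤ n) (hR : RadialFamily n δ (bdryRadius f)) {a b : ℝ}
    (hab : Icc a b ⊆ Ioo (-criticalAction E ω) (criticalAction E ω) \ criticalSet E ω h μ) :
    ∃ ε₀, 0 < ε₀ ∧ ∀ ε, |ε| < ε₀ → ∀ p ∈ Icc 0 (4 * Real.pi) ×ˢ Icc a b,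
      GoodReturn E ω h μ f n δ (p.1, p.2, ε) ∧
      (fderiv ℝ (returnLift E ω h μ f) (p.1, p.2, ε) (0, 1, 0)).1 ≠ 0 := by
  have hK : IsCompact (Icc 0 (4 * Real.pi) ×ˢ Icc a b) := isCompact_Icc.prod isCompact_Icc
  have := hK.eventually_forall_of_forall_eventually (x₀ := (0 : ℝ)) (P := fun ε p =>
      GoodReturn E ω h μ f n δ (p.1, p.2, ε) ∧
      (fderiv ℝ (returnLift E ω h μ f) (p.1, p.2, ε) (0, 1, 0)).1 ≠ 0) fun p hp => by
    obtain ⟨hI, hJ⟩ := hab hp.2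
    have hI2 := sq_lt_of_mem hEω hI
    have hne : deriv (outerShift E ω) p.2 + deriv (innerShift E h μ) p.2 ≠ 0 := fun h0 =>
      hJ ⟨hI, h0⟩
    have hc : ContinuousAt (fun z : ℝ × ℝ × ℝ => (z.2.1, z.2.2, z.1)) (0, p) := by fun_prop
    exact hc.eventually ((eventually_goodReturn hE hω hh hμ hn hR hI2 p.1).and
      (eventually_twist hE hω hh hμ hn hR hI2 hne p.1))
  obtain ⟨ε₀, h0, H⟩ := Metric.eventually_nhds_iff.1 this
  exact ⟨ε₀, h0, fun ε hε => H (by simpa [Real.dist_eq] using hε)⟩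

/-- The properties of the lift of the first return map, uniformly on the strip. -/
theorem exists_lift (hE : 0 < E) (hω : 0 < ω) (hh : 0 < h) (hμ : 0 < μ)
    (hEω : ω ^ 2 / 2 < E) (hn : 1 ≤ n) (hR : RadialFamily n δ (bdryRadius f)) {a b : ℝ}
    (hab : Icc a b ⊆ Ioo (-criticalAction E ω) (criticalAction E ω) \ criticalSet E ω h μ) :
    ∃ ε₀, 0 < ε₀ ∧ ∀ ε, |ε| < ε₀ → |ε| < δ ∧ ∃ Φ : ℝ × ℝ → ℝ × ℝ,
      ∀ p ∈ univ ×ˢ Icc a b,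
        IsFirstReturn E ω h μ f ε p.1 p.2 (Φ p).1 (Φ p).2 ∧ ContDiffAt ℝ n Φ p ∧
        ∃ L : ℝ × ℝ →L[ℝ] ℝ × ℝ, HasFDerivAt Φ L p ∧ L.det = 1 ∧ (L (0, 1)).1 ≠ 0 := by
  obtain ⟨ε₀, h0, H⟩ := exists_uniform_goodReturn hE hω hh hμ hEω hn hR hab
  refine ⟨min ε₀ δ, lt_min h0 hR.pos, fun ε hε => ?_⟩
  have hεδ := hε.trans_le (min_le_right _ _)
  refine ⟨hεδ, fun p => returnLift E ω h μ f (p.1, p.2, ε), ?_⟩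
  rintro ⟨ξ, I⟩ ⟨-, hI⟩
  set Φ : ℝ × ℝ → ℝ × ℝ := fun p => returnLift E ω h μ f (p.1, p.2, ε) with hΦ
  have hn' : (1 : WithTop ℕ∞) ≤ n := by exact_mod_cast hn
  have h4π : 0 < 4 * Real.pi := by positivity
  obtain ⟨m, hm, -⟩ := existsUnique_sub_zsmul_mem_Ico h4π ξ 0
  simp only [zero_add] at hm
  set c : ℝ × ℝ := (m • (4 * Real.pi), 0) with hc
  -- Since `Φ - id` has period `4π` in `ξ`, all properties at `(ξ, I)` are transported from the
  -- representative `ξ'` in `[0, 4π)`.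
  have hper : Function.Periodic (fun p => Φ p - p) (4 * Real.pi, 0) := fun p => by
    simp only [hΦ, Prod.fst_add, Prod.snd_add, add_zero,
      returnLift_add_four_pi hE hω hh hμ hR hεδ]
    abel
  have hshift : ∀ p, Φ p = Φ (p - c) + c := fun p => by
    have h1 := hper.sub_zsmul_eq (x := p) m
    have h2 : m • ((4 * Real.pi, 0) : ℝ × ℝ) = c := by ext <;> simp [hc]
    simp only [h2] at h1
    rw [← sub_eq_iff_eq_add, ← sub_left_inj (a := p - c), h1]
    abel
  set ξ' := ξ - m • (4 * Real.pi) with hξ'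
  have hpc : ((ξ, I) : ℝ × ℝ) - c = (ξ', I) := by ext <;> simp [hc, hξ']
  obtain ⟨hG, htw⟩ := H ε (hε.trans_le (min_le_left _ _)) (ξ', I) ⟨Ico_subset_Icc_self hm, hI⟩
  have hslice : HasFDerivAt (fun p : ℝ × ℝ => ((p.1, p.2, ε) : ℝ × ℝ × ℝ))
      ((ContinuousLinearMap.fst ℝ ℝ ℝ).prod ((ContinuousLinearMap.snd ℝ ℝ ℝ).prod 0)) (ξ', I) :=
    hasFDerivAt_fst.prodMk (hasFDerivAt_snd.prodMk (hasFDerivAt_const _ _))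
  have hsub : HasFDerivAt (fun p : ℝ × ℝ => p - c) (ContinuousLinearMap.id ℝ (ℝ × ℝ)) (ξ, I) :=
    (hasFDerivAt_id _).sub_const c
  have hcd : ContDiffAt ℝ n Φ (ξ', I) :=
    hG.contDiffAt.comp (ξ', I) (f := fun p : ℝ × ℝ => ((p.1, p.2, ε) : ℝ × ℝ × ℝ)) (by fun_prop)
  obtain ⟨L, hL, hdet⟩ := hG.hasFDerivAt hE hω hh hμ hn hR
  have hΦc : Φ = fun p => Φ (p - c) + c := funext hshift
  refine ⟨?_, ?_, L, ?_, hdet, ?_⟩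
  · have hcoe : ((m • (4 * Real.pi) : ℝ) : AddCircle (2 * Real.pi)) = 0 :=
      (AddCircle.coe_eq_zero_iff _).2 ⟨2 * m, by simp; ring⟩
    have h1 := hG.isFirstReturn hE hω hh hμ hR
    have h2 : Φ (ξ, I) = Φ (ξ', I) + c := by rw [hshift, hpc]
    change IsFirstReturn E ω h μ f ε ξ I (Φ (ξ, I)).1 (Φ (ξ, I)).2
    rw [h2]
    have h3 : (Φ (ξ', I) + c).2 = (Φ (ξ', I)).2 := by simp [hc]
    rw [h3]
    refine h1.congr hR hεδ ?_ ?_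
    · rw [hξ', AddCircle.coe_sub, hcoe, sub_zero]
    · change _ = (((Φ (ξ', I)).1 + m • (4 * Real.pi) : ℝ) : AddCircle (2 * Real.pi))
      rw [AddCircle.coe_add, hcoe, add_zero]
  · rw [hΦc]
    refine (ContDiffAt.comp (ξ, I) (f := fun p => p - c) (g := Φ) ?_ (by fun_prop)).add
      contDiffAt_const
    rw [hpc]; exact hcd
  · rw [hΦc]
    have h1 : HasFDerivAt Φ L ((fun p : ℝ × ℝ => p - c) (ξ, I)) := by
      simp only [hpc]; exact hL
    simpa using (h1.comp (ξ, I) hsub).add_const c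
  · have h1 := HasFDerivAt.comp (ξ', I) (f := fun p : ℝ × ℝ => ((p.1, p.2, ε) : ℝ × ℝ × ℝ))
      ((hG.contDiffAt.of_le hn').differentiableAt (by simp)).hasFDerivAt hslice
    rw [hL.unique h1]
    simpa using htw

end GalacticBilliard

end

/-! ### The proposition. -/

theorem mainTheorem3
    (E ω h μ : ℝ) (hE : 0 < E) (hω : 0 < ω) (hh : 0 < h) (hμ : 0 < μ) (hEω : ω ^ 2 / 2 < E)
    (k : ℕ) (hk : 2 ≤ k) (C : ℝ) (hC : 0 < C) (f : ℝ → ℝ → ℝ)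
    (hper : ∀ ε ∈ Set.Icc (-C) C, Function.Periodic (fun ξ => f ξ ε) (2 * Real.pi))
    (hf : ContDiffOn ℝ (k : WithTop ℕ∞) (fun x : ℝ × ℝ => f x.1 x.2)
      (Set.univ ×ˢ Set.Icc (-C) C)) :
    (GalacticBilliard.criticalSet E ω h μ).Finite ∧
    ∀ a b : ℝ, a < b →
      Set.Icc a b ⊆ Set.Ioo (-GalacticBilliard.criticalAction E ω)
        (GalacticBilliard.criticalAction E ω) \ GalacticBilliard.criticalSet E ω h μ →
      ∃ ε₀ : ℝ, 0 < ε₀ ∧ ∀ ε : ℝ, |ε| < ε₀ →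
        -- `F` is the first return map on the annulus and `Φ` is a lift of it to the strip
        ∃ (F : GalacticBilliard.Cylinder → GalacticBilliard.Cylinder) (Φ : ℝ × ℝ → ℝ × ℝ),
          (∀ ξ₀ : ℝ, ∀ I₀ ∈ Set.Icc a b, ∀ ξ₁ I₁ : ℝ,
            GalacticBilliard.IsFirstReturn E ω h μ f ε ξ₀ I₀ ξ₁ I₁ ↔
              F ((ξ₀ : AddCircle (2 * Real.pi)), I₀) = ((ξ₁ : AddCircle (2 * Real.pi)), I₁)) ∧
          (∀ ξ₀ : ℝ, ∀ I₀ ∈ Set.Icc a b,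
            F ((ξ₀ : AddCircle (2 * Real.pi)), I₀) =
              (((Φ (ξ₀, I₀)).1 : AddCircle (2 * Real.pi)), (Φ (ξ₀, I₀)).2)) ∧
          ContDiffOn ℝ ((k - 2 : ℕ) : WithTop ℕ∞) Φ (Set.univ ×ˢ Set.Icc a b) ∧
          -- area preservation, for subsets and infinitesimally
          GalacticBilliard.PreservesAreaOn F (GalacticBilliard.annulus a b) ∧
          (∀ ξ₀ : ℝ, ∀ I₀ ∈ Set.Icc a b, ∃ L : ℝ × ℝ →L[ℝ] ℝ × ℝ,
            HasFDerivWithinAt Φ L (Set.univ ×ˢ Set.Icc a b) (ξ₀, I₀) ∧ L.det = 1) ∧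
          -- the twist condition
          (∀ ξ₀ : ℝ, ∀ I₀ ∈ Set.Icc a b, ∃ d : ℝ,
            HasDerivWithinAt (fun I => (Φ (ξ₀, I)).1) d (Set.Icc a b) I₀ ∧ d ≠ 0) := by
  refine ⟨GalacticBilliard.criticalSet_finite hE hω hh hμ hEω, fun a b _ hab => ?_⟩
  -- One derivative is spent on the tangent of the boundary, so the lift is of class `C^(k-1)`. With
  -- `k ≥ 2` it is at least `C¹`, as twist and determinant require.
  obtain ⟨n, rfl⟩ : ∃ n, k = n + 1 := ⟨k - 1, by omega⟩
  have hn : 1 ≤ n := by omega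
  obtain ⟨δ, hR⟩ := GalacticBilliard.exists_radialFamily hC hper hf
  obtain ⟨ε₀, h0, H⟩ := GalacticBilliard.exists_lift hE hω hh hμ hEω hn hR hab
  refine ⟨ε₀, h0, fun ε hε => ?_⟩
  obtain ⟨hεδ, Φ, hΦ⟩ := H ε hε
  have hout : ∀ ξ : ℝ, ((Quotient.out (ξ : AddCircle (2 * Real.pi)) : ℝ) :
      AddCircle (2 * Real.pi)) = ξ := fun ξ => QuotientAddGroup.out_eq' _
  -- A representative of the angle is chosen arbitrarily; `hiff` shows that over the annulus the
  -- choice does not matter, and outside it the values are irrelevant.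
  let F : GalacticBilliard.Cylinder → GalacticBilliard.Cylinder := fun c =>
    GalacticBilliard.proj (Φ (Quotient.out c.1, c.2))
  have hiff : ∀ ξ₀ : ℝ, ∀ I₀ ∈ Set.Icc a b, ∀ ξ₁ I₁ : ℝ,
      GalacticBilliard.IsFirstReturn E ω h μ f ε ξ₀ I₀ ξ₁ I₁ ↔
        F ((ξ₀ : AddCircle (2 * Real.pi)), I₀) = ((ξ₁ : AddCircle (2 * Real.pi)), I₁) := by
    intro ξ₀ I₀ hI₀ ξ₁ I₁
    have hr := (hΦ (Quotient.out (ξ₀ : AddCircle (2 * Real.pi)), I₀) ⟨trivial, hI₀⟩).1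
    constructor
    · intro h1
      obtain ⟨e1, e2⟩ := hr.unique hω hR hεδ (h1.congr hR hεδ (hout ξ₀).symm rfl)
      exact Prod.ext e1 e2
    · intro h1
      have e1 := congrArg Prod.fst h1
      have e2 : _ = I₁ := congrArg Prod.snd h1
      rw [← e2]
      exact hr.congr hR hεδ (hout ξ₀) e1
  have hlift : ∀ ξ₀ : ℝ, ∀ I₀ ∈ Set.Icc a b, F ((ξ₀ : AddCircle (2 * Real.pi)), I₀) =
      (((Φ (ξ₀, I₀)).1 : AddCircle (2 * Real.pi)), (Φ (ξ₀, I₀)).2) := fun ξ₀ I₀ hI₀ =>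
    (hiff ξ₀ I₀ hI₀ _ _).1 (hΦ (ξ₀, I₀) ⟨trivial, hI₀⟩).1
  refine ⟨F, Φ, hiff, hlift, fun p hp => ?_, ?_, fun ξ₀ I₀ hI₀ => ?_, fun ξ₀ I₀ hI₀ => ?_⟩
  · exact ((hΦ p hp).2.1.of_le (by exact_mod_cast (by omega : n + 1 - 2 ≤ n))).contDiffWithinAt
  · refine GalacticBilliard.preservesAreaOn_of_lift (Φ := Φ) (fun p hp => hlift p.1 p.2 hp.2)
      (fun p hp q hq hpq => ?_) fun p hp => ?_
    · have h1 := (hΦ p hp).1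
      have h2 := (hiff q.1 q.2 hq.2 _ _).2 (hpq.symm.trans (hlift p.1 p.2 hp.2))
      obtain ⟨e1, e2⟩ := h1.injective hω hR hεδ h2
      exact Prod.ext e1 e2
    · obtain ⟨L, hL, hdet, -⟩ := (hΦ p hp).2.2
      exact ⟨L, hL, hdet⟩
  · obtain ⟨L, hL, hdet, -⟩ := (hΦ (ξ₀, I₀) ⟨trivial, hI₀⟩).2.2
    exact ⟨L, hL.hasFDerivWithinAt, hdet⟩
  · obtain ⟨L, hL, -, htw⟩ := (hΦ (ξ₀, I₀) ⟨trivial, hI₀⟩).2.2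
    refine ⟨(L (0, 1)).1, HasDerivAt.hasDerivWithinAt ?_, htw⟩
    exact (ContinuousLinearMap.fst ℝ ℝ ℝ).hasFDerivAt.comp_hasDerivAt I₀
      (HasFDerivAt.comp_hasDerivAt I₀ (f := fun I : ℝ => (ξ₀, I)) hL
        ((hasDerivAt_const I₀ ξ₀).prodMk (hasDerivAt_id I₀)))
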